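/- Let $n\in\mathbb N$ and $p,\delta,\sigma\in\mathbb R$ satisfy $n+1>p>\max\{2,n\}$, $\delta>(p-n)^{-1}$ (so $\delta>1$) and $0<\sigma<1$. Put $$g(s)=\bigl(s+\delta^{-\frac1{\delta-1}}\bigr)^{\delta}-\delta^{-\frac{\delta}{\delta-1}},\qquad j(t)=\bigl(t+\sigma^{\frac1{1-\sigma}}\bigr)^{\sigma}-\sigma^{\frac{\sigma}{1-\sigma}},$$ and let $M_g=([0,\infty)\times\mathbb S^n,\ ds^2+g(s)^2d\theta^2)$ and $N_j=([0,\infty)\times\mathbb S^n,\ dt^2+j(t)^2d\theta^2)$, where $d\theta^2$ is the round metric of the unit sphere $\mathbb S^n$ and $\{0\}\times\mathbb S^n$ is collapsed to a point, the pole. A map $F:M_g\to N_j$ is called $C^2$ rotationally symmetric if $F(s,\theta)=(f(s),\theta)$ with a profile $f\in C^2([0,\infty))$, $f\ge 0$, $f(0)=0$; it is called $p$-harmonic if it maps the complement of the pole to the complement of the pole and satisfies $\operatorname{div}(|dF|^{p-2}dF)=0$ at all points other than the pole. For real functions, $\Delta_p u=\operatorname{div}(|du|^{p-2}du)$. Let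 $\mathcal C$ be the set of all functions $H:N_j\to\mathbb R$ with $H(t,\theta)=h(t)$ for $t>0$, where $h\in C^2([0,\infty))$ and $h'(t)>0$ for $t>0$, that are convex, i.e. have nonnegative Riemannian Hessian off the pole. Then there exist a $C^2$ rotationally symmetric $p$-harmonic map $F:M_g\to N_j$ and a sequence of positive numbers $s_k\to+\infty$ such that, for every $H\in\mathcal C$, there is $k_0=k_0(H)$ with $$\Delta_p(H\circ F)(s_k,\theta)<0\qquad\text{for all }k\ge k_0\text{ and all }\theta\in\mathbb S^n .$$ In particular, there is $H\in\mathcal C$ such that $\Delta_p(H\circ F)\ge 0$ fails at some point of $M_g$ other than the pole, so the composition of a $p$-harmonic map with a convex function need not be $p$-subharmonic. -/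

import Mathlib

noncomputable section

namespace PHarm

/-! ## Riemannian geometry in a coordinate domain of Euclidean space

A Riemannian metric is given by its matrix `G x` of components in Cartesian coordinates. -/

section Coordinates

variable {ι κ : Type*} [Fintype ι] [DecidableEq ι] [Fintype κ] [DecidableEq κ]

/-- The partial derivative `∂u/∂xᵢ` at `x`. -/
def pd (i : ι) (u : EuclideanSpace ℝ ι → ℝ) (x : EuclideanSpace ℝ ι) : ℝ :=
  fderiv ℝ u x (EuclideanSpace.single i 1)

/-- The Christoffel symbol `Γᵏᵢⱼ` of the Levi-Civita connection of the metric `G` at `x`. -/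
def christoffel (G : EuclideanSpace ℝ ι → Matrix ι ι ℝ) (k i j : ι)
    (x : EuclideanSpace ℝ ι) : ℝ :=
  (1 / 2 : ℝ) * ∑ l, (G x)⁻¹ k l *
    (pd i (fun y => G y j l) x + pd j (fun y => G y i l) x - pd l (fun y => G y i j) x)

/-- The component `(∇du)ᵢⱼ = ∂ᵢ∂ⱼu - Γᵏᵢⱼ ∂ₖu` of the Riemannian Hessian of `u`. -/
def hessian (G : EuclideanSpace ℝ ι → Matrix ι ι ℝ) (u : EuclideanSpace ℝ ι → ℝ)
    (x : EuclideanSpace ℝ ι) (i j : ι) : ℝ :=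
  pd i (pd j u) x - ∑ k, christoffel G k i j x * pd k u x

/-- A `C²` function is convex on `U` when its Riemannian Hessian is a nonnegative quadratic form
at every point of `U`. -/
def IsConvexOn (G : EuclideanSpace ℝ ι → Matrix ι ι ℝ) (U : Set (EuclideanSpace ℝ ι))
    (u : EuclideanSpace ℝ ι → ℝ) : Prop :=
  ContDiffOn ℝ 2 u U ∧
    ∀ x ∈ U, ∀ v : ι → ℝ, 0 ≤ ∑ i, ∑ j, hessian G u x i j * v i * v j

/-- The Hilbert-Schmidt norm `|dF|` of the differential of a map `F` from the metric `G` to the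
metric `K`: `|dF|² = Gⁱʲ K_ab(F) ∂ᵢFᵃ ∂ⱼFᵇ`. -/
def diffNorm (G : EuclideanSpace ℝ ι → Matrix ι ι ℝ) (K : EuclideanSpace ℝ κ → Matrix κ κ ℝ)
    (F : EuclideanSpace ℝ ι → EuclideanSpace ℝ κ) (x : EuclideanSpace ℝ ι) : ℝ :=
  Real.sqrt (∑ i, ∑ j, ∑ a, ∑ b,
    (G x)⁻¹ i j * K (F x) a b * pd i (fun y => F y a) x * pd j (fun y => F y b) x)

/-- The component `|dF|^(p-2) ∂ⱼFᵃ` of the `F⁻¹TN`-valued one-form `|dF|^(p-2) dF`. -/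
def pFlux (p : ℝ) (G : EuclideanSpace ℝ ι → Matrix ι ι ℝ)
    (K : EuclideanSpace ℝ κ → Matrix κ κ ℝ)
    (F : EuclideanSpace ℝ ι → EuclideanSpace ℝ κ) (a : κ) (j : ι)
    (x : EuclideanSpace ℝ ι) : ℝ :=
  diffNorm G K F x ^ (p - 2) * pd j (fun y => F y a) x

/-- The `a`-th component of the `p`-tension field `τ_p(F) = div(|dF|^(p-2) dF)`: the trace with
respect to `G` of the covariant derivative of the `F⁻¹TN`-valued one-form `ω = |dF|^(p-2) dF`, that
is `Gⁱʲ (∂ᵢ ωᵃⱼ - Γᵏᵢⱼ ωᵃₖ + Γᵃ_bc(F) ∂ᵢFᵇ ωᶜⱼ)`. -/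
def pTension (p : ℝ) (G : EuclideanSpace ℝ ι → Matrix ι ι ℝ)
    (K : EuclideanSpace ℝ κ → Matrix κ κ ℝ)
    (F : EuclideanSpace ℝ ι → EuclideanSpace ℝ κ) (x : EuclideanSpace ℝ ι) (a : κ) : ℝ :=
  ∑ i, ∑ j, (G x)⁻¹ i j *
    (pd i (pFlux p G K F a j) x
      - ∑ k, christoffel G k i j x * pFlux p G K F a k x
      + ∑ b, ∑ c, christoffel K a b c (F x) * pd i (fun y => F y b) x * pFlux p G K F c j x)

/-- `F` is a `C²` map from `U` (with metric `G`) to `V` (with metric `K`) which solves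
`τ_p(F) = 0` on `U`. -/
def IsPHarmonicOn (p : ℝ) (G : EuclideanSpace ℝ ι → Matrix ι ι ℝ) (U : Set (EuclideanSpace ℝ ι))
    (K : EuclideanSpace ℝ κ → Matrix κ κ ℝ) (V : Set (EuclideanSpace ℝ κ))
    (F : EuclideanSpace ℝ ι → EuclideanSpace ℝ κ) : Prop :=
  Set.MapsTo F U V ∧ ContDiffOn ℝ 2 F U ∧ ∀ x ∈ U, ∀ a, pTension p G K F x a = 0

/-- The `p`-Laplacian of a real function: the `p`-tension field of the corresponding map into the
Euclidean line. -/
def pLaplacian (p : ℝ) (G : EuclideanSpace ℝ ι → Matrix ι ι ℝ) (u : EuclideanSpace ℝ ι → ℝ)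
    (x : EuclideanSpace ℝ ι) : ℝ :=
  pTension p G (fun _ => (1 : Matrix (Fin 1) (Fin 1) ℝ))
    (fun y => EuclideanSpace.single (0 : Fin 1) (u y)) x 0

end Coordinates

/-! ## Rotationally symmetric manifolds, maps and functions

The manifold `[0,∞) × 𝕊ⁿ` (with `{0} × 𝕊ⁿ` collapsed to the pole) is `ℝⁿ⁺¹`, the point `(s, θ)`
being the vector `s • θ`. -/

/-- The components of the warped product metric `ds² + w(s)² dθ²` at a point `x ≠ 0` of `ℝⁿ⁺¹`, where
`s = ‖x‖` and `θ = x / ‖x‖` are the polar coordinates and `dθ²` is the round metric of the unit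
sphere. (The value at the pole `0` is not used.) -/
def warpedMetric (n : ℕ) (w : ℝ → ℝ) (x : EuclideanSpace ℝ (Fin (n + 1))) :
    Matrix (Fin (n + 1)) (Fin (n + 1)) ℝ :=
  Matrix.of fun i j =>
    pd i (fun y => ‖y‖) x * pd j (fun y => ‖y‖) x
      + w ‖x‖ ^ 2 *
        inner ℝ
          (fderiv ℝ (fun y : EuclideanSpace ℝ (Fin (n + 1)) => ‖y‖⁻¹ • y) x
            (EuclideanSpace.single i 1))
          (fderiv ℝ (fun y : EuclideanSpace ℝ (Fin (n + 1)) => ‖y‖⁻¹ • y) x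
            (EuclideanSpace.single j 1))

/-- The warped product metric in Cartesian coordinates, off the pole. -/
theorem warpedMetric_apply (n : ℕ) (w : ℝ → ℝ) {x : EuclideanSpace ℝ (Fin (n + 1))} (hx : x ≠ 0)
    (i j : Fin (n + 1)) :
    warpedMetric n w x i j = x i * x j / ‖x‖ ^ 2
      + w ‖x‖ ^ 2 / ‖x‖ ^ 2 * ((if i = j then 1 else 0) - x i * x j / ‖x‖ ^ 2) := by
  have hr : ‖x‖ ≠ 0 := norm_ne_zero_iff.mpr hx
  have h1 : HasFDerivAt (fun y : EuclideanSpace ℝ (Fin (n + 1)) => ‖y‖)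
      (‖x‖⁻¹ • innerSL ℝ x) x := by
    have h := ((hasStrictFDerivAt_norm_sq x).hasFDerivAt).sqrt (by positivity)
    simp only [Real.sqrt_sq (norm_nonneg _)] at h
    refine h.congr_fderiv ?_
    ext v
    simp
    field_simp
  have h2 := ((hasDerivAt_inv hr).comp_hasFDerivAt x h1).smul (hasFDerivAt_id x)
  have h3 : fderiv ℝ (fun y : EuclideanSpace ℝ (Fin (n + 1)) => ‖y‖⁻¹ • y) x = _ := h2.fderiv
  simp only [warpedMetric, pd, Matrix.of_apply, h1.fderiv, h3]
  simp [inner_add_left, inner_add_right, inner_smul_left, inner_smul_right, EuclideanSpace.inner_single_left, EuclideanSpace.inner_single_right, PiLp.single_apply]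
  rcases eq_or_ne i j with rfl | hij
  · simp
    field_simp
    ring
  · simp [hij, hij.symm]
    field_simp
    ring

/-- The warping function `g(s) = (s + δ^(-1/(δ-1)))^δ - δ^(-δ/(δ-1))`. -/
def gWarp (δ s : ℝ) : ℝ := (s + δ ^ (-1 / (δ - 1))) ^ δ - δ ^ (-δ / (δ - 1))

/-- The warping function `j(t) = (t + σ^(1/(1-σ)))^σ - σ^(σ/(1-σ))`. -/
def jWarp (σ t : ℝ) : ℝ := (t + σ ^ (1 / (1 - σ))) ^ σ - σ ^ (σ / (1 - σ))

/-- `F` is the `C²` rotationally symmetric map `F(s, θ) = (f(s), θ)` with profile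
`f ∈ C²([0,∞))`, `f ≥ 0`. (The case `s = 0` of the last clause forces `f 0 = 0`, that is,
`F` maps the pole to the pole.) -/
def IsRotSymMap (n : ℕ) (F : EuclideanSpace ℝ (Fin (n + 1)) → EuclideanSpace ℝ (Fin (n + 1)))
    (f : ℝ → ℝ) : Prop :=
  ContDiffOn ℝ 2 f (Set.Ici 0) ∧ (∀ s, 0 ≤ s → 0 ≤ f s) ∧
    ∀ s, 0 ≤ s → ∀ θ ∈ Metric.sphere (0 : EuclideanSpace ℝ (Fin (n + 1))) 1,
      F (s • θ) = f s • θ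

/-- `H` is the `C²` rotationally symmetric function `H(t, θ) = h(t)` with profile
`h ∈ C²([0,∞))`. -/
def IsRotSymFun (n : ℕ) (H : EuclideanSpace ℝ (Fin (n + 1)) → ℝ) (h : ℝ → ℝ) : Prop :=
  ContDiffOn ℝ 2 h (Set.Ici 0) ∧
    ∀ t, 0 < t → ∀ θ ∈ Metric.sphere (0 : EuclideanSpace ℝ (Fin (n + 1))) 1, H (t • θ) = h t

end PHarm

end

/-! Put `ν = n`, `m = n + 1 - p > 0`, `y = j(f)/g` and `Z = f' g / j(f)`, so that `|dF|² = y² (Z² +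
ν)`. By symmetry only the radial component of the `p`-tension field survives, and its vanishing is
an ODE for `f`. In the variable `x = log g`, with `a = 1/g'` and `P = Z (Z² + ν)^((p-2)/2)`, this
ODE becomes `P' = -m P + a j'(f) C(P)`, `f' = j(f) a Z`, where `C` satisfies `dC/dP = -p Z`.

As `x → -∞` (the pole) both `a` and `j'(f)` tend to `1` and `Z = 1` is the equilibrium. As `x → ∞`,
`a` is at most `e^(-k x)` with `k = (δ-1)/δ`, and the hypothesis `δ > 1/(p-n)` says exactly that `m
< k`. The source is then negligible: `P` and `Z` decay like `e^(-m x)`, `f` stays bounded, and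
`1/(g' Z) → 0`. Hence `g f''/(g' f') → -1 - m`, and since `n = m + p - 1`, `(p-1) f'' + n (g'/g) f'`
is asymptotic to `-m (p-2) (g'/g) f'`, which is negative because `p > 2`.

For `H = h(t)` with `h' > 0`, `Δ_p(H ∘ F)` is a positive multiple of `(p-1)(f'' + (h''/h') f'²) + n
(g'/g) f'`. For `s ≥ 1` the values of `f` lie in a compact subset of `(0,∞)`, so `h''/h'` is bounded
along `f`, while `f'²` is negligible against `(g'/g) f'`. The sign is therefore negative for all
large `s`. The distance to the pole, whose Hessian is `j j' dθ²`, is an admissible `H`.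

The solution is found in `exists_profile` as a fixed point among bounded functions on the whole
line; boundedness at `-∞` replaces an initial condition at the singular pole. Writing `f = e(y)`
with `e' = j(e)` (here `y` is the flow time) and starting from a very negative `y(0)` makes `j'(f)`
depend weakly on `P`, which gives a contraction. `exists_phase_solution` extracts the asymptotics at
both ends, `contDiffOn_profile` the regularity at the pole, and `eventually_radial_neg` the sign.
The geometry enters through `pTension_rotSym`, `pLaplacian_radial` and `isConvexOn_norm`. -/

noncomputable section

namespace PHarm

open Filter Topology Asymptotics

set_option linter.unusedSectionVars false

/-! ### Partial derivatives and the splitting into radial and tangential directions. -/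

section Partial

variable {ι : Type*} [Fintype ι] [DecidableEq ι]

/-- `u` is differentiable at `x` with partial derivatives `D i`. -/
def HasPd (u : EuclideanSpace ℝ ι → ℝ) (D : ι → ℝ) (x : EuclideanSpace ℝ ι) : Prop :=
  DifferentiableAt ℝ u x ∧ ∀ i, pd i u x = D i

theorem HasPd.pd {u : EuclideanSpace ℝ ι → ℝ} {D : ι → ℝ} {x : EuclideanSpace ℝ ι}
    (h : HasPd u D x) (i : ι) : pd i u x = D i := h.2 i

theorem HasFDerivAt.hasPd {u : EuclideanSpace ℝ ι → ℝ} {u' : EuclideanSpace ℝ ι →L[ℝ] ℝ}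
    {x : EuclideanSpace ℝ ι} (h : HasFDerivAt u u' x) :
    HasPd u (fun i => u' (EuclideanSpace.single i 1)) x :=
  ⟨h.differentiableAt, fun i => by rw [PHarm.pd, h.fderiv]⟩

theorem HasPd.congr {u v : EuclideanSpace ℝ ι → ℝ} {D E : ι → ℝ} {x : EuclideanSpace ℝ ι}
    (h : HasPd u D x) (huv : v =ᶠ[𝓝 x] u) (hDE : ∀ i, D i = E i) : HasPd v E x :=
  ⟨h.1.congr_of_eventuallyEq huv, fun i => by
    rw [PHarm.pd, huv.fderiv_eq, ← hDE i]; exact h.2 i⟩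

theorem hasPd_const (c : ℝ) (x : EuclideanSpace ℝ ι) : HasPd (fun _ => c) (fun _ => 0) x :=
  ⟨differentiableAt_const c, fun i => by simp [PHarm.pd]⟩

theorem HasPd.add {u v : EuclideanSpace ℝ ι → ℝ} {D E : ι → ℝ} {x : EuclideanSpace ℝ ι}
    (hu : HasPd u D x) (hv : HasPd v E x) :
    HasPd (fun y => u y + v y) (fun i => D i + E i) x :=
  ⟨hu.1.add hv.1, fun i => by
    simp only [← hu.2 i, ← hv.2 i]; rw [PHarm.pd, fderiv_fun_add hu.1 hv.1]; rfl⟩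

theorem HasPd.mul {u v : EuclideanSpace ℝ ι → ℝ} {D E : ι → ℝ} {x : EuclideanSpace ℝ ι}
    (hu : HasPd u D x) (hv : HasPd v E x) :
    HasPd (fun y => u y * v y) (fun i => u x * E i + D i * v x) x :=
  ⟨hu.1.mul hv.1, fun i => by
    simp only [← hu.2 i, ← hv.2 i]; rw [PHarm.pd, fderiv_fun_mul hu.1 hv.1]
    simp [PHarm.pd, mul_comm]⟩

theorem hasPd_coord (j : ι) (x : EuclideanSpace ℝ ι) :
    HasPd (fun y => y j) (fun i => if i = j then 1 else 0) x := by
  have h : HasFDerivAt (fun y : EuclideanSpace ℝ ι => y j)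
      (EuclideanSpace.proj j : EuclideanSpace ℝ ι →L[ℝ] ℝ) x :=
    (EuclideanSpace.proj j : EuclideanSpace ℝ ι →L[ℝ] ℝ).hasFDerivAt
  refine (HasFDerivAt.hasPd h).congr EventuallyEq.rfl fun i => ?_
  simp [PiLp.single_apply, eq_comm]

theorem hasPd_radial {R : ℝ → ℝ} {R' : ℝ} {x : EuclideanSpace ℝ ι} (hx : x ≠ 0)
    (hR : HasDerivAt R R' ‖x‖) :
    HasPd (fun y => R ‖y‖) (fun i => R' * (x i / ‖x‖)) x := by
  have hr : ‖x‖ ≠ 0 := norm_ne_zero_iff.mpr hx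
  have h1 : HasFDerivAt (fun y : EuclideanSpace ℝ ι => ‖y‖) (‖x‖⁻¹ • innerSL ℝ x) x := by
    have h := ((hasStrictFDerivAt_norm_sq x).hasFDerivAt).sqrt (by positivity)
    simp only [Real.sqrt_sq (norm_nonneg _)] at h
    refine h.congr_fderiv ?_
    ext v
    simp
    field_simp
  refine (HasFDerivAt.hasPd (hR.comp_hasFDerivAt x h1)).congr EventuallyEq.rfl fun i => ?_
  simp [EuclideanSpace.inner_single_right, div_eq_inv_mul]

/-- The components of the orthogonal projection onto the tangent space of the sphere `‖y‖ = ‖x‖`. -/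
def tanProj (x : EuclideanSpace ℝ ι) (i j : ι) : ℝ :=
  (if i = j then 1 else 0) - x i / ‖x‖ * (x j / ‖x‖)

theorem tanProj_comm (x : EuclideanSpace ℝ ι) (i j : ι) : tanProj x i j = tanProj x j i := by
  simp only [tanProj, eq_comm (a := i) (b := j)]; ring

/-- With `N = x/‖x‖` and `T` the tangential projection, this and the next two lemmas are `|N| = 1`,
`T N = 0` and `T² = T`; every contraction of indices below reduces to them. -/
theorem sum_unit_sq {x : EuclideanSpace ℝ ι} (hx : x ≠ 0) :
    ∑ i, x i / ‖x‖ * (x i / ‖x‖) = 1 := by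
  have hr : ‖x‖ ≠ 0 := norm_ne_zero_iff.mpr hx
  have h := EuclideanSpace.real_norm_sq_eq x
  have : ∑ i, x i / ‖x‖ * (x i / ‖x‖) = (∑ i, x i ^ 2) / ‖x‖ ^ 2 := by
    rw [Finset.sum_div]; exact Finset.sum_congr rfl fun i _ => by ring
  rw [this, ← h]; field_simp

theorem sum_tanProj_unit {x : EuclideanSpace ℝ ι} (hx : x ≠ 0) (i : ι) :
    ∑ j, tanProj x i j * (x j / ‖x‖) = 0 := by
  have h : ∀ j, tanProj x i j * (x j / ‖x‖)
      = (if i = j then x j / ‖x‖ else 0) - x i / ‖x‖ * (x j / ‖x‖ * (x j / ‖x‖)) := by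
    intro j; simp only [tanProj]; split_ifs <;> ring
  simp only [h, Finset.sum_sub_distrib, ← Finset.mul_sum, sum_unit_sq hx]
  simp

theorem sum_tanProj_mul {x : EuclideanSpace ℝ ι} (hx : x ≠ 0) (i k : ι) :
    ∑ j, tanProj x i j * tanProj x j k = tanProj x i k := by
  have h : ∀ j, tanProj x i j * tanProj x j k
      = (if j = k then tanProj x i j else 0) - x k / ‖x‖ * (tanProj x i j * (x j / ‖x‖)) := by
    intro j; rw [tanProj, tanProj]; split_ifs <;> ring
  simp only [h, Finset.sum_sub_distrib, ← Finset.mul_sum, sum_tanProj_unit hx]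
  simp

theorem hasPd_unit {x : EuclideanSpace ℝ ι} (hx : x ≠ 0) (j : ι) :
    HasPd (fun y => y j / ‖y‖) (fun i => tanProj x i j / ‖x‖) x := by
  have hr : ‖x‖ ≠ 0 := norm_ne_zero_iff.mpr hx
  have h := (hasPd_coord j x).mul (hasPd_radial hx (hasDerivAt_inv hr))
  refine h.congr (by simp only [div_eq_mul_inv]; rfl) fun i => ?_
  simp only [tanProj]
  split_ifs <;> field_simp <;> ring

theorem eventually_ne_zero {x : EuclideanSpace ℝ ι} (hx : x ≠ 0) : ∀ᶠ y in 𝓝 x, y ≠ 0 :=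
  isOpen_ne.mem_nhds hx

end Partial

/-! ### Inverse, derivatives and Christoffel symbols of a warped product metric. -/

section Warped

variable {n : ℕ}

theorem trace_tanProj {x : EuclideanSpace ℝ (Fin (n + 1))} (hx : x ≠ 0) :
    ∑ i, tanProj x i i = n := by
  simp only [tanProj, Finset.sum_sub_distrib, sum_unit_sq hx]
  simp

theorem warpedMetric_eq {w : ℝ → ℝ} {x : EuclideanSpace ℝ (Fin (n + 1))} (hx : x ≠ 0)
    (i j : Fin (n + 1)) :
    warpedMetric n w x i j
      = x i / ‖x‖ * (x j / ‖x‖) + w ‖x‖ ^ 2 / ‖x‖ ^ 2 * tanProj x i j := by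
  rw [warpedMetric_apply n w hx, tanProj]
  ring

theorem sum_tanProj_unit' {x : EuclideanSpace ℝ (Fin (n + 1))} (hx : x ≠ 0) (j : Fin (n + 1)) :
    ∑ i, x i / ‖x‖ * tanProj x i j = 0 := by
  rw [← sum_tanProj_unit hx j]
  exact Finset.sum_congr rfl fun i _ => by rw [tanProj_comm]; ring

/-- The metric is `N ⊗ N + (w/r)² T` with complementary projections `N ⊗ N` and `T`, so it is
inverted coefficient by coefficient. -/
theorem warpedMetric_inv {w : ℝ → ℝ} {x : EuclideanSpace ℝ (Fin (n + 1))} (hx : x ≠ 0)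
    (hw : w ‖x‖ ≠ 0) (i j : Fin (n + 1)) :
    (warpedMetric n w x)⁻¹ i j
      = x i / ‖x‖ * (x j / ‖x‖) + ‖x‖ ^ 2 / w ‖x‖ ^ 2 * tanProj x i j := by
  have hr : ‖x‖ ≠ 0 := norm_ne_zero_iff.mpr hx
  suffices h : (warpedMetric n w x)⁻¹ = Matrix.of fun i j =>
      x i / ‖x‖ * (x j / ‖x‖) + ‖x‖ ^ 2 / w ‖x‖ ^ 2 * tanProj x i j by
    rw [h]; rfl
  refine Matrix.inv_eq_right_inv ?_
  ext i k
  rw [Matrix.mul_apply]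
  have h : ∀ j, warpedMetric n w x i j * (Matrix.of fun i j =>
      x i / ‖x‖ * (x j / ‖x‖) + ‖x‖ ^ 2 / w ‖x‖ ^ 2 * tanProj x i j) j k
      = x i / ‖x‖ * (x k / ‖x‖) * (x j / ‖x‖ * (x j / ‖x‖))
        + ‖x‖ ^ 2 / w ‖x‖ ^ 2 * (x i / ‖x‖) * (x j / ‖x‖ * tanProj x j k)
        + w ‖x‖ ^ 2 / ‖x‖ ^ 2 * (x k / ‖x‖) * (tanProj x i j * (x j / ‖x‖))
        + (w ‖x‖ ^ 2 / ‖x‖ ^ 2) * (‖x‖ ^ 2 / w ‖x‖ ^ 2) * (tanProj x i j * tanProj x j k) := by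
    intro j
    rw [warpedMetric_eq hx, Matrix.of_apply]; ring
  simp only [h, Finset.sum_add_distrib, ← Finset.mul_sum, sum_unit_sq hx, sum_tanProj_unit hx,
    sum_tanProj_unit' hx, sum_tanProj_mul hx]
  rw [Matrix.one_apply, tanProj, div_mul_div_cancel₀ (by positivity), div_self (by positivity)]
  ring

/-- Partial derivatives of a rotationally equivariant symmetric two-tensor. -/
theorem hasPd_tensor {U V : ℝ → ℝ} {U' V' : ℝ} {x : EuclideanSpace ℝ (Fin (n + 1))} (hx : x ≠ 0)
    (hU : HasDerivAt U U' ‖x‖) (hV : HasDerivAt V V' ‖x‖) (j a : Fin (n + 1)) :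
    HasPd (fun y => V ‖y‖ * (y j / ‖y‖ * (y a / ‖y‖)) + U ‖y‖ * tanProj y j a)
      (fun i => x i / ‖x‖ * (V' * (x j / ‖x‖ * (x a / ‖x‖)) + U' * tanProj x j a)
        + (V ‖x‖ - U ‖x‖) / ‖x‖ * (tanProj x i j * (x a / ‖x‖) + tanProj x i a * (x j / ‖x‖)))
      x := by
  have hee := (hasPd_unit hx j).mul (hasPd_unit hx a)
  have h := ((hasPd_radial hx hV).mul hee).add ((hasPd_radial hx hU).mul
    ((hasPd_const (if j = a then 1 else 0) x).add ((hasPd_const (-1) x).mul hee)))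
  refine h.congr (Eventually.of_forall fun y => ?_) fun i => ?_
  · simp only [tanProj]; ring
  · simp only [tanProj]; ring

theorem hasPd_warpedMetric {w : ℝ → ℝ} {w' : ℝ} {x : EuclideanSpace ℝ (Fin (n + 1))} (hx : x ≠ 0)
    (hw : HasDerivAt w w' ‖x‖) (j a : Fin (n + 1)) :
    HasPd (fun y => warpedMetric n w y j a)
      (fun i => (2 * w ‖x‖ * w' / ‖x‖ ^ 2 - 2 * w ‖x‖ ^ 2 / ‖x‖ ^ 3) * (x i / ‖x‖) * tanProj x j a
        + (1 - w ‖x‖ ^ 2 / ‖x‖ ^ 2) / ‖x‖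
          * (tanProj x i j * (x a / ‖x‖) + tanProj x i a * (x j / ‖x‖)))
      x := by
  have hr : ‖x‖ ≠ 0 := norm_ne_zero_iff.mpr hx
  have hU : HasDerivAt (fun s => w s ^ 2 / s ^ 2)
      (2 * w ‖x‖ * w' / ‖x‖ ^ 2 - 2 * w ‖x‖ ^ 2 / ‖x‖ ^ 3) ‖x‖ := by
    refine ((hw.pow 2).div (hasDerivAt_pow 2 ‖x‖) (by positivity)).congr_deriv ?_
    simp only [Pi.pow_apply]
    field_simp
    push_cast
    ring
  refine (hasPd_tensor hx hU (hasDerivAt_const ‖x‖ 1) j a).congr ?_ fun i => ?_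
  · filter_upwards [eventually_ne_zero hx] with y hy
    rw [warpedMetric_eq hy]; ring
  · ring

/-- Both coefficients measure the deviation from the flat metric: they vanish for `w(s) = s`. -/
theorem christoffel_warpedMetric {w : ℝ → ℝ} {w' : ℝ} {x : EuclideanSpace ℝ (Fin (n + 1))}
    (hx : x ≠ 0) (hw : HasDerivAt w w' ‖x‖) (hw0 : w ‖x‖ ≠ 0) (k i j : Fin (n + 1)) :
    christoffel (warpedMetric n w) k i j x
      = (w' / w ‖x‖ - 1 / ‖x‖) * (x i / ‖x‖ * tanProj x j k + x j / ‖x‖ * tanProj x i k)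
        + (1 / ‖x‖ - w ‖x‖ * w' / ‖x‖ ^ 2) * (tanProj x i j * (x k / ‖x‖)) := by
  have hr : ‖x‖ ≠ 0 := norm_ne_zero_iff.mpr hx
  rw [christoffel]
  simp only [(hasPd_warpedMetric hx hw _ _).pd, warpedMetric_inv hx hw0]
  set A' := 2 * w ‖x‖ * w' / ‖x‖ ^ 2 - 2 * w ‖x‖ ^ 2 / ‖x‖ ^ 3 with hA'
  set β := (1 - w ‖x‖ ^ 2 / ‖x‖ ^ 2) / ‖x‖ with hβ
  set α := ‖x‖ ^ 2 / w ‖x‖ ^ 2 with hα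
  have h : ∀ l, (x k / ‖x‖ * (x l / ‖x‖) + α * tanProj x k l) *
      (A' * (x i / ‖x‖) * tanProj x j l
          + β * (tanProj x i j * (x l / ‖x‖) + tanProj x i l * (x j / ‖x‖))
        + (A' * (x j / ‖x‖) * tanProj x i l
          + β * (tanProj x j i * (x l / ‖x‖) + tanProj x j l * (x i / ‖x‖)))
        - (A' * (x l / ‖x‖) * tanProj x i j
          + β * (tanProj x l i * (x j / ‖x‖) + tanProj x l j * (x i / ‖x‖))))
      = x k / ‖x‖ * (A' * (x i / ‖x‖)) * (tanProj x j l * (x l / ‖x‖))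
        + x k / ‖x‖ * (A' * (x j / ‖x‖)) * (tanProj x i l * (x l / ‖x‖))
        + x k / ‖x‖ * ((2 * β - A') * tanProj x i j) * (x l / ‖x‖ * (x l / ‖x‖))
        + α * (A' * (x i / ‖x‖)) * (tanProj x k l * tanProj x l j)
        + α * (A' * (x j / ‖x‖)) * (tanProj x k l * tanProj x l i)
        + α * ((2 * β - A') * tanProj x i j) * (tanProj x k l * (x l / ‖x‖)) := by
    intro l
    rw [tanProj_comm x l j, tanProj_comm x l i, tanProj_comm x j i]; ring
  simp only [h, Finset.sum_add_distrib, ← Finset.mul_sum, sum_unit_sq hx, sum_tanProj_unit hx,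
    sum_tanProj_mul hx]
  rw [tanProj_comm x k j, tanProj_comm x k i]
  have h1 : 1 / 2 * (α * A') = w' / w ‖x‖ - 1 / ‖x‖ := by
    rw [hα, hA']; field_simp
  have h2 : 1 / 2 * (2 * β - A') = 1 / ‖x‖ - w ‖x‖ * w' / ‖x‖ ^ 2 := by
    rw [hβ, hA']; field_simp; ring
  rw [← h1, ← h2]; ring

/-- The free index `a` is the component of a vector-valued form. Mixed radial-tangential terms have
zero trace because `T N = 0`, and the trace of `T` is `n`. -/
theorem sum_sum_warpedMetric_inv {x : EuclideanSpace ℝ (Fin (n + 1))} (hx : x ≠ 0)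
    (α c₁ c₂ c₃ c₄ : ℝ) (a : Fin (n + 1)) :
    ∑ i, ∑ j, (x i / ‖x‖ * (x j / ‖x‖) + α * tanProj x i j) *
      (c₁ * (x i / ‖x‖ * (x j / ‖x‖)) + c₂ * tanProj x i j
        + c₃ * (x i / ‖x‖ * tanProj x j a) + c₄ * (x j / ‖x‖ * tanProj x i a))
      = c₁ + α * n * c₂ := by
  have h : ∀ i j, (x i / ‖x‖ * (x j / ‖x‖) + α * tanProj x i j) *
      (c₁ * (x i / ‖x‖ * (x j / ‖x‖)) + c₂ * tanProj x i j
        + c₃ * (x i / ‖x‖ * tanProj x j a) + c₄ * (x j / ‖x‖ * tanProj x i a))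
      = c₁ * (x i / ‖x‖ * (x i / ‖x‖)) * (x j / ‖x‖ * (x j / ‖x‖))
        + (c₂ + α * c₁) * (x i / ‖x‖) * (tanProj x i j * (x j / ‖x‖))
        + c₃ * (x i / ‖x‖ * (x i / ‖x‖)) * (x j / ‖x‖ * tanProj x j a)
        + c₄ * (x i / ‖x‖) * tanProj x i a * (x j / ‖x‖ * (x j / ‖x‖))
        + α * c₂ * (tanProj x i j * tanProj x j i)
        + α * c₃ * (x i / ‖x‖) * (tanProj x i j * tanProj x j a)
        + α * c₄ * tanProj x i a * (tanProj x i j * (x j / ‖x‖)) := by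
    intro i j
    rw [tanProj_comm x j i]; ring
  simp only [h, Finset.sum_add_distrib, ← Finset.mul_sum, sum_unit_sq hx, sum_tanProj_unit hx,
    sum_tanProj_unit' hx, sum_tanProj_mul hx, trace_tanProj hx, mul_one, mul_zero,
    Finset.sum_const_zero]
  simp only [mul_assoc, ← Finset.mul_sum, sum_tanProj_unit' hx]
  ring

end Warped

/-! ### Rotationally symmetric maps and functions: `|dF|`, `p`-tension field, `p`-Laplacian,
convexity. -/

section RotSym

variable {n : ℕ}

theorem norm_radial {c r : ℝ} (hc : 0 < c) {x : EuclideanSpace ℝ (Fin (n + 1))} (hx : x ≠ 0)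
    (hr : r = ‖x‖) : ‖(c / r) • x‖ = c := by
  have h : 0 < ‖x‖ := norm_pos_iff.mpr hx
  rw [hr, norm_smul, Real.norm_of_nonneg (by positivity)]
  field_simp

theorem unit_radial {c : ℝ} (hc : 0 < c) {x : EuclideanSpace ℝ (Fin (n + 1))} (hx : x ≠ 0)
    (i : Fin (n + 1)) :
    ((c / ‖x‖) • x : EuclideanSpace ℝ (Fin (n + 1))) i / ‖(c / ‖x‖) • x‖ = x i / ‖x‖ := by
  rw [norm_radial hc hx rfl, PiLp.smul_apply, smul_eq_mul]
  field_simp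

theorem tanProj_radial {c : ℝ} (hc : 0 < c) {x : EuclideanSpace ℝ (Fin (n + 1))} (hx : x ≠ 0)
    (i j : Fin (n + 1)) : tanProj ((c / ‖x‖) • x) i j = tanProj x i j := by
  simp only [tanProj, unit_radial hc hx]

/-- The sum over both indices of a form `φ N + ψ (1 - N)` applied to two tensors of this shape. -/
theorem sum_sum_pair {x : EuclideanSpace ℝ (Fin (n + 1))} (hx : x ≠ 0)
    (κ u v u' v' : ℝ) (i j : Fin (n + 1)) :
    ∑ a, ∑ b, (x a / ‖x‖ * (x b / ‖x‖) + κ * tanProj x a b) *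
      (u * (x i / ‖x‖ * (x a / ‖x‖)) + v * tanProj x i a) *
      (u' * (x j / ‖x‖ * (x b / ‖x‖)) + v' * tanProj x j b)
      = u * u' * (x i / ‖x‖ * (x j / ‖x‖)) + κ * (v * v') * tanProj x i j := by
  have h1 : ∀ a, ∑ b, (x a / ‖x‖ * (x b / ‖x‖) + κ * tanProj x a b) *
      (u * (x i / ‖x‖ * (x a / ‖x‖)) + v * tanProj x i a) *
      (u' * (x j / ‖x‖ * (x b / ‖x‖)) + v' * tanProj x j b)
      = (u * (x i / ‖x‖ * (x a / ‖x‖)) + v * tanProj x i a) *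
        (u' * (x j / ‖x‖) * (x a / ‖x‖) + κ * v' * tanProj x a j) := by
    intro a
    have h : ∀ b, (x a / ‖x‖ * (x b / ‖x‖) + κ * tanProj x a b) *
      (u * (x i / ‖x‖ * (x a / ‖x‖)) + v * tanProj x i a) *
      (u' * (x j / ‖x‖ * (x b / ‖x‖)) + v' * tanProj x j b)
      = (u * (x i / ‖x‖ * (x a / ‖x‖)) + v * tanProj x i a) *
        (u' * (x j / ‖x‖) * (x a / ‖x‖) * (x b / ‖x‖ * (x b / ‖x‖))
        + v' * (x a / ‖x‖) * (tanProj x j b * (x b / ‖x‖))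
        + κ * u' * (x j / ‖x‖) * (tanProj x a b * (x b / ‖x‖))
        + κ * v' * (tanProj x a b * tanProj x b j)) := by
      intro b
      rw [tanProj_comm x b j]; ring
    simp only [h, ← Finset.mul_sum, Finset.sum_add_distrib, sum_unit_sq hx, sum_tanProj_unit hx,
      sum_tanProj_mul hx]
    ring
  have h2 : ∀ a, (u * (x i / ‖x‖ * (x a / ‖x‖)) + v * tanProj x i a) *
        (u' * (x j / ‖x‖) * (x a / ‖x‖) + κ * v' * tanProj x a j)
      = u * u' * (x i / ‖x‖ * (x j / ‖x‖)) * (x a / ‖x‖ * (x a / ‖x‖))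
        + u * κ * v' * (x i / ‖x‖) * (x a / ‖x‖ * tanProj x a j)
        + v * u' * (x j / ‖x‖) * (tanProj x i a * (x a / ‖x‖))
        + κ * (v * v') * (tanProj x i a * tanProj x a j) := by
    intro a; ring
  simp only [h1, h2, ← Finset.mul_sum, Finset.sum_add_distrib, sum_unit_sq hx,
    sum_tanProj_unit hx, sum_tanProj_unit' hx, sum_tanProj_mul hx]
  ring

/-- The quadratic part of the covariant derivative along a rotationally symmetric map. -/
theorem sum_sum_christoffel {x : EuclideanSpace ℝ (Fin (n + 1))} (hx : x ≠ 0)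
    (A B u v u' v' : ℝ) (i j a : Fin (n + 1)) :
    ∑ b, ∑ c, (A * (x b / ‖x‖ * tanProj x c a + x c / ‖x‖ * tanProj x b a)
        + B * (tanProj x b c * (x a / ‖x‖))) *
      (u * (x i / ‖x‖ * (x b / ‖x‖)) + v * tanProj x i b) *
      (u' * (x j / ‖x‖ * (x c / ‖x‖)) + v' * tanProj x j c)
      = B * (v * v') * (x a / ‖x‖) * tanProj x i j
        + A * u * v' * (x i / ‖x‖ * tanProj x j a) + A * v * u' * (x j / ‖x‖ * tanProj x i a) := by
  have h1 : ∀ b, ∑ c, (A * (x b / ‖x‖ * tanProj x c a + x c / ‖x‖ * tanProj x b a)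
        + B * (tanProj x b c * (x a / ‖x‖))) *
      (u * (x i / ‖x‖ * (x b / ‖x‖)) + v * tanProj x i b) *
      (u' * (x j / ‖x‖ * (x c / ‖x‖)) + v' * tanProj x j c)
      = (u * (x i / ‖x‖ * (x b / ‖x‖)) + v * tanProj x i b) *
        (A * v' * tanProj x j a * (x b / ‖x‖) + A * u' * (x j / ‖x‖) * tanProj x b a
          + B * v' * (x a / ‖x‖) * tanProj x b j) := by
    intro b
    have h : ∀ c, (A * (x b / ‖x‖ * tanProj x c a + x c / ‖x‖ * tanProj x b a)
        + B * (tanProj x b c * (x a / ‖x‖))) *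
      (u * (x i / ‖x‖ * (x b / ‖x‖)) + v * tanProj x i b) *
      (u' * (x j / ‖x‖ * (x c / ‖x‖)) + v' * tanProj x j c)
      = (u * (x i / ‖x‖ * (x b / ‖x‖)) + v * tanProj x i b) *
        (A * u' * (x j / ‖x‖) * (x b / ‖x‖) * (x c / ‖x‖ * tanProj x c a)
        + A * v' * (x b / ‖x‖) * (tanProj x j c * tanProj x c a)
        + A * u' * (x j / ‖x‖) * tanProj x b a * (x c / ‖x‖ * (x c / ‖x‖))
        + A * v' * tanProj x b a * (tanProj x j c * (x c / ‖x‖))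
        + B * u' * (x j / ‖x‖) * (x a / ‖x‖) * (tanProj x b c * (x c / ‖x‖))
        + B * v' * (x a / ‖x‖) * (tanProj x b c * tanProj x c j)) := by
      intro c
      rw [tanProj_comm x c j]; ring
    simp only [h, ← Finset.mul_sum, Finset.sum_add_distrib, sum_unit_sq hx, sum_tanProj_unit hx,
      sum_tanProj_unit' hx, sum_tanProj_mul hx]
    ring
  have h2 : ∀ b, (u * (x i / ‖x‖ * (x b / ‖x‖)) + v * tanProj x i b) *
        (A * v' * tanProj x j a * (x b / ‖x‖) + A * u' * (x j / ‖x‖) * tanProj x b a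
          + B * v' * (x a / ‖x‖) * tanProj x b j)
      = u * A * v' * (x i / ‖x‖) * tanProj x j a * (x b / ‖x‖ * (x b / ‖x‖))
        + u * A * u' * (x i / ‖x‖) * (x j / ‖x‖) * (x b / ‖x‖ * tanProj x b a)
        + u * B * v' * (x i / ‖x‖) * (x a / ‖x‖) * (x b / ‖x‖ * tanProj x b j)
        + v * A * v' * tanProj x j a * (tanProj x i b * (x b / ‖x‖))
        + v * A * u' * (x j / ‖x‖) * (tanProj x i b * tanProj x b a)
        + v * B * v' * (x a / ‖x‖) * (tanProj x i b * tanProj x b j) := by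
    intro b; ring
  simp only [h1, h2, ← Finset.mul_sum, Finset.sum_add_distrib, sum_unit_sq hx,
    sum_tanProj_unit hx, sum_tanProj_unit' hx, sum_tanProj_mul hx]
  ring

theorem sum_christoffel_mul {w : ℝ → ℝ} {w' : ℝ} {x : EuclideanSpace ℝ (Fin (n + 1))}
    (hx : x ≠ 0) (hw : HasDerivAt w w' ‖x‖) (hw0 : w ‖x‖ ≠ 0) (u v : ℝ) (i j a : Fin (n + 1)) :
    ∑ k, christoffel (warpedMetric n w) k i j x
        * (v * (x k / ‖x‖ * (x a / ‖x‖)) + u * tanProj x k a)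
      = (w' / w ‖x‖ - 1 / ‖x‖) * u * (x i / ‖x‖ * tanProj x j a)
        + (w' / w ‖x‖ - 1 / ‖x‖) * u * (x j / ‖x‖ * tanProj x i a)
        + (1 / ‖x‖ - w ‖x‖ * w' / ‖x‖ ^ 2) * v * (x a / ‖x‖) * tanProj x i j := by
  simp only [christoffel_warpedMetric hx hw hw0]
  generalize w' / w ‖x‖ - 1 / ‖x‖ = A
  generalize 1 / ‖x‖ - w ‖x‖ * w' / ‖x‖ ^ 2 = B
  have h : ∀ k, (A * (x i / ‖x‖ * tanProj x j k + x j / ‖x‖ * tanProj x i k)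
        + B * (tanProj x i j * (x k / ‖x‖)))
        * (v * (x k / ‖x‖ * (x a / ‖x‖)) + u * tanProj x k a)
      = A * v * (x i / ‖x‖) * (x a / ‖x‖) * (tanProj x j k * (x k / ‖x‖))
        + A * u * (x i / ‖x‖) * (tanProj x j k * tanProj x k a)
        + A * v * (x j / ‖x‖) * (x a / ‖x‖) * (tanProj x i k * (x k / ‖x‖))
        + A * u * (x j / ‖x‖) * (tanProj x i k * tanProj x k a)
        + B * v * (x a / ‖x‖) * tanProj x i j * (x k / ‖x‖ * (x k / ‖x‖))
        + B * u * tanProj x i j * (x k / ‖x‖ * tanProj x k a) := by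
    intro k; ring
  simp only [h, ← Finset.mul_sum, Finset.sum_add_distrib, sum_unit_sq hx,
    sum_tanProj_unit hx, sum_tanProj_unit' hx, sum_tanProj_mul hx]
  ring

variable {w k f f1 : ℝ → ℝ} {F : EuclideanSpace ℝ (Fin (n + 1)) → EuclideanSpace ℝ (Fin (n + 1))}

theorem hasPd_rotSym (hF : ∀ y, y ≠ 0 → F y = (f ‖y‖ / ‖y‖) • y)
    (hf1 : ∀ s, 0 < s → HasDerivAt f (f1 s) s) {x : EuclideanSpace ℝ (Fin (n + 1))} (hx : x ≠ 0)
    (b : Fin (n + 1)) :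
    HasPd (fun y => F y b)
      (fun i => f1 ‖x‖ * (x i / ‖x‖ * (x b / ‖x‖)) + f ‖x‖ / ‖x‖ * tanProj x i b) x := by
  refine ((hasPd_radial hx (hf1 _ (norm_pos_iff.mpr hx))).mul (hasPd_unit hx b)).congr ?_ ?_
  · filter_upwards [eventually_ne_zero hx] with y hy
    rw [hF y hy, PiLp.smul_apply, smul_eq_mul]; ring
  · intro i; ring

/-- The radial direction is stretched by `f'` and each of the `n` tangential directions by `k(f)/w`.
-/
theorem diffNorm_rotSym (hF : ∀ y, y ≠ 0 → F y = (f ‖y‖ / ‖y‖) • y)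
    (hw : ∀ s, 0 < s → 0 < w s) (hf : ∀ s, 0 < s → 0 < f s)
    (hf1 : ∀ s, 0 < s → HasDerivAt f (f1 s) s) {x : EuclideanSpace ℝ (Fin (n + 1))} (hx : x ≠ 0) :
    diffNorm (warpedMetric n w) (warpedMetric n k) F x
      = Real.sqrt (f1 ‖x‖ ^ 2 + n * (k (f ‖x‖) ^ 2 / w ‖x‖ ^ 2)) := by
  have hr : 0 < ‖x‖ := norm_pos_iff.mpr hx
  have hfr := hf _ hr
  have hFx : F x ≠ 0 := by
    rw [hF x hx]; exact smul_ne_zero (by positivity) hx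
  rw [diffNorm]
  congr 1
  have hunit : ∀ i, F x i / f ‖x‖ = x i / ‖x‖ := fun i => by
    rw [← unit_radial hfr hx i, norm_radial hfr hx rfl, hF x hx]
  have hproj : ∀ i j, tanProj (F x) i j = tanProj x i j := fun i j => by
    rw [hF x hx, tanProj_radial hfr hx]
  have hnorm : ‖F x‖ = f ‖x‖ := by rw [hF x hx]; exact norm_radial hfr hx rfl
  simp only [(hasPd_rotSym hF hf1 hx _).pd, warpedMetric_inv hx (hw _ hr).ne',
    warpedMetric_eq hFx, hunit, hproj, hnorm]
  -- The two vanishing terms with dummy index `0` only give the summand the shape required by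
  -- `sum_sum_warpedMetric_inv`.
  have h : ∀ i j, ∑ a, ∑ b, (x i / ‖x‖ * (x j / ‖x‖) + ‖x‖ ^ 2 / w ‖x‖ ^ 2 * tanProj x i j) *
      (x a / ‖x‖ * (x b / ‖x‖) + k (f ‖x‖) ^ 2 / f ‖x‖ ^ 2 * tanProj x a b) *
      (f1 ‖x‖ * (x i / ‖x‖ * (x a / ‖x‖)) + f ‖x‖ / ‖x‖ * tanProj x i a) *
      (f1 ‖x‖ * (x j / ‖x‖ * (x b / ‖x‖)) + f ‖x‖ / ‖x‖ * tanProj x j b)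
      = (x i / ‖x‖ * (x j / ‖x‖) + ‖x‖ ^ 2 / w ‖x‖ ^ 2 * tanProj x i j) *
        (f1 ‖x‖ * f1 ‖x‖ * (x i / ‖x‖ * (x j / ‖x‖))
          + k (f ‖x‖) ^ 2 / f ‖x‖ ^ 2 * (f ‖x‖ / ‖x‖ * (f ‖x‖ / ‖x‖)) * tanProj x i j
          + 0 * (x i / ‖x‖ * tanProj x j 0) + 0 * (x j / ‖x‖ * tanProj x i 0)) := by
    intro i j
    rw [zero_mul, zero_mul, add_zero, add_zero, ← sum_sum_pair hx]
    simp only [Finset.mul_sum]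
    exact Finset.sum_congr rfl fun a _ => Finset.sum_congr rfl fun b _ => by ring
  simp only [h, sum_sum_warpedMetric_inv hx]
  field_simp

/-- Here `L` is `|dF|^(p-2)`. The mixed terms have no trace, so what remains points along `N`, with
coefficient `w^(-n) (w^n L f')' - n L k(f) k'(f) / w²`. -/
theorem pTension_rotSym (p : ℝ) (hF : ∀ y, y ≠ 0 → F y = (f ‖y‖ / ‖y‖) • y)
    (hw : ∀ s, 0 < s → 0 < w s) (hk : ∀ t, 0 < t → 0 < k t) (hf : ∀ s, 0 < s → 0 < f s)
    (hf1 : ∀ s, 0 < s → HasDerivAt f (f1 s) s) {L : ℝ → ℝ}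
    (hL : ∀ s, 0 < s → L s = Real.sqrt (f1 s ^ 2 + n * (k (f s) ^ 2 / w s ^ 2)) ^ (p - 2))
    {x : EuclideanSpace ℝ (Fin (n + 1))} (hx : x ≠ 0) {w' k' L' f2 : ℝ}
    (hw' : HasDerivAt w w' ‖x‖) (hk' : HasDerivAt k k' (f ‖x‖)) (hL' : HasDerivAt L L' ‖x‖)
    (hf2 : HasDerivAt f1 f2 ‖x‖) (a : Fin (n + 1)) :
    pTension p (warpedMetric n w) (warpedMetric n k) F x a
      = (L' * f1 ‖x‖ + L ‖x‖ * f2 + n * (w' / w ‖x‖) * (L ‖x‖ * f1 ‖x‖)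
          - n * L ‖x‖ * k (f ‖x‖) * k' / w ‖x‖ ^ 2) * (x a / ‖x‖) := by
  have hr : 0 < ‖x‖ := norm_pos_iff.mpr hx
  have hfr := hf _ hr
  have hwr := hw _ hr
  have hkr := hk _ hfr
  have hFx : F x ≠ 0 := by
    rw [hF x hx]; exact smul_ne_zero (by positivity) hx
  have hflux : ∀ y, y ≠ 0 → ∀ a j, pFlux p (warpedMetric n w) (warpedMetric n k) F a j y
      = L ‖y‖ * f1 ‖y‖ * (y j / ‖y‖ * (y a / ‖y‖))
        + L ‖y‖ * (f ‖y‖ / ‖y‖) * tanProj y j a := by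
    intro y hy a j
    rw [pFlux, (hasPd_rotSym hF hf1 hy a).pd, diffNorm_rotSym hF hw hf hf1 hy,
      ← hL _ (norm_pos_iff.mpr hy)]
    ring
  have hU : HasDerivAt (fun s => L s * (f s / s))
      (L' * (f ‖x‖ / ‖x‖) + L ‖x‖ * ((f1 ‖x‖ * ‖x‖ - f ‖x‖ * 1) / ‖x‖ ^ 2)) ‖x‖ :=
    hL'.mul ((hf1 _ hr).div (hasDerivAt_id _) hr.ne')
  have hpd : ∀ a i j, pd i (pFlux p (warpedMetric n w) (warpedMetric n k) F a j) x = _ :=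
    fun a i j => ((hasPd_tensor hx hU (hL'.mul hf2) j a).congr
      ((eventually_ne_zero hx).mono fun y hy => hflux y hy a j) fun i => rfl).pd i
  have hunit : ∀ i, F x i / f ‖x‖ = x i / ‖x‖ := fun i => by
    rw [← unit_radial hfr hx i, norm_radial hfr hx rfl, hF x hx]
  have hproj : ∀ i j, tanProj (F x) i j = tanProj x i j := fun i j => by
    rw [hF x hx, tanProj_radial hfr hx]
  have hnorm : ‖F x‖ = f ‖x‖ := by rw [hF x hx]; exact norm_radial hfr hx rfl
  have hwK : HasDerivAt k k' ‖F x‖ := by rwa [hnorm]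
  have hK0 : k ‖F x‖ ≠ 0 := by rw [hnorm]; exact hkr.ne'
  rw [pTension]
  simp only [hpd, hflux x hx, (hasPd_rotSym hF hf1 hx _).pd, warpedMetric_inv hx hwr.ne',
    sum_christoffel_mul hx hw' hwr.ne', christoffel_warpedMetric hFx hwK hK0, hunit, hproj, hnorm,
    Pi.mul_apply, sum_sum_christoffel hx]
  set A := w' / w ‖x‖ - 1 / ‖x‖ with hA
  set B := 1 / ‖x‖ - w ‖x‖ * w' / ‖x‖ ^ 2 with hB
  set A₁ := k' / k (f ‖x‖) - 1 / f ‖x‖ with hA₁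
  set B₁ := 1 / f ‖x‖ - k (f ‖x‖) * k' / f ‖x‖ ^ 2 with hB₁
  set U := L ‖x‖ * (f ‖x‖ / ‖x‖) with hU₁
  set V := L ‖x‖ * f1 ‖x‖ with hV₁
  set U' := L' * (f ‖x‖ / ‖x‖) + L ‖x‖ * ((f1 ‖x‖ * ‖x‖ - f ‖x‖ * 1) / ‖x‖ ^ 2) with hU'
  have h := sum_sum_warpedMetric_inv hx (‖x‖ ^ 2 / w ‖x‖ ^ 2)
    ((L' * f1 ‖x‖ + L ‖x‖ * f2) * (x a / ‖x‖))
    (((V - U) / ‖x‖ - B * V + B₁ * (f ‖x‖ / ‖x‖) * U) * (x a / ‖x‖))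
    (U' - A * U + A₁ * f1 ‖x‖ * U) ((V - U) / ‖x‖ - A * U + A₁ * (f ‖x‖ / ‖x‖) * V) a
  trans (L' * f1 ‖x‖ + L ‖x‖ * f2) * (x a / ‖x‖) + ‖x‖ ^ 2 / w ‖x‖ ^ 2 * n *
    (((V - U) / ‖x‖ - B * V + B₁ * (f ‖x‖ / ‖x‖) * U) * (x a / ‖x‖))
  · rw [← h]
    refine Finset.sum_congr rfl fun i _ => Finset.sum_congr rfl fun j _ => ?_
    congr 1
    ring
  · rw [hB, hB₁, hU₁, hV₁]
    field_simp
    ring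

/-- The `p`-Laplacian of a radial function. -/
theorem pLaplacian_radial (p : ℝ) {u v : ℝ → ℝ} {H : EuclideanSpace ℝ (Fin (n + 1)) → ℝ}
    (hH : ∀ y, y ≠ 0 → H y = u ‖y‖) (hw : ∀ s, 0 < s → 0 < w s)
    (hu : ∀ s, 0 < s → HasDerivAt u (v s) s) (hv : ∀ s, 0 < s → 0 < v s)
    {x : EuclideanSpace ℝ (Fin (n + 1))} (hx : x ≠ 0) {w' v' : ℝ}
    (hw' : HasDerivAt w w' ‖x‖) (hv' : HasDerivAt v v' ‖x‖) :
    pLaplacian p (warpedMetric n w) H x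
      = v ‖x‖ ^ (p - 2) * ((p - 1) * v' + n * (w' / w ‖x‖) * v ‖x‖) := by
  have hr : 0 < ‖x‖ := norm_pos_iff.mpr hx
  have hwr := hw _ hr
  have hvr := hv _ hr
  have hpdH : ∀ y, y ≠ 0 → HasPd (fun y => (EuclideanSpace.single (0 : Fin 1) (H y)) 0)
      (fun i => v ‖y‖ * (y i / ‖y‖)) y := fun y hy =>
    (hasPd_radial hy (hu _ (norm_pos_iff.mpr hy))).congr
      ((eventually_ne_zero hy).mono fun z hz => by simp [hH z hz]) fun i => rfl
  have hnorm : ∀ y, y ≠ 0 → diffNorm (warpedMetric n w)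
      (fun _ => (1 : Matrix (Fin 1) (Fin 1) ℝ))
      (fun y => EuclideanSpace.single (0 : Fin 1) (H y)) y = v ‖y‖ := by
    intro y hy
    have hry : 0 < ‖y‖ := norm_pos_iff.mpr hy
    rw [diffNorm]
    simp only [Finset.univ_unique, Fin.default_eq_zero, Finset.sum_singleton,
      (hpdH y hy).pd, warpedMetric_inv hy (hw _ hry).ne', Matrix.one_apply_eq, mul_one]
    have h := sum_sum_warpedMetric_inv hy (‖y‖ ^ 2 / w ‖y‖ ^ 2) (v ‖y‖ * v ‖y‖) 0 0 0 0
    simp only [zero_mul, add_zero, mul_zero] at h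
    refine Eq.trans ?_ (Real.sqrt_mul_self (hv _ hry).le)
    congr 1
    refine Eq.trans ?_ h
    exact Finset.sum_congr rfl fun i _ => Finset.sum_congr rfl fun j _ => by ring
  have hflux : ∀ y, y ≠ 0 → ∀ j, pFlux p (warpedMetric n w)
      (fun _ => (1 : Matrix (Fin 1) (Fin 1) ℝ))
      (fun y => EuclideanSpace.single (0 : Fin 1) (H y)) 0 j y
      = v ‖y‖ ^ (p - 1) * (y j / ‖y‖) := by
    intro y hy j
    have hvy := hv _ (norm_pos_iff.mpr hy)
    rw [pFlux, (hpdH y hy).pd, hnorm y hy, show p - 1 = p - 2 + 1 by ring,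
      Real.rpow_add hvy, Real.rpow_one]
    ring
  have hV : HasDerivAt (fun s => v s ^ (p - 1)) (v' * (p - 1) * v ‖x‖ ^ (p - 1 - 1)) ‖x‖ :=
    hv'.rpow_const (Or.inl hvr.ne')
  have hpd : ∀ i j, pd i (pFlux p (warpedMetric n w) (fun _ => (1 : Matrix (Fin 1) (Fin 1) ℝ))
      (fun y => EuclideanSpace.single (0 : Fin 1) (H y)) 0 j) x = _ :=
    fun i j => (((hasPd_radial hx hV).mul (hasPd_unit hx j)).congr
      ((eventually_ne_zero hx).mono fun y hy => hflux y hy j) fun i => rfl).pd i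
  have hΓ : ∀ a b c y, christoffel (fun _ : EuclideanSpace ℝ (Fin 1) =>
      (1 : Matrix (Fin 1) (Fin 1) ℝ)) a b c y = 0 := by
    intro a b c y
    simp [christoffel, pd]
  have hsum : ∀ i j, ∑ k, christoffel (warpedMetric n w) k i j x
        * (v ‖x‖ ^ (p - 1) * (x k / ‖x‖)) =
        (1 / ‖x‖ - w ‖x‖ * w' / ‖x‖ ^ 2) * v ‖x‖ ^ (p - 1) * tanProj x i j := by
    intro i j
    simp only [christoffel_warpedMetric hx hw' hwr.ne']
    generalize w' / w ‖x‖ - 1 / ‖x‖ = A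
    generalize 1 / ‖x‖ - w ‖x‖ * w' / ‖x‖ ^ 2 = B
    generalize v ‖x‖ ^ (p - 1) = V
    have h : ∀ k, (A * (x i / ‖x‖ * tanProj x j k + x j / ‖x‖ * tanProj x i k)
        + B * (tanProj x i j * (x k / ‖x‖))) * (V * (x k / ‖x‖))
        = A * V * (x i / ‖x‖) * (tanProj x j k * (x k / ‖x‖))
          + A * V * (x j / ‖x‖) * (tanProj x i k * (x k / ‖x‖))
          + B * V * tanProj x i j * (x k / ‖x‖ * (x k / ‖x‖)) := by
      intro k; ring
    simp only [h, ← Finset.mul_sum, Finset.sum_add_distrib, sum_unit_sq hx,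
      sum_tanProj_unit hx]
    ring
  rw [pLaplacian, pTension]
  simp only [hpd, hflux x hx, warpedMetric_inv hx hwr.ne', hΓ, hsum, zero_mul,
    Finset.sum_const_zero, add_zero]
  have hpow : v ‖x‖ ^ (p - 1) = v ‖x‖ ^ (p - 2) * v ‖x‖ := by
    rw [show p - 1 = p - 2 + 1 by ring, Real.rpow_add hvr, Real.rpow_one]
  rw [show p - 1 - 1 = p - 2 by ring]
  set V := v ‖x‖ ^ (p - 1) with hV₁
  set B := 1 / ‖x‖ - w ‖x‖ * w' / ‖x‖ ^ 2 with hB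
  have h := sum_sum_warpedMetric_inv hx (‖x‖ ^ 2 / w ‖x‖ ^ 2)
    (v' * (p - 1) * v ‖x‖ ^ (p - 2)) (V / ‖x‖ - B * V) 0 0 0
  trans v' * (p - 1) * v ‖x‖ ^ (p - 2) + ‖x‖ ^ 2 / w ‖x‖ ^ 2 * n * (V / ‖x‖ - B * V)
  · rw [← h]
    refine Finset.sum_congr rfl fun i _ => Finset.sum_congr rfl fun j _ => ?_
    congr 1
    ring
  · rw [hB, hpow]
    field_simp
    ring

/-- The distance to the pole is convex where the warping function is nondecreasing. -/
theorem isConvexOn_norm (hw : ∀ s, 0 < s → 0 < w s) {w' : ℝ → ℝ}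
    (hw' : ∀ s, 0 < s → HasDerivAt w (w' s) s) (hw0 : ∀ s, 0 < s → 0 ≤ w' s) :
    IsConvexOn (warpedMetric n w) {0}ᶜ (fun x => ‖x‖) := by
  refine ⟨fun x hx => (contDiffAt_norm ℝ hx).contDiffWithinAt, fun x hx v => ?_⟩
  have hx : x ≠ 0 := hx
  have hr : 0 < ‖x‖ := norm_pos_iff.mpr hx
  have hwr := hw _ hr
  have hpd : ∀ y, y ≠ 0 → ∀ j, pd j (fun x : EuclideanSpace ℝ (Fin (n + 1)) => ‖x‖) y
      = y j / ‖y‖ := fun y hy j => by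
    have h : pd j (fun x : EuclideanSpace ℝ (Fin (n + 1)) => id ‖x‖) y = _ :=
      (hasPd_radial hy (hasDerivAt_id ‖y‖)).pd j
    rw [one_mul] at h
    exact h
  have hpd2 : ∀ i j, pd i (pd j fun x : EuclideanSpace ℝ (Fin (n + 1)) => ‖x‖) x
      = tanProj x i j / ‖x‖ := fun i j =>
    ((hasPd_unit hx j).congr ((eventually_ne_zero hx).mono fun y hy => hpd y hy j)
      fun i => rfl).pd i
  have hhess : ∀ i j, hessian (warpedMetric n w) (fun x => ‖x‖) x i j
      = w ‖x‖ * w' ‖x‖ / ‖x‖ ^ 2 * tanProj x i j := by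
    intro i j
    rw [hessian, hpd2]
    simp only [hpd x hx, christoffel_warpedMetric hx (hw' _ hr) hwr.ne']
    generalize hA : w' ‖x‖ / w ‖x‖ - 1 / ‖x‖ = A
    have h : ∀ k, (A * (x i / ‖x‖ * tanProj x j k + x j / ‖x‖ * tanProj x i k)
        + (1 / ‖x‖ - w ‖x‖ * w' ‖x‖ / ‖x‖ ^ 2) * (tanProj x i j * (x k / ‖x‖))) * (x k / ‖x‖)
        = A * (x i / ‖x‖) * (tanProj x j k * (x k / ‖x‖))
          + A * (x j / ‖x‖) * (tanProj x i k * (x k / ‖x‖))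
          + (1 / ‖x‖ - w ‖x‖ * w' ‖x‖ / ‖x‖ ^ 2) * tanProj x i j * (x k / ‖x‖ * (x k / ‖x‖)) := by
      intro k; ring
    simp only [h, ← Finset.mul_sum, Finset.sum_add_distrib, sum_unit_sq hx,
      sum_tanProj_unit hx]
    ring
  have hsum : ∑ i, ∑ j, hessian (warpedMetric n w) (fun x => ‖x‖) x i j * v i * v j
      = w ‖x‖ * w' ‖x‖ / ‖x‖ ^ 2 * (∑ i, v i ^ 2 - (∑ i, x i / ‖x‖ * v i) ^ 2) := by
    have h : ∀ i j, hessian (warpedMetric n w) (fun x => ‖x‖) x i j * v i * v j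
        = w ‖x‖ * w' ‖x‖ / ‖x‖ ^ 2 * ((if i = j then v i * v j else 0)
          - x i / ‖x‖ * v i * (x j / ‖x‖ * v j)) := by
      intro i j
      rw [hhess, tanProj]; split_ifs <;> ring
    simp only [h, ← Finset.mul_sum, Finset.sum_sub_distrib, ← Finset.sum_mul, Finset.sum_ite_eq,
      Finset.mem_univ, if_true]
    simp only [pow_two]
  rw [hsum]
  -- Cauchy–Schwarz with the unit vector `N`: the tangential part `|v|² - ⟨N, v⟩²` is nonnegative.
  have hcs := Finset.sum_mul_sq_le_sq_mul_sq Finset.univ (fun i => x i / ‖x‖) v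
  have h1 : ∑ i, (x i / ‖x‖) ^ 2 = 1 := by
    rw [← sum_unit_sq hx]; exact Finset.sum_congr rfl fun i _ => pow_two _
  rw [h1, one_mul] at hcs
  exact mul_nonneg (div_nonneg (mul_nonneg hwr.le (hw0 _ hr)) (by positivity)) (by linarith)

end RotSym

/-! ### Bounded solutions of `D' + l D = Φ` near `-∞`. -/

section LinearODE

open MeasureTheory

/-- A bounded function on a left half-line with `D' + l D ≤ R` satisfies `D ≤ R / l`. -/
theorem le_div_of_deriv_add_mul_le {D D' : ℝ → ℝ} {l R X M : ℝ} (hl : 0 < l)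
    (hD : ∀ x ≤ X, HasDerivAt D (D' x) x) (hb : ∀ x ≤ X, |D x| ≤ M)
    (h : ∀ x ≤ X, D' x + l * D x ≤ R) : ∀ x ≤ X, D x ≤ R / l := by
  intro x hx
  -- With the integrating factor the quantity is nonincreasing, and since `D` is bounded it tends to
  -- `0` at `-∞`; this limit plays the role of an initial value.
  have hφ : ∀ z ≤ X, HasDerivAt (fun z => Real.exp (l * z) * (D z - R / l))
      (Real.exp (l * z) * (D' z + l * D z - R)) z := by
    intro z hz
    refine ((((hasDerivAt_id z).const_mul l).exp).mul ((hD z hz).sub_const _)).congr_deriv ?_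
    simp only [id]
    field_simp
    ring
  have hanti : AntitoneOn (fun z => Real.exp (l * z) * (D z - R / l)) (Set.Iic X) := by
    refine antitoneOn_of_hasDerivWithinAt_nonpos (convex_Iic X)
      (fun z hz => (hφ z hz).continuousAt.continuousWithinAt)
      (fun z hz => (hφ z (interior_subset (s := Set.Iic X) hz)).hasDerivWithinAt) fun z hz => ?_
    exact mul_nonpos_of_nonneg_of_nonpos (Real.exp_pos _).le
      (by linarith [h z (interior_subset (s := Set.Iic X) hz)])
  have hexp : Tendsto (fun z => Real.exp (l * z) * (M + |R / l|)) atBot (𝓝 0) := by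
    have := (Real.tendsto_exp_atBot.comp (tendsto_id.const_mul_atBot hl)).mul_const (M + |R / l|)
    simpa using this
  have hlim : Tendsto (fun z => Real.exp (l * z) * (D z - R / l)) atBot (𝓝 0) := by
    refine squeeze_zero_norm' ?_ hexp
    filter_upwards [eventually_le_atBot X] with z hz
    rw [norm_mul, Real.norm_of_nonneg (Real.exp_pos _).le]
    gcongr
    exact (abs_sub _ _).trans (by linarith [hb z hz])
  have h0 : Real.exp (l * x) * (D x - R / l) ≤ 0 := by
    refine ge_of_tendsto hlim ?_
    filter_upwards [eventually_le_atBot x] with z hz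
    exact hanti (hz.trans hx) hx hz
  have := nonpos_of_mul_nonpos_right h0 (Real.exp_pos _)
  linarith

theorem abs_le_div_of_abs_deriv_add_mul_le {D D' : ℝ → ℝ} {l R X M : ℝ} (hl : 0 < l)
    (hD : ∀ x ≤ X, HasDerivAt D (D' x) x) (hb : ∀ x ≤ X, |D x| ≤ M)
    (h : ∀ x ≤ X, |D' x + l * D x| ≤ R) : ∀ x ≤ X, |D x| ≤ R / l := by
  intro x hx
  refine abs_le'.2 ⟨le_div_of_deriv_add_mul_le hl hD hb (fun z hz => (abs_le.1 (h z hz)).2) x hx,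
    le_div_of_deriv_add_mul_le (D := fun z => -D z) (D' := fun z => -D' z) hl
      (fun z hz => (hD z hz).neg) (M := M) (fun z hz => by rw [abs_neg]; exact hb z hz)
      (fun z hz => by linarith [(abs_le.1 (h z hz)).1]) x hx⟩

/-- The term `k |D|` is absorbed: the supremum `N` of `|D|` satisfies `N ≤ (k N + ε) / l`, and `k <
l`. -/
theorem abs_le_of_abs_deriv_add_mul_le_mul {D D' : ℝ → ℝ} {l k ε X M : ℝ} (hk : 0 ≤ k) (hkl : k < l)
    (hD : ∀ x ≤ X, HasDerivAt D (D' x) x) (hb : ∀ x ≤ X, |D x| ≤ M)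
    (h : ∀ x ≤ X, |D' x + l * D x| ≤ k * |D x| + ε) : ∀ x ≤ X, |D x| ≤ ε / (l - k) := by
  have hbdd : BddAbove ((fun x => |D x|) '' Set.Iic X) :=
    ⟨M, by rintro _ ⟨x, hx, rfl⟩; exact hb x hx⟩
  have hne : ((fun x => |D x|) '' Set.Iic X).Nonempty := ⟨_, X, Set.mem_Iic.2 le_rfl, rfl⟩
  set N := sSup ((fun x => |D x|) '' Set.Iic X) with hN
  have hDN : ∀ x ≤ X, |D x| ≤ N := fun x hx => le_csSup hbdd ⟨x, hx, rfl⟩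
  have hl : 0 < l := hk.trans_lt hkl
  have h1 := abs_le_div_of_abs_deriv_add_mul_le (R := k * N + ε) hl hD hb fun x hx =>
    (h x hx).trans (by have := mul_le_mul_of_nonneg_left (hDN x hx) hk; linarith)
  have h2 : N ≤ (k * N + ε) / l := csSup_le hne (by rintro _ ⟨x, hx, rfl⟩; exact h1 x hx)
  intro x hx
  refine (hDN x hx).trans ?_
  rw [le_div_iff₀ hl] at h2
  rw [le_div_iff₀ (by linarith)]
  linarith

theorem tendsto_zero_of_deriv_add_mul {D D' : ℝ → ℝ} {l X M : ℝ} (hl : 0 < l)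
    (hD : ∀ x ≤ X, HasDerivAt D (D' x) x) (hb : ∀ x ≤ X, |D x| ≤ M)
    (h : Tendsto (fun x => D' x + l * D x) atBot (𝓝 0)) : Tendsto D atBot (𝓝 0) := by
  rw [Metric.tendsto_nhds] at h ⊢
  intro ε hε
  obtain ⟨Y, hY⟩ := eventually_atBot.1 (h (ε * l / 2) (by positivity))
  filter_upwards [eventually_le_atBot (min X Y)] with x hx
  have := abs_le_div_of_abs_deriv_add_mul_le (X := min X Y) (R := ε * l / 2) hl
    (fun z hz => hD z (hz.trans (min_le_left _ _))) (fun z hz => hb z (hz.trans (min_le_left _ _)))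
    (fun z hz => by simpa using (hY z (hz.trans (min_le_right _ _))).le) x hx
  rw [Real.dist_eq, sub_zero]
  refine this.trans_lt ?_
  rw [div_lt_iff₀ hl]
  nlinarith [mul_pos hε hl]

/-- Duhamel's formula started at `-∞`: `D(x) = ∫_{-∞}^x e^(-l(x-t)) Φ(t) dt`. -/
theorem exists_bounded_deriv_add_mul_eq {Φ : ℝ → ℝ} {l M : ℝ} (hl : 0 < l)
    (hΦ : Continuous Φ) (hM : ∀ x, |Φ x| ≤ M) :
    ∃ D : ℝ → ℝ, (∀ x, HasDerivAt D (Φ x - l * D x) x) ∧ ∀ x, |D x| ≤ M / l := by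
  have hcont : Continuous fun t => Real.exp (l * t) * Φ t := by fun_prop
  have hint0 : ∀ x, IntegrableOn (fun t => Real.exp (l * t) * M) (Set.Iic x) := fun x =>
    (integrableOn_exp_mul_Iic hl x).mul_const M
  have hbd : ∀ t, ‖Real.exp (l * t) * Φ t‖ ≤ Real.exp (l * t) * M := fun t => by
    rw [norm_mul, Real.norm_of_nonneg (Real.exp_pos _).le]
    exact mul_le_mul_of_nonneg_left (hM t) (Real.exp_pos _).le
  have hint : ∀ x, IntegrableOn (fun t => Real.exp (l * t) * Φ t) (Set.Iic x) := fun x =>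
    (hint0 x).mono' hcont.aestronglyMeasurable.restrict (Eventually.of_forall hbd)
  have hI : ∀ x, HasDerivAt (fun x => ∫ t in Set.Iic x, Real.exp (l * t) * Φ t)
      (Real.exp (l * x) * Φ x) x := by
    intro x
    have h := (intervalIntegral.integral_hasDerivAt_right (hcont.intervalIntegrable 0 x)
      (hcont.stronglyMeasurableAtFilter _ _) hcont.continuousAt).add_const
        (∫ t in Set.Iic 0, Real.exp (l * t) * Φ t)
    refine h.congr_of_eventuallyEq (Eventually.of_forall fun y => ?_)
    simp only [← intervalIntegral.integral_Iic_sub_Iic (hint 0) (hint y)]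
    ring
  refine ⟨fun x => Real.exp (-(l * x)) * ∫ t in Set.Iic x, Real.exp (l * t) * Φ t,
    fun x => ?_, fun x => ?_⟩
  · refine ((((hasDerivAt_id x).const_mul l).neg.exp).mul (hI x)).congr_deriv ?_
    simp only [id, Pi.neg_apply]
    rw [show Real.exp (-(l * x)) * (Real.exp (l * x) * Φ x) = Φ x by
      rw [← mul_assoc, ← Real.exp_add, neg_add_cancel, Real.exp_zero, one_mul]]
    ring
  · have h1 : |∫ t in Set.Iic x, Real.exp (l * t) * Φ t| ≤ ∫ t in Set.Iic x, Real.exp (l * t) * M :=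
      norm_integral_le_of_norm_le (hint0 x) (Eventually.of_forall hbd)
    rw [integral_mul_const, integral_exp_mul_Iic hl] at h1
    rw [abs_mul, abs_of_pos (Real.exp_pos _)]
    calc _ ≤ Real.exp (-(l * x)) * (Real.exp (l * x) / l * M) := by gcongr
      _ = (Real.exp (-(l * x)) * Real.exp (l * x)) * (M / l) := by ring
      _ = M / l := by rw [← Real.exp_add, neg_add_cancel, Real.exp_zero, one_mul]

end LinearODE

/-! ### Existence of a global solution by a contraction argument. -/

section Profile

open scoped BoundedContinuousFunction

theorem hasDerivAt_source {q C : ℝ → ℝ} {p Q : ℝ} (hC : ∀ P, HasDerivAt C (-p * q P) P) (s P : ℝ) :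
    HasDerivAt (fun P => s * C P + p * Q * P) (p * (Q - s * q P)) P := by
  refine (((hC P).const_mul s).add ((hasDerivAt_id P).const_mul (p * Q))).congr_deriv ?_
  ring

/-- The derivative `p (q(Pmax) - s q(P))` of the shifted source lies between `0` and `p q(Pmax)`.
The Lipschitz constant is therefore smaller by `m` than the damping rate `m + p q(Pmax)` used with
it. -/
theorem abs_source_sub_le {q C : ℝ → ℝ} {p Pmax : ℝ} (hp : 0 < p) (hqm : Monotone q)
    (hq00 : q 0 = 0) (hC : ∀ P, HasDerivAt C (-p * q P) P) (s : ℝ) (hs0 : 0 ≤ s) (hs1 : s ≤ 1)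
    (P : ℝ) (hP : P ∈ Set.Icc 0 Pmax) (R : ℝ) (hR : R ∈ Set.Icc 0 Pmax) :
    |s * C P + p * q Pmax * P - (s * C R + p * q Pmax * R)| ≤ p * q Pmax * |P - R| := by
  have := Convex.norm_image_sub_le_of_norm_hasDerivWithin_le (s := Set.Icc 0 Pmax)
    (C := p * q Pmax) (fun x _ => (hasDerivAt_source hC s x).hasDerivWithinAt)
    (fun z hz => by
      have h1 : q z ≤ q Pmax := hqm hz.2
      have h2 : 0 ≤ q z := hq00 ▸ hqm hz.1
      have h3 : s * q z ≤ 1 * q Pmax := mul_le_mul hs1 h1 h2 zero_le_one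
      have h4 : 0 ≤ s * q z := mul_nonneg hs0 h2
      rw [Real.norm_of_nonneg (mul_nonneg hp.le (by linarith))]
      nlinarith) (convex_Icc 0 Pmax) hR hP
  simpa using this

/-- Existence of a solution `(P, y)` with `P` bounded and `y → -∞` at `-∞` of the system
`P' = -m P + a J(y) C(P)`, `y' = a q(P)`. -/
theorem exists_profile {q q' C a J J' : ℝ → ℝ} {p m Pmax I K c : ℝ} (hp : 0 < p) (hm : 0 < m)
    (hq : ∀ P, HasDerivAt q (q' P) P) (hq0 : ∀ P, 0 < q' P) (hq1 : ∀ P, q' P ≤ 1) (hq00 : q 0 = 0)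
    (hC : ∀ P, HasDerivAt C (-p * q P) P) (hC0 : 0 < C 0) (hPmax : 0 < Pmax) (hC1 : C Pmax = 0)
    (ha : Continuous a) (ha0 : ∀ x, 0 < a x) (ha1 : ∀ x, a x ≤ 1) (haa : Antitone a)
    (hI : ∀ x, 0 ≤ x → ∫ t in (0 : ℝ)..x, a t ≤ I)
    (hJ : ∀ y, HasDerivAt J (J' y) y) (hJ0 : ∀ y, 0 < J y) (hJ1 : ∀ y, J y ≤ 1)
    (hJa : Antitone J) (hc : 0 < c) (hJ' : ∀ y ≤ 0, |J' y| ≤ K * Real.exp (c * y)) :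
    ∃ (P y : ℝ → ℝ) (Pmin : ℝ), (∀ x, HasDerivAt P (-m * P x + a x * J (y x) * C (P x)) x) ∧
      (∀ x, HasDerivAt y (a x * q (P x)) x) ∧ (∀ x, 0 ≤ P x ∧ P x ≤ Pmax) ∧ 0 < Pmin ∧
      (∀ x ≤ 0, Pmin ≤ P x) ∧ ∀ x, y x ≤ 0 := by
  have hqm : Monotone q := (strictMono_of_hasDerivAt_pos hq hq0).monotone
  have hqc : Continuous q := continuous_iff_continuousAt.2 fun P => (hq P).continuousAt
  have hCc : Continuous C := continuous_iff_continuousAt.2 fun P => (hC P).continuousAt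
  have hJc : Continuous J := continuous_iff_continuousAt.2 fun P => (hJ P).continuousAt
  have hqlip : ∀ P R, |q P - q R| ≤ |P - R| := by
    intro P R
    have := Convex.norm_image_sub_le_of_norm_hasDerivWithin_le (s := Set.univ) (C := 1)
      (fun x _ => (hq x).hasDerivWithinAt)
      (fun x _ => by rw [Real.norm_of_nonneg (hq0 x).le]; exact hq1 x) convex_univ
      (Set.mem_univ R) (Set.mem_univ P)
    simpa using this
  have hqn : ∀ P, 0 ≤ P → 0 ≤ q P := fun P hP => hq00 ▸ hqm hP
  set Q := q Pmax with hQ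
  have hQ0 : 0 ≤ Q := hqn _ hPmax.le
  have hI0 : 0 ≤ I := by simpa using hI 0 le_rfl
  have hK0 : 0 ≤ K := by
    have := (abs_nonneg _).trans (hJ' 0 le_rfl)
    simpa using this
  have hCanti : ∀ P, 0 ≤ P → C P ≤ C 0 := by
    have : AntitoneOn C (Set.Ici 0) := antitoneOn_of_hasDerivWithinAt_nonpos (convex_Ici 0)
      hCc.continuousOn (fun z _ => (hC z).hasDerivWithinAt) fun z hz => by
        have := hqn z (interior_subset hz)
        nlinarith
    exact fun P hP => this Set.self_mem_Ici hP hP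
  have hCanti2 : ∀ P, 0 ≤ P → P ≤ Pmax → 0 ≤ C P := by
    have : AntitoneOn C (Set.Ici 0) := antitoneOn_of_hasDerivWithinAt_nonpos (convex_Ici 0)
      hCc.continuousOn (fun z _ => (hC z).hasDerivWithinAt) fun z hz => by
        have := hqn z (interior_subset hz)
        nlinarith
    exact fun P hP hP1 => hC1 ▸ this hP hPmax.le hP1
  -- `Pmin` is a lower barrier on `x ≤ 0`, where `a ≥ a(0)` and `J(y) ≥ J(0)`; a small value works
  -- because `C(0) > 0`.
  obtain ⟨Pmin, hPmin0, hPmin1, hPmin2⟩ :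
      ∃ Pmin, 0 < Pmin ∧ Pmin ≤ Pmax ∧ m * Pmin ≤ a 0 * J 0 * C Pmin := by
    have h1 : Tendsto (fun P => a 0 * J 0 * C P - m * P) (𝓝[>] 0)
        (𝓝 (a 0 * J 0 * C 0 - m * 0)) := by
      refine Tendsto.mono_left ?_ nhdsWithin_le_nhds
      exact Continuous.tendsto (by fun_prop) 0
    have h2 : 0 < a 0 * J 0 * C 0 - m * 0 := by
      have := mul_pos (mul_pos (ha0 0) (hJ0 0)) hC0
      linarith
    obtain ⟨P, h3, h4⟩ := ((h1.eventually (lt_mem_nhds h2)).and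
      (Ioc_mem_nhdsGT hPmax)).exists
    exact ⟨P, h4.1, h4.2, by linarith⟩
  set qmin := q Pmin with hqmin
  have hqmin0 : 0 < qmin := by
    rw [← hq00]
    exact strictMono_of_hasDerivAt_pos hq hq0 hPmin0
  set l := m + p * Q with hl
  have hl0 : 0 < l := by positivity
  have ha00 := ha0 0
  -- `E` covers both half-lines: `I` bounds `∫ a` on the right, and the other term bounds `|x| e^(c
  -- a(0) qmin x)` on the left.
  set E := I + 1 / (c * a 0 * qmin) with hE
  have hE0 : 0 ≤ E := by positivity
  -- `-Λ` is the value of the phase at `x = 0`. The first condition keeps the phase nonpositive; the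
  -- second makes the Lipschitz constant of `P ↦ J(y)`, multiplied by `C(0)`, at most `m/2`.
  obtain ⟨Λ, hΛ1, hΛ2⟩ : ∃ Λ, Q * I ≤ Λ ∧
      C 0 * (K * Real.exp (c * (Q * I - Λ)) * E) ≤ m / 2 := by
    have h0 : Tendsto (fun Λ => c * (Q * I - Λ)) atTop atBot :=
      (tendsto_atBot_add_const_left atTop (Q * I) tendsto_neg_atTop_atBot).const_mul_atBot hc
    have h1 : Tendsto (fun Λ => C 0 * (K * Real.exp (c * (Q * I - Λ)) * E)) atTop
        (𝓝 (C 0 * (K * 0 * E))) :=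
      (((Real.tendsto_exp_atBot.comp h0).const_mul K).mul_const E).const_mul (C 0)
    have h2 : C 0 * (K * 0 * E) < m / 2 := by simpa using hm
    obtain ⟨Λ, h3, h4⟩ := ((eventually_ge_atTop (Q * I)).and
      (h1.eventually (gt_mem_nhds h2))).exists
    exact ⟨Λ, h3, h4.le⟩
  set ε := K * Real.exp (c * (Q * I - Λ)) * E with hε
  have hε0 : 0 ≤ ε := by positivity
  -- the phase `y` attached to a bounded function
  let Y : (ℝ → ℝ) → ℝ → ℝ := fun P x => -Λ + ∫ t in (0 : ℝ)..x, a t * q (P t)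
  have hY : ∀ P : ℝ → ℝ, Continuous P → ∀ x, HasDerivAt (Y P) (a x * q (P x)) x := by
    intro P hP x
    have hcont : Continuous fun t => a t * q (P t) := by fun_prop
    exact (intervalIntegral.integral_hasDerivAt_right (hcont.intervalIntegrable 0 x)
      (hcont.stronglyMeasurableAtFilter _ _) hcont.continuousAt).const_add (-Λ)
  have hYc : ∀ P : ℝ → ℝ, Continuous P → Continuous (Y P) := fun P hP =>
    continuous_iff_continuousAt.2 fun x => (hY P hP x).continuousAt
  have hYle : ∀ P : ℝ → ℝ, Continuous P → (∀ x, P x ≤ Pmax) → ∀ x, 0 ≤ x → Y P x ≤ Q * I - Λ := by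
    intro P hP hP1 x hx
    have h : ∫ t in (0 : ℝ)..x, a t * q (P t) ≤ ∫ t in (0 : ℝ)..x, a t * Q := by
      refine intervalIntegral.integral_mono_on hx (Continuous.intervalIntegrable (by fun_prop) _ _)
        (Continuous.intervalIntegrable (by fun_prop) _ _) fun t _ => ?_
      exact mul_le_mul_of_nonneg_left (hqm (hP1 t)) (ha0 t).le
    rw [intervalIntegral.integral_mul_const] at h
    have := mul_le_mul_of_nonneg_right (hI x hx) hQ0
    simp only [Y]
    linarith
  have hYneg : ∀ P : ℝ → ℝ, Continuous P → (∀ x ≤ 0, Pmin ≤ P x) → ∀ x ≤ 0,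
      Y P x ≤ -Λ + a 0 * qmin * x := by
    intro P hP hP1 x hx
    have h : ∫ t in x..0, a 0 * qmin ≤ ∫ t in x..0, a t * q (P t) := by
      refine intervalIntegral.integral_mono_on hx (Continuous.intervalIntegrable (by fun_prop) _ _)
        (Continuous.intervalIntegrable (by fun_prop) _ _) fun t ht => ?_
      exact mul_le_mul (haa ht.2) (hqm (hP1 t ht.2)) hqmin0.le (ha0 t).le
    rw [intervalIntegral.integral_const, smul_eq_mul] at h
    simp only [Y]
    rw [intervalIntegral.integral_symm]
    linarith
  have hYnonpos : ∀ P : ℝ → ℝ, Continuous P → (∀ x, P x ≤ Pmax) → (∀ x ≤ 0, Pmin ≤ P x) →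
      ∀ x, Y P x ≤ 0 := by
    intro P hP hP1 hP2 x
    rcases le_total 0 x with hx | hx
    · linarith [hYle P hP hP1 x hx]
    · have := hYneg P hP hP2 x hx
      have h2 : a 0 * qmin * x ≤ 0 := mul_nonpos_of_nonneg_of_nonpos (by positivity) hx
      have h3 : 0 ≤ Q * I := by positivity
      linarith
  have hJlip : ∀ y z B, y ≤ B → z ≤ B → B ≤ 0 → |J y - J z| ≤ K * Real.exp (c * B) * |y - z| := by
    intro y z B hy hz hB
    have := Convex.norm_image_sub_le_of_norm_hasDerivWithin_le (s := Set.Iic B)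
      (C := K * Real.exp (c * B)) (fun x _ => (hJ x).hasDerivWithinAt)
      (fun x (hx : x ≤ B) => (hJ' x (hx.trans hB)).trans (by gcongr)) (convex_Iic B)
      (Set.mem_Iic.2 hz) (Set.mem_Iic.2 hy)
    simpa using this
  have hYsub : ∀ P R : ℝ → ℝ, Continuous P → Continuous R → ∀ d, (∀ x, |P x - R x| ≤ d) → ∀ x,
      |Y P x - Y R x| ≤ d * |∫ t in (0 : ℝ)..x, a t| := by
    intro P R hP hR d hd x
    have h1 : Y P x - Y R x = ∫ t in (0 : ℝ)..x, (a t * q (P t) - a t * q (R t)) := by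
      rw [intervalIntegral.integral_sub (Continuous.intervalIntegrable (by fun_prop) _ _)
        (Continuous.intervalIntegrable (by fun_prop) _ _)]
      simp only [Y]; ring
    have h2 := intervalIntegral.norm_integral_le_abs_of_norm_le
      (f := fun t => a t * q (P t) - a t * q (R t)) (g := fun t => a t * d) (a := 0) (b := x)
      (μ := MeasureTheory.volume)
      (Eventually.of_forall fun t => by
        rw [← mul_sub, norm_mul, Real.norm_of_nonneg (ha0 t).le]
        exact mul_le_mul_of_nonneg_left ((hqlip _ _).trans (hd t)) (ha0 t).le)
      (Continuous.intervalIntegrable (by fun_prop) _ _)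
    rw [h1]
    refine h2.trans ?_
    rw [intervalIntegral.integral_mul_const, abs_mul, mul_comm,
      abs_of_nonneg ((abs_nonneg _).trans (hd 0))]
  -- The bound on the difference of two phases grows linearly as `x → -∞`, but both phases go to
  -- `-∞` linearly there and `J'` decays exponentially, so the bound is uniform in `x`.
  have hJsub : ∀ P R : ℝ → ℝ, Continuous P → Continuous R → (∀ x, P x ≤ Pmax) → (∀ x, R x ≤ Pmax) →
      (∀ x ≤ 0, Pmin ≤ P x) → (∀ x ≤ 0, Pmin ≤ R x) → ∀ d, (∀ x, |P x - R x| ≤ d) → ∀ x,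
      |J (Y P x) - J (Y R x)| ≤ ε * d := by
    intro P R hP hR hP1 hR1 hP2 hR2 d hd x
    have hd0 : 0 ≤ d := (abs_nonneg _).trans (hd 0)
    have hs := hYsub P R hP hR d hd x
    rcases le_total 0 x with hx | hx
    · have h1 := hJlip _ _ _ (hYle P hP hP1 x hx) (hYle R hR hR1 x hx) (by linarith)
      have h2 : |∫ t in (0 : ℝ)..x, a t| ≤ I := by
        rw [abs_of_nonneg (intervalIntegral.integral_nonneg hx fun t _ => (ha0 t).le)]
        exact hI x hx
      have h3 : I ≤ E := by rw [hE]; linarith [show 0 ≤ 1 / (c * a 0 * qmin) by positivity]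
      calc _ ≤ K * Real.exp (c * (Q * I - Λ)) * (d * E) := by
            refine h1.trans (mul_le_mul_of_nonneg_left (hs.trans ?_) (by positivity))
            exact mul_le_mul_of_nonneg_left (h2.trans h3) hd0
        _ = ε * d := by rw [hε]; ring
    · have hB : -Λ + a 0 * qmin * x ≤ 0 := by
        have h2 : a 0 * qmin * x ≤ 0 := mul_nonpos_of_nonneg_of_nonpos (by positivity) hx
        have h3 : 0 ≤ Q * I := by positivity
        linarith
      have h1 := hJlip _ _ _ (hYneg P hP hP2 x hx) (hYneg R hR hR2 x hx) hB
      have h2 : |∫ t in (0 : ℝ)..x, a t| ≤ -x := by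
        have := intervalIntegral.norm_integral_le_of_norm_le_const (a := 0) (b := x) (f := a)
          (C := 1) fun t _ => by rw [Real.norm_of_nonneg (ha0 t).le]; exact ha1 t
        rwa [one_mul, sub_zero, abs_of_nonpos hx] at this
      have h4 : Real.exp (c * (a 0 * qmin * x)) * (-x) ≤ E := by
        have hk : 0 < c * a 0 * qmin := by positivity
        -- This is `u e^(-u) ≤ 1`, from `1 + u ≤ e^u`.
        have h5 : Real.exp (c * (a 0 * qmin * x)) * (c * a 0 * qmin * (-x)) ≤ 1 := by
          have h6 := Real.add_one_le_exp (c * a 0 * qmin * (-x))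
          have h7 : Real.exp (c * (a 0 * qmin * x)) * Real.exp (c * a 0 * qmin * (-x)) = 1 := by
            rw [← Real.exp_add]; ring_nf; exact Real.exp_zero
          rw [← h7]
          exact mul_le_mul_of_nonneg_left (by linarith) (Real.exp_pos _).le
        have h8 : Real.exp (c * (a 0 * qmin * x)) * (-x) ≤ 1 / (c * a 0 * qmin) := by
          rw [le_div_iff₀ hk]; linarith
        rw [hE]; linarith
      have h9 : Real.exp (c * -Λ) ≤ Real.exp (c * (Q * I - Λ)) := by
        apply Real.exp_le_exp.2
        have h3 : 0 ≤ Q * I := by positivity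
        exact mul_le_mul_of_nonneg_left (by linarith) hc.le
      have h10 : 0 ≤ -x := by linarith
      calc _ ≤ K * Real.exp (c * (-Λ + a 0 * qmin * x)) * (d * (-x)) := by
            refine h1.trans (mul_le_mul_of_nonneg_left (hs.trans ?_) (by positivity))
            exact mul_le_mul_of_nonneg_left h2 hd0
        _ = K * Real.exp (c * -Λ) * d * (Real.exp (c * (a 0 * qmin * x)) * (-x)) := by
            rw [mul_add, Real.exp_add]; ring
        _ ≤ K * Real.exp (c * (Q * I - Λ)) * d * E := by gcongr
        _ = ε * d := by rw [hε]; ring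
  -- monotonicity and Lipschitz bound of the nonlinearity
  have hgder := hasDerivAt_source (p := p) (Q := Q) hC
  have hgmono : ∀ s, 0 ≤ s → s ≤ 1 → MonotoneOn (fun P => s * C P + p * Q * P)
      (Set.Icc 0 Pmax) := by
    intro s hs0 hs1
    refine monotoneOn_of_hasDerivWithinAt_nonneg (convex_Icc 0 Pmax)
      (fun z _ => (hgder s z).continuousAt.continuousWithinAt)
      (fun z _ => (hgder s z).hasDerivWithinAt) fun z hz => ?_
    have hz := interior_subset hz
    have h1 : q z ≤ Q := hqm hz.2
    have h2 := hqn z hz.1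
    have h3 : s * q z ≤ 1 * Q := mul_le_mul hs1 h1 h2 zero_le_one
    exact mul_nonneg hp.le (by linarith)
  have hglip := abs_source_sub_le (Pmax := Pmax) hp hqm hq00 hC
  have hs0 : ∀ x y, 0 ≤ a x * J y := fun x y => (mul_pos (ha0 x) (hJ0 y)).le
  have hs1 : ∀ x y, a x * J y ≤ 1 := fun x y => by
    simpa using mul_le_mul (ha1 x) (hJ1 y) (hJ0 y).le zero_le_one
  -- the complete metric space
  let S : Set (ℝ →ᵇ ℝ) := {P | (∀ x, 0 ≤ P x) ∧ (∀ x, P x ≤ Pmax) ∧ ∀ x ≤ 0, Pmin ≤ P x}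
  have hSclosed : IsClosed S := by
    have hev : ∀ x : ℝ, Continuous fun P : ℝ →ᵇ ℝ => P x := fun x =>
      continuous_eval_const x
    simp only [S, Set.ofPred_and, Set.ofPred_forall]
    refine (isClosed_iInter fun x => isClosed_le continuous_const (hev x)).inter
      ((isClosed_iInter fun x => isClosed_le (hev x) continuous_const).inter
        (isClosed_iInter fun x => isClosed_iInter fun _ => isClosed_le continuous_const (hev x)))
  have : CompleteSpace S := hSclosed.completeSpace_coe
  have : Nonempty S := ⟨⟨BoundedContinuousFunction.const ℝ Pmax, fun x => hPmax.le,
    fun x => le_rfl, fun x _ => hPmin1⟩⟩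
  -- Adding `p Q P` to both sides turns the equation into `P' + l P = Φ(P)` with a source monotone
  -- in `P` for a fixed phase, so that constant barriers are preserved.
  let Φ : (ℝ → ℝ) → ℝ → ℝ := fun P x => a x * J (Y P x) * C (P x) + p * Q * P x
  have hlm : 0 ≤ p * Q := mul_nonneg hp.le hQ0
  have hΦ0 : ∀ P : S, ∀ x, 0 ≤ Φ P.1 x := fun P x =>
    add_nonneg (mul_nonneg (hs0 _ _) (hCanti2 _ (P.2.1 x) (P.2.2.1 x)))
      (mul_nonneg hlm (P.2.1 x))
  have hΦ1 : ∀ P : S, ∀ x, Φ P.1 x ≤ p * Q * Pmax := fun P x => by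
    have := hgmono _ (hs0 x (Y P.1 x)) (hs1 _ _) ⟨P.2.1 x, P.2.2.1 x⟩ ⟨hPmax.le, le_rfl⟩
      (P.2.2.1 x)
    simpa [hC1] using this
  have hΦ2 : ∀ P : S, ∀ x ≤ 0, l * Pmin ≤ Φ P.1 x := fun P x hx => by
    have h1 := hgmono _ (hs0 x (Y P.1 x)) (hs1 _ _) ⟨hPmin0.le, hPmin1⟩ ⟨P.2.1 x, P.2.2.1 x⟩
      (P.2.2.2 x hx)
    have h2 : a 0 * J 0 * C Pmin ≤ a x * J (Y P.1 x) * C Pmin := by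
      refine mul_le_mul_of_nonneg_right ?_ (hCanti2 _ hPmin0.le hPmin1)
      exact mul_le_mul (haa hx) (hJa (hYnonpos P.1 P.1.continuous P.2.2.1 P.2.2.2 x)) (hJ0 0).le
        (ha0 x).le
    simp only at h1
    simp only [Φ]
    linarith
  have hΦc : ∀ P : S, Continuous (Φ P.1) := fun P => by
    have := hYc P.1 P.1.continuous
    have := P.1.continuous
    fun_prop
  have hT : ∀ P : S, ∃ R : S, ∀ x, HasDerivAt R.1 (Φ P.1 x - l * R.1 x) x := by
    intro P
    obtain ⟨D, hD, hDb⟩ := exists_bounded_deriv_add_mul_eq (M := p * Q * Pmax) hl0 (hΦc P)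
      fun x => by rw [abs_of_nonneg (hΦ0 P x)]; exact hΦ1 P x
    have hDc : Continuous D := continuous_iff_continuousAt.2 fun x => (hD x).continuousAt
    refine ⟨⟨BoundedContinuousFunction.ofNormedAddCommGroup D hDc _ hDb, fun x => ?_, fun x => ?_,
      fun x hx => ?_⟩, hD⟩
    · have := le_div_of_deriv_add_mul_le (D := fun z => -D z) (X := x) (R := 0) hl0
        (fun z _ => (hD z).neg)
        (fun z _ => by rw [abs_neg]; exact hDb z)
        (fun z _ => by linarith [hΦ0 P z]) x le_rfl
      simp only [zero_div] at this
      exact neg_nonpos.1 this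
    · have := le_div_of_deriv_add_mul_le (D := D) (X := x) (R := p * Q * Pmax) hl0
        (fun z _ => hD z) (fun z _ => hDb z) (fun z _ => by linarith [hΦ1 P z]) x le_rfl
      refine this.trans ?_
      rw [div_le_iff₀ hl0]
      nlinarith
    · have := le_div_of_deriv_add_mul_le (D := fun z => -D z) (X := 0) (R := -(l * Pmin)) hl0
        (fun z _ => (hD z).neg)
        (fun z _ => by rw [abs_neg]; exact hDb z)
        (fun z hz => by linarith [hΦ2 P z hz]) x hx
      rw [← mul_neg, mul_div_cancel_left₀ _ hl0.ne'] at this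
      exact neg_le_neg_iff.1 this
  choose T hT using hT
  have hκ0 : 0 ≤ (l - m / 2) / l := div_nonneg (by linarith) hl0.le
  -- The source has Lipschitz constant `p Q = l - m` in `P` and at most `m/2` through the phase;
  -- inverting `D' + l D` divides the sum by `l`.
  have hcontr : ContractingWith (Real.toNNReal ((l - m / 2) / l)) T := by
    refine ⟨?_, LipschitzWith.of_dist_le_mul fun P R => ?_⟩
    · rw [Real.toNNReal_lt_one, div_lt_one hl0]
      linarith
    · rw [Real.coe_toNNReal _ hκ0]
      set d := dist P R with hd
      have hd0 : 0 ≤ d := dist_nonneg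
      have hdx : ∀ x, |P.1 x - R.1 x| ≤ d := fun x =>
        BoundedContinuousFunction.dist_coe_le_dist (f := P.1) (g := R.1) x
      have hΦsub : ∀ x, |Φ P.1 x - Φ R.1 x| ≤ (l - m / 2) * d := by
        intro x
        have h1 := hglip _ (hs0 x (Y P.1 x)) (hs1 _ _) _ ⟨P.2.1 x, P.2.2.1 x⟩ _
          ⟨R.2.1 x, R.2.2.1 x⟩
        have h2 := hJsub P.1 R.1 P.1.continuous R.1.continuous P.2.2.1 R.2.2.1 P.2.2.2 R.2.2.2 d
          hdx x
        have h3 : |a x * C (R.1 x) * (J (Y P.1 x) - J (Y R.1 x))| ≤ C 0 * (ε * d) := by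
          have hCR := hCanti2 _ (R.2.1 x) (R.2.2.1 x)
          rw [abs_mul, abs_of_nonneg (mul_nonneg (ha0 x).le hCR)]
          refine mul_le_mul ?_ h2 (abs_nonneg _) hC0.le
          simpa using mul_le_mul (ha1 x) (hCanti _ (R.2.1 x)) hCR zero_le_one
        have h4 : Φ P.1 x - Φ R.1 x = (a x * J (Y P.1 x) * C (P.1 x) + p * Q * P.1 x
            - (a x * J (Y P.1 x) * C (R.1 x) + p * Q * R.1 x))
            + a x * C (R.1 x) * (J (Y P.1 x) - J (Y R.1 x)) := by
          simp only [Φ]; ring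
        rw [h4]
        refine (abs_add_le _ _).trans ((add_le_add h1 h3).trans ?_)
        have h5 := mul_le_mul_of_nonneg_left (hdx x) hlm
        have h6 := mul_le_mul_of_nonneg_right hΛ2 hd0
        linarith
      refine (BoundedContinuousFunction.dist_le (by positivity)).2 fun x => ?_
      have := abs_le_div_of_abs_deriv_add_mul_le (D := fun z => (T P).1 z - (T R).1 z) (X := x)
        (M := Pmax) (R := (l - m / 2) * d) hl0 (fun z _ => (hT P z).sub (hT R z))
        (fun z _ => abs_le.2 ⟨by linarith [(T P).2.1 z, (T R).2.2.1 z],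
          by linarith [(T R).2.1 z, (T P).2.2.1 z]⟩)
        (fun z _ => by
          refine le_trans (le_of_eq ?_) (hΦsub z)
          congr 1
          ring) x le_rfl
      rw [Real.dist_eq, div_mul_eq_mul_div]
      exact this
  obtain ⟨P, hP⟩ : ∃ P, T P = P := ⟨_, hcontr.fixedPoint_isFixedPt⟩
  refine ⟨P.1, Y P.1, Pmin, fun x => ?_, hY _ P.1.continuous, fun x => ⟨P.2.1 x, P.2.2.1 x⟩, hPmin0,
    P.2.2.2, hYnonpos P.1 P.1.continuous P.2.2.1 P.2.2.2⟩
  have := hT P x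
  rw [hP] at this
  refine this.congr_deriv ?_
  simp only [Φ]
  ring

end Profile

/-- A differentiable function on the line with derivative at least `1` has a differentiable
inverse. -/
theorem exists_inverse_of_one_le_deriv {φ φ' : ℝ → ℝ} (h : ∀ x, HasDerivAt φ (φ' x) x)
    (h1 : ∀ x, 1 ≤ φ' x) :
    ∃ ψ : ℝ → ℝ, (∀ y, φ (ψ y) = y) ∧ (∀ x, ψ (φ x) = x) ∧
      ∀ y, HasDerivAt ψ (φ' (ψ y))⁻¹ y := by
  have hmono : StrictMono φ := strictMono_of_hasDerivAt_pos h fun x => by linarith [h1 x]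
  have hcont : Continuous φ := continuous_iff_continuousAt.2 fun x => (h x).continuousAt
  -- Since `φ - id` is monotone, `φ` is unbounded on both sides, hence surjective.
  have hsub : Monotone fun x => φ x - x :=
    monotone_of_hasDerivAt_nonneg (fun x => (h x).sub (hasDerivAt_id x))
      fun x => by simp only [Pi.zero_apply]; linarith [h1 x]
  have htop : Tendsto φ atTop atTop := by
    refine tendsto_atTop_mono' _ ?_ (tendsto_atTop_add_const_left atTop (φ 0) tendsto_id)
    filter_upwards [eventually_ge_atTop 0] with x hx
    have := hsub hx
    simp only [sub_zero] at this
    simp only [id]; linarith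
  have hbot : Tendsto φ atBot atBot := by
    refine tendsto_atBot_mono' _ ?_ (tendsto_atBot_add_const_left atBot (φ 0) tendsto_id)
    filter_upwards [eventually_le_atBot 0] with x hx
    have := hsub hx
    simp only [sub_zero] at this
    simp only [id]; linarith
  let e := hmono.orderIsoOfSurjective φ (hcont.surjective htop hbot)
  have he : ∀ x, e x = φ x := fun x => rfl
  refine ⟨e.symm, fun y => ?_, fun x => ?_, fun y => ?_⟩
  · rw [← he, e.apply_symm_apply]
  · rw [← he, e.symm_apply_apply]
  · refine HasDerivAt.of_local_left_inverse e.symm.continuous.continuousAt (h _)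
      (by linarith [h1 (e.symm y)]) (Eventually.of_forall fun y => ?_)
    rw [← he, e.apply_symm_apply]

/-! ### The algebraic relation between slope, flux and source. -/

section Constitutive

/-- The function `q ↦ q (q² + ν)^((p-2)/2)` relating `f' g / j(f)` to the flux. -/
def fluxFun (ν p z : ℝ) : ℝ := z * (z ^ 2 + ν) ^ ((p - 2) / 2)

/-- The derivative of `fluxFun`. -/
def fluxFunDeriv (ν p z : ℝ) : ℝ := (z ^ 2 + ν) ^ ((p - 2) / 2 - 1) * ((p - 1) * z ^ 2 + ν)

variable {ν p : ℝ}

theorem rpow_sub_one_mul (hν : 1 ≤ ν) (z : ℝ) :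
    (z ^ 2 + ν) ^ ((p - 2) / 2) = (z ^ 2 + ν) ^ ((p - 2) / 2 - 1) * (z ^ 2 + ν) := by
  have h : 0 < z ^ 2 + ν := by positivity
  rw [Real.rpow_sub_one h.ne']; field_simp

theorem hasDerivAt_rpow_sq_add (hν : 1 ≤ ν) (z : ℝ) :
    HasDerivAt (fun z => (z ^ 2 + ν) ^ ((p - 2) / 2))
      ((p - 2) * z * (z ^ 2 + ν) ^ ((p - 2) / 2 - 1)) z := by
  have h : 0 < z ^ 2 + ν := by positivity
  refine ((((hasDerivAt_pow 2 z).add_const ν)).rpow_const (p := (p - 2) / 2)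
    (Or.inl h.ne')).congr_deriv ?_
  push_cast
  ring

theorem hasDerivAt_fluxFun (hν : 1 ≤ ν) (z : ℝ) :
    HasDerivAt (fluxFun ν p) (fluxFunDeriv ν p z) z := by
  refine ((hasDerivAt_id z).mul (hasDerivAt_rpow_sq_add (p := p) hν z)).congr_deriv ?_
  rw [fluxFunDeriv, rpow_sub_one_mul hν]
  simp only [id]; ring

/-- This makes the flux globally invertible with a `1`-Lipschitz inverse `q`. -/
theorem one_le_fluxFunDeriv (hν : 1 ≤ ν) (hp : 2 < p) (z : ℝ) : 1 ≤ fluxFunDeriv ν p z := by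
  have h1 : 1 ≤ z ^ 2 + ν := by nlinarith [sq_nonneg z]
  have h2 : 1 ≤ (z ^ 2 + ν) ^ ((p - 2) / 2) := Real.one_le_rpow h1 (by linarith)
  rw [rpow_sub_one_mul hν] at h2
  refine h2.trans ?_
  rw [fluxFunDeriv]
  refine mul_le_mul_of_nonneg_left ?_ (Real.rpow_nonneg (by linarith) _)
  nlinarith [sq_nonneg z]

/-- The function `C(P) = (q² + ν)^((p-2)/2) (ν - (p-1) q²)` as a function of `q`. -/
def sourceFun (ν p z : ℝ) : ℝ := (z ^ 2 + ν) ^ ((p - 2) / 2) * (ν - (p - 1) * z ^ 2)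

/-- The derivative of the source is `-p z` times that of the flux, which is why `dC/dP = -p q(P)`
when the source is expressed through the flux `P`. -/
theorem hasDerivAt_sourceFun (hν : 1 ≤ ν) (z : ℝ) :
    HasDerivAt (sourceFun ν p) (-p * z * fluxFunDeriv ν p z) z := by
  refine ((hasDerivAt_rpow_sq_add (p := p) hν z).mul
    (((hasDerivAt_pow 2 z).const_mul (p - 1)).const_sub ν)).congr_deriv ?_
  rw [fluxFunDeriv, rpow_sub_one_mul hν]
  push_cast
  ring

end Constitutive

/-! ### The concave warping function of the target and its flow. -/

section JWarp

variable {σ : ℝ}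

/-- The derivative of `jWarp`. -/
def jWarp' (σ t : ℝ) : ℝ := σ * (t + σ ^ (1 / (1 - σ))) ^ (σ - 1)

/-- The second derivative of `jWarp`. -/
def jWarp'' (σ t : ℝ) : ℝ := σ * ((σ - 1) * (t + σ ^ (1 / (1 - σ))) ^ (σ - 2))

theorem hasDerivAt_jWarp (h0 : 0 < σ) {t : ℝ} (ht : 0 ≤ t) :
    HasDerivAt (jWarp σ) (jWarp' σ t) t := by
  have hb : 0 < t + σ ^ (1 / (1 - σ)) := add_pos_of_nonneg_of_pos ht (Real.rpow_pos_of_pos h0 _)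
  refine ((((hasDerivAt_id t).add_const _).rpow_const (Or.inl hb.ne')).sub_const _).congr_deriv ?_
  rw [jWarp']; simp only [id]; ring

theorem hasDerivAt_jWarp' (h0 : 0 < σ) {t : ℝ} (ht : 0 ≤ t) :
    HasDerivAt (jWarp' σ) (jWarp'' σ t) t := by
  have hb : 0 < t + σ ^ (1 / (1 - σ)) := add_pos_of_nonneg_of_pos ht (Real.rpow_pos_of_pos h0 _)
  refine ((((hasDerivAt_id t).add_const _).rpow_const (Or.inl hb.ne')).const_mul σ).congr_deriv ?_
  rw [jWarp'', show σ - 1 - 1 = σ - 2 by ring]; simp only [id]; ring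

theorem jWarp_zero (h0 : 0 < σ) : jWarp σ 0 = 0 := by
  rw [jWarp, zero_add, ← Real.rpow_mul h0.le, show 1 / (1 - σ) * σ = σ / (1 - σ) by ring, sub_self]

theorem jWarp'_zero (h0 : 0 < σ) (h1 : σ < 1) : jWarp' σ 0 = 1 := by
  have : 1 - σ ≠ 0 := by linarith
  rw [jWarp', zero_add, ← Real.rpow_mul h0.le,
    show 1 / (1 - σ) * (σ - 1) = -1 by field_simp; ring, Real.rpow_neg_one]
  field_simp

theorem jWarp'_pos (h0 : 0 < σ) {t : ℝ} (ht : 0 ≤ t) : 0 < jWarp' σ t :=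
  mul_pos h0 (Real.rpow_pos_of_pos (add_pos_of_nonneg_of_pos ht (Real.rpow_pos_of_pos h0 _)) _)

theorem jWarp'_anti (h0 : 0 < σ) (h1 : σ < 1) {s t : ℝ} (hs : 0 ≤ s) (hst : s ≤ t) :
    jWarp' σ t ≤ jWarp' σ s := by
  have hb := Real.rpow_pos_of_pos h0 (1 / (1 - σ))
  exact mul_le_mul_of_nonneg_left (Real.rpow_le_rpow_of_nonpos (by linarith) (by linarith)
    (by linarith)) h0.le

theorem jWarp'_le_one (h0 : 0 < σ) (h1 : σ < 1) {t : ℝ} (ht : 0 ≤ t) : jWarp' σ t ≤ 1 :=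
  jWarp'_zero h0 h1 ▸ jWarp'_anti h0 h1 le_rfl ht

theorem abs_jWarp''_le (h0 : 0 < σ) (h1 : σ < 1) {t : ℝ} (ht : 0 ≤ t) :
    |jWarp'' σ t| ≤ |jWarp'' σ 0| := by
  have hb := Real.rpow_pos_of_pos h0 (1 / (1 - σ))
  simp only [jWarp'', abs_mul]
  gcongr _ * (_ * ?_)
  rw [abs_of_pos (Real.rpow_pos_of_pos (by linarith) _),
    abs_of_pos (Real.rpow_pos_of_pos (by linarith) _)]
  exact Real.rpow_le_rpow_of_nonpos (by linarith) (by linarith) (by linarith)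

theorem jWarp_strictMonoOn (h0 : 0 < σ) : StrictMonoOn (jWarp σ) (Set.Ici 0) :=
  strictMonoOn_of_hasDerivWithinAt_pos (convex_Ici 0)
    (fun _ ht => (hasDerivAt_jWarp h0 ht).continuousAt.continuousWithinAt)
    (fun _ ht => (hasDerivAt_jWarp h0 (interior_subset (s := Set.Ici (0:ℝ)) ht)).hasDerivWithinAt)
    (fun _ ht => jWarp'_pos h0 (interior_subset (s := Set.Ici (0:ℝ)) ht))

theorem jWarp_pos (h0 : 0 < σ) {t : ℝ} (ht : 0 < t) : 0 < jWarp σ t :=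
  jWarp_zero h0 ▸ jWarp_strictMonoOn h0 Set.self_mem_Ici ht.le ht

theorem jWarp_le (h0 : 0 < σ) (h1 : σ < 1) {t : ℝ} (ht : 0 ≤ t) : jWarp σ t ≤ t := by
  have h : AntitoneOn (fun t => jWarp σ t - t) (Set.Ici 0) :=
    antitoneOn_of_hasDerivWithinAt_nonpos (convex_Ici 0)
    (fun t ht => ((hasDerivAt_jWarp h0 ht).sub (hasDerivAt_id t)).continuousAt.continuousWithinAt)
    (fun t ht => ((hasDerivAt_jWarp h0 (interior_subset (s := Set.Ici (0:ℝ)) ht)).sub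
      (hasDerivAt_id t)).hasDerivWithinAt)
    (fun t ht => by linarith [jWarp'_le_one h0 h1 (interior_subset (s := Set.Ici (0:ℝ)) ht)])
  have := h Set.self_mem_Ici ht ht
  simp only [jWarp_zero h0] at this
  linarith

/-- A concave function lies above its chord over `[0, 1]`. The bound yields the exponential decay of
the flow of `j` at `-∞`. -/
theorem mul_jWarp_one_le (h0 : 0 < σ) (h1 : σ < 1) {t : ℝ} (ht : 0 ≤ t) (ht1 : t ≤ 1) :
    jWarp σ 1 * t ≤ jWarp σ t := by
  have h : ConcaveOn ℝ (Set.Ici 0) (jWarp σ) := by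
    refine AntitoneOn.concaveOn_of_deriv (convex_Ici 0)
      (fun t ht => (hasDerivAt_jWarp h0 ht).continuousAt.continuousWithinAt)
      (fun t ht => (hasDerivAt_jWarp h0
        (interior_subset (s := Set.Ici (0:ℝ)) ht)).differentiableAt.differentiableWithinAt) ?_
    intro s hs t ht hst
    have hs := interior_subset (s := Set.Ici (0:ℝ)) hs
    have ht := interior_subset (s := Set.Ici (0:ℝ)) ht
    rw [(hasDerivAt_jWarp h0 hs).deriv, (hasDerivAt_jWarp h0 ht).deriv]
    exact jWarp'_anti h0 h1 hs hst
  have := h.2 (Set.self_mem_Ici) (Set.mem_Ici.2 zero_le_one) (sub_nonneg.2 ht1) ht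
    (by ring)
  simp only [smul_eq_mul, jWarp_zero h0, mul_zero, mul_one, zero_add] at this
  linarith

/-- The flow of the autonomous equation `e' = j(e)`. -/
theorem exists_flow_jWarp (h0 : 0 < σ) (h1 : σ < 1) :
    ∃ e : ℝ → ℝ, (∀ y, 0 < e y) ∧ (∀ y, HasDerivAt e (jWarp σ (e y)) y) ∧
      ∀ y ≤ 0, e y ≤ Real.exp (jWarp σ 1 * y) := by
  -- With `v = log e` the equation separates: the time needed to reach `v` is the integral of `k`.
  -- As `j(t) ≤ t`, `k ≥ 1`, so the time runs over the whole line and the flow is global.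
  let k : ℝ → ℝ := fun v => Real.exp v / jWarp σ (Real.exp v)
  have hjpos : ∀ v, 0 < jWarp σ (Real.exp v) := fun v => jWarp_pos h0 (Real.exp_pos v)
  have hjc : Continuous fun v => jWarp σ (Real.exp v) := continuous_iff_continuousAt.2 fun v =>
    ContinuousAt.comp (g := jWarp σ) (hasDerivAt_jWarp h0 (Real.exp_pos v).le).continuousAt
      Real.continuous_exp.continuousAt
  have hkc : Continuous k := Real.continuous_exp.div hjc fun v => (hjpos v).ne'
  have hφ : ∀ v, HasDerivAt (fun v => ∫ s in (0 : ℝ)..v, k s) (k v) v := fun v =>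
    intervalIntegral.integral_hasDerivAt_right (hkc.intervalIntegrable 0 v)
      (hkc.stronglyMeasurableAtFilter _ _) hkc.continuousAt
  obtain ⟨ψ, h2, h3, h4⟩ := exists_inverse_of_one_le_deriv hφ fun v => by
    rw [one_le_div (hjpos v)]
    exact jWarp_le h0 h1 (Real.exp_pos v).le
  refine ⟨fun y => Real.exp (ψ y), fun y => Real.exp_pos _, fun y => ?_, fun y hy => ?_⟩
  · refine (h4 y).exp.congr_deriv ?_
    simp only [k]
    have := hjpos (ψ y)
    field_simp
  · have hψ0 : ψ 0 = 0 := by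
      have := h3 0
      rwa [intervalIntegral.integral_same] at this
    have hψm : Monotone ψ := monotone_of_hasDerivAt_nonneg h4 fun y =>
      inv_nonneg.2 (div_nonneg (Real.exp_pos _).le (hjpos _).le)
    -- For `y ≤ 0` the flow satisfies `e ≤ 1`, so `(log e)' = j(e)/e ≥ j(1)`.
    have hmono : MonotoneOn (fun y => ψ y - jWarp σ 1 * y) (Set.Iic 0) := by
      refine monotoneOn_of_hasDerivWithinAt_nonneg (convex_Iic 0)
        (fun z _ => ((h4 z).sub ((hasDerivAt_id z).const_mul _)).continuousAt.continuousWithinAt)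
        (fun z _ => ((h4 z).sub ((hasDerivAt_id z).const_mul _)).hasDerivWithinAt) fun z hz => ?_
      have hz : z ≤ 0 := interior_subset (s := Set.Iic (0:ℝ)) hz
      have h5 : ψ z ≤ 0 := hψ0 ▸ hψm hz
      have h6 := mul_jWarp_one_le h0 h1 (Real.exp_pos (ψ z)).le (Real.exp_le_one_iff.2 h5)
      simp only [k, inv_div, mul_one]
      rw [sub_nonneg, le_div_iff₀ (Real.exp_pos _)]
      exact h6
    have := hmono hy (Set.mem_Iic.2 le_rfl) hy
    simp only [hψ0, mul_zero, sub_zero] at this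
    exact Real.exp_le_exp.2 (by linarith)

end JWarp

/-! ### The warping function of the domain and `1/g'` as a function of `g`. -/

section GWarp

variable {δ : ℝ}

/-- The derivative of `gWarp`. -/
def gWarp' (δ s : ℝ) : ℝ := δ * (s + δ ^ (-1 / (δ - 1))) ^ (δ - 1)

/-- The second derivative of `gWarp`. -/
def gWarp'' (δ s : ℝ) : ℝ := δ * ((δ - 1) * (s + δ ^ (-1 / (δ - 1))) ^ (δ - 2))

/-- The reciprocal of `g'`, as a function of `g`. -/
def gRecip (δ u : ℝ) : ℝ := (δ * (u + δ ^ (-δ / (δ - 1))) ^ ((δ - 1) / δ))⁻¹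

theorem hasDerivAt_gWarp (h1 : 1 < δ) {s : ℝ} (hs : 0 ≤ s) :
    HasDerivAt (gWarp δ) (gWarp' δ s) s := by
  have hb : 0 < s + δ ^ (-1 / (δ - 1)) :=
    add_pos_of_nonneg_of_pos hs (Real.rpow_pos_of_pos (by linarith) _)
  refine ((((hasDerivAt_id s).add_const _).rpow_const (Or.inl hb.ne')).sub_const _).congr_deriv ?_
  rw [gWarp']; simp only [id]; ring

theorem hasDerivAt_gWarp' (h1 : 1 < δ) {s : ℝ} (hs : 0 ≤ s) :
    HasDerivAt (gWarp' δ) (gWarp'' δ s) s := by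
  have hb : 0 < s + δ ^ (-1 / (δ - 1)) :=
    add_pos_of_nonneg_of_pos hs (Real.rpow_pos_of_pos (by linarith) _)
  refine ((((hasDerivAt_id s).add_const _).rpow_const (Or.inl hb.ne')).const_mul δ).congr_deriv ?_
  rw [gWarp'', show δ - 1 - 1 = δ - 2 by ring]; simp only [id]; ring

theorem gWarp_zero (h1 : 1 < δ) : gWarp δ 0 = 0 := by
  rw [gWarp, zero_add, ← Real.rpow_mul (by linarith),
    show -1 / (δ - 1) * δ = -δ / (δ - 1) by ring, sub_self]

theorem gWarp'_zero (h1 : 1 < δ) : gWarp' δ 0 = 1 := by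
  have : δ - 1 ≠ 0 := by linarith
  rw [gWarp', zero_add, ← Real.rpow_mul (by linarith),
    show -1 / (δ - 1) * (δ - 1) = -1 by field_simp, Real.rpow_neg_one]
  field_simp

theorem one_le_gWarp' (h1 : 1 < δ) {s : ℝ} (hs : 0 ≤ s) : 1 ≤ gWarp' δ s := by
  have hb := Real.rpow_pos_of_pos (show 0 < δ by linarith) (-1 / (δ - 1))
  rw [← gWarp'_zero h1]
  exact mul_le_mul_of_nonneg_left (Real.rpow_le_rpow (by linarith) (by linarith) (by linarith))
    (by linarith)

theorem gWarp_strictMonoOn (h1 : 1 < δ) : StrictMonoOn (gWarp δ) (Set.Ici 0) :=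
  strictMonoOn_of_hasDerivWithinAt_pos (convex_Ici 0)
    (fun t ht => (hasDerivAt_gWarp h1 ht).continuousAt.continuousWithinAt)
    (fun t ht => (hasDerivAt_gWarp h1 (interior_subset (s := Set.Ici (0:ℝ)) ht)).hasDerivWithinAt)
    (fun t ht => by linarith [one_le_gWarp' h1 (interior_subset (s := Set.Ici (0:ℝ)) ht)])

theorem gWarp_pos (h1 : 1 < δ) {s : ℝ} (hs : 0 < s) : 0 < gWarp δ s :=
  gWarp_zero h1 ▸ gWarp_strictMonoOn h1 Set.self_mem_Ici hs.le hs

theorem le_gWarp (h1 : 1 < δ) {s : ℝ} (hs : 0 ≤ s) : s ≤ gWarp δ s := by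
  have h : MonotoneOn (fun t => gWarp δ t - t) (Set.Ici 0) :=
    monotoneOn_of_hasDerivWithinAt_nonneg (convex_Ici 0)
    (fun t ht => ((hasDerivAt_gWarp h1 ht).sub (hasDerivAt_id t)).continuousAt.continuousWithinAt)
    (fun t ht => ((hasDerivAt_gWarp h1 (interior_subset (s := Set.Ici (0:ℝ)) ht)).sub
      (hasDerivAt_id t)).hasDerivWithinAt)
    (fun t ht => by linarith [one_le_gWarp' h1 (interior_subset (s := Set.Ici (0:ℝ)) ht)])
  have := h Set.self_mem_Ici hs hs
  simp only [gWarp_zero h1] at this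
  linarith

/-- This lets the coefficient `1/g'` be written in terms of `x = log g` alone. -/
theorem gRecip_gWarp (h1 : 1 < δ) {s : ℝ} (hs : 0 ≤ s) : gRecip δ (gWarp δ s) = (gWarp' δ s)⁻¹ := by
  have hb : 0 < s + δ ^ (-1 / (δ - 1)) :=
    add_pos_of_nonneg_of_pos hs (Real.rpow_pos_of_pos (by linarith) _)
  have : δ ≠ 0 := by linarith
  rw [gRecip, gWarp, gWarp', sub_add_cancel, ← Real.rpow_mul hb.le, mul_div_cancel₀ _ this]

theorem gRecip_zero (h1 : 1 < δ) : gRecip δ 0 = 1 := by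
  rw [← gWarp_zero h1, gRecip_gWarp h1 le_rfl, gWarp'_zero h1, inv_one]

theorem gRecip_pos (h1 : 1 < δ) {u : ℝ} (hu : 0 ≤ u) : 0 < gRecip δ u := by
  have := Real.rpow_pos_of_pos (show 0 < δ by linarith) (-δ / (δ - 1))
  exact inv_pos.2 (mul_pos (by linarith) (Real.rpow_pos_of_pos (by linarith) _))

theorem gRecip_anti (h1 : 1 < δ) {u v : ℝ} (hu : 0 ≤ u) (huv : u ≤ v) :
    gRecip δ v ≤ gRecip δ u := by
  have := Real.rpow_pos_of_pos (show 0 < δ by linarith) (-δ / (δ - 1))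
  refine inv_anti₀ (mul_pos (by linarith) (Real.rpow_pos_of_pos (by linarith) _)) ?_
  refine mul_le_mul_of_nonneg_left (Real.rpow_le_rpow (by linarith) (by linarith) ?_) (by linarith)
  exact div_nonneg (by linarith) (by linarith)

theorem differentiableAt_gRecip (h1 : 1 < δ) {u : ℝ} (hu : 0 ≤ u) :
    DifferentiableAt ℝ (gRecip δ) u := by
  have := Real.rpow_pos_of_pos (show 0 < δ by linarith) (-δ / (δ - 1))
  have h2 : 0 < u + δ ^ (-δ / (δ - 1)) := by linarith
  refine DifferentiableAt.inv ?_ (mul_pos (by linarith) (Real.rpow_pos_of_pos h2 _)).ne'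
  exact ((differentiableAt_id.add_const _).rpow_const (Or.inl h2.ne')).const_mul _

/-- Dropping the positive shift and the factor `δ > 1` leaves a pure power of `g = e^x`. The rate
`(δ-1)/δ` is the one compared with `m`. -/
theorem gRecip_exp_le (h1 : 1 < δ) (x : ℝ) :
    gRecip δ (Real.exp x) ≤ Real.exp (-((δ - 1) / δ * x)) := by
  have hb := Real.rpow_pos_of_pos (show 0 < δ by linarith) (-δ / (δ - 1))
  rw [Real.exp_neg, gRecip]
  refine inv_anti₀ (Real.exp_pos _) ?_
  have h2 : Real.exp ((δ - 1) / δ * x) = Real.exp x ^ ((δ - 1) / δ) := by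
    rw [← Real.exp_mul, mul_comm]
  have h3 : Real.exp x ^ ((δ - 1) / δ) ≤ (Real.exp x + δ ^ (-δ / (δ - 1))) ^ ((δ - 1) / δ) :=
    Real.rpow_le_rpow (Real.exp_pos x).le (by linarith) (div_nonneg (by linarith) (by linarith))
  rw [h2]
  have h4 := Real.rpow_nonneg (Real.exp_pos x).le ((δ - 1) / δ)
  nlinarith

theorem continuous_gRecip_exp (h1 : 1 < δ) : Continuous fun x => gRecip δ (Real.exp x) :=
  continuous_iff_continuousAt.2 fun x => ContinuousAt.comp (g := gRecip δ)
    (differentiableAt_gRecip h1 (Real.exp_pos x).le).continuousAt Real.continuous_exp.continuousAt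

theorem integral_gRecip_exp_le (h1 : 1 < δ) {x : ℝ} (hx : 0 ≤ x) :
    ∫ t in (0 : ℝ)..x, gRecip δ (Real.exp t) ≤ δ / (δ - 1) := by
  have hk : 0 < (δ - 1) / δ := div_pos (by linarith) (by linarith)
  have h2 : ∫ t in (0 : ℝ)..x, gRecip δ (Real.exp t)
      ≤ ∫ t in (0 : ℝ)..x, Real.exp (-((δ - 1) / δ * t)) :=
    intervalIntegral.integral_mono_on hx ((continuous_gRecip_exp h1).intervalIntegrable _ _)
      (Continuous.intervalIntegrable (by fun_prop) _ _) fun t _ => gRecip_exp_le h1 t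
  have h3 : ∫ t in (0 : ℝ)..x, Real.exp (-((δ - 1) / δ * t))
      = -((δ - 1) / δ)⁻¹ * Real.exp (-((δ - 1) / δ * x)) -
        -((δ - 1) / δ)⁻¹ * Real.exp (-((δ - 1) / δ * 0)) := by
    refine intervalIntegral.integral_eq_sub_of_hasDerivAt
      (f := fun t => -((δ - 1) / δ)⁻¹ * Real.exp (-((δ - 1) / δ * t))) (fun t _ => ?_)
      (Continuous.intervalIntegrable (by fun_prop) _ _)
    refine ((((hasDerivAt_id t).const_mul ((δ - 1) / δ)).neg.exp).const_mul _).congr_deriv ?_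
    have : δ - 1 ≠ 0 := by linarith
    simp only [id, Pi.neg_apply]
    field_simp
  rw [h3, mul_zero, neg_zero, Real.exp_zero, inv_div] at h2
  have h4 : 0 ≤ δ / (δ - 1) * Real.exp (-((δ - 1) / δ * x)) :=
    mul_nonneg (div_nonneg (by linarith) (by linarith)) (Real.exp_pos _).le
  linarith

end GWarp

/-! ### Convergence to the equilibrium at the pole. -/

section Equilibrium

variable {q C P s : ℝ → ℝ} {p m Pmax P0 : ℝ}

theorem isBigO_exp_iff {D : ℝ → ℝ} {c : ℝ} :
    D =O[atBot] (fun x => Real.exp (c * x)) ↔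
      ∃ K X, 0 ≤ K ∧ ∀ x ≤ X, |D x| ≤ K * Real.exp (c * x) := by
  constructor
  · intro h
    obtain ⟨K, hK0, hK⟩ := h.exists_nonneg
    obtain ⟨X, hX⟩ := eventually_atBot.1 hK.bound
    refine ⟨K, X, hK0, fun x hx => ?_⟩
    have := hX x hx
    rwa [Real.norm_eq_abs, Real.norm_eq_abs, abs_of_pos (Real.exp_pos _)] at this
  · rintro ⟨K, X, hK0, hK⟩
    refine IsBigO.of_bound K ?_
    filter_upwards [eventually_le_atBot X] with x hx
    rw [Real.norm_eq_abs, Real.norm_eq_abs, abs_of_pos (Real.exp_pos _)]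
    exact hK x hx

/-- Exponential convergence of the profile to the equilibrium at `-∞`. -/
theorem profile_sub_isBigO (hp : 0 < p) (hm : 0 < m) (hqm : Monotone q) (hq00 : q 0 = 0)
    (hC : ∀ P, HasDerivAt C (-p * q P) P) (hP : ∀ x, HasDerivAt P (-m * P x + s x * C (P x)) x)
    (hPb : ∀ x, 0 ≤ P x ∧ P x ≤ Pmax) (hs : ∀ x, 0 ≤ s x ∧ s x ≤ 1) (hP0 : 0 ≤ P0)
    (hP1 : P0 ≤ Pmax) (hCP0 : C P0 = m * P0) {c : ℝ} (hc : 0 < c)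
    (hsc : (fun x => s x - 1) =O[atBot] fun x => Real.exp (c * x)) :
    (fun x => P x - P0) =O[atBot] fun x => Real.exp (c * x) := by
  obtain ⟨K, X, hK0, hK⟩ := isBigO_exp_iff.1 hsc
  have hQ : 0 ≤ q Pmax := hq00 ▸ hqm (hP0.trans hP1)
  have hk : 0 ≤ p * q Pmax := by positivity
  refine isBigO_exp_iff.2 ⟨K * (m * P0) / m, X, by positivity, fun x hx => ?_⟩
  -- The bound is applied on `(-∞, x]` with `x` itself as endpoint, where the forcing is at most its
  -- value `K e^(c x) m P0` at `x`.
  have h := abs_le_of_abs_deriv_add_mul_le_mul (D := fun x => P x - P0) (X := x) (M := Pmax)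
    (l := m + p * q Pmax) (k := p * q Pmax) (ε := K * Real.exp (c * x) * (m * P0)) hk
    (by linarith) (fun z _ => (hP z).sub_const P0)
    (fun z _ => abs_le.2 ⟨by linarith [(hPb z).1], by linarith [(hPb z).2]⟩) (fun z hz => ?_) x
    le_rfl
  · refine h.trans (le_of_eq ?_)
    rw [add_sub_cancel_right]; ring
  · have h1 := abs_source_sub_le hp hqm hq00 hC (s z) (hs z).1 (hs z).2 (P z) (hPb z) P0 ⟨hP0, hP1⟩
    have h2 : -m * P z + s z * C (P z) + (m + p * q Pmax) * (P z - P0)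
        = (s z * C (P z) + p * q Pmax * P z - (s z * C P0 + p * q Pmax * P0))
          + (s z - 1) * (m * P0) := by rw [hCP0]; ring
    rw [h2]
    refine (abs_add_le _ _).trans (add_le_add h1 ?_)
    rw [abs_mul, abs_of_nonneg (show 0 ≤ m * P0 by positivity)]
    refine mul_le_mul_of_nonneg_right ?_ (by positivity)
    refine (hK z (hz.trans hx)).trans ?_
    gcongr

/-- First order expansion of the profile at `-∞`. -/
theorem tendsto_profile_sub_mul_exp (hp : 0 < p) (hm : 0 < m) (hqm : Monotone q) (hq00 : q 0 = 0)
    (hC : ∀ P, HasDerivAt C (-p * q P) P) (hP : ∀ x, HasDerivAt P (-m * P x + s x * C (P x)) x)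
    (hPb : ∀ x, 0 ≤ P x ∧ P x ≤ Pmax) (hs : ∀ x, 0 ≤ s x ∧ s x ≤ 1) (hP0 : 0 ≤ P0)
    (hP1 : P0 ≤ Pmax) (hCP0 : C P0 = m * P0) {ρ : ℝ}
    (hsc : Tendsto (fun x => (s x - 1) * Real.exp (-x)) atBot (𝓝 ρ)) :
    ∃ κ, Tendsto (fun x => (P x - P0) * Real.exp (-x)) atBot (𝓝 κ) := by
  have hexp1 : ∀ x, Real.exp (-x) * Real.exp x = 1 := fun x => by
    rw [← Real.exp_add, neg_add_cancel, Real.exp_zero]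
  have hsO : (fun x => s x - 1) =O[atBot] fun x => Real.exp (1 * x) := by
    have := (hsc.isBigO_one ℝ).mul (isBigO_refl Real.exp atBot)
    refine this.congr (fun x => ?_) fun x => by rw [one_mul, one_mul]
    rw [mul_assoc, hexp1, mul_one]
  have hDO := profile_sub_isBigO hp hm hqm hq00 hC hP hPb hs hP0 hP1 hCP0 one_pos hsO
  have hexp0 : Tendsto (fun x : ℝ => Real.exp (1 * x)) atBot (𝓝 0) := by
    simpa using Real.tendsto_exp_atBot
  have hD0 : Tendsto (fun x => P x - P0) atBot (𝓝 0) := hDO.trans_tendsto hexp0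
  have hs1 : Tendsto (fun x => 1 - s x) atBot (𝓝 0) := by
    simpa using (hsO.trans_tendsto hexp0).neg
  have hPlim : Tendsto P atBot (𝓝 P0) := by simpa using hD0.add_const P0
  set q0 := q P0 with hq0
  have hq0' : 0 ≤ q0 := hq00 ▸ hqm hP0
  have hμ : 0 < m + p * q0 + 1 := by positivity
  obtain ⟨K, X, hK0, hK⟩ := isBigO_exp_iff.1 hDO
  have hKb : ∀ x ≤ X, |(P x - P0) * Real.exp (-x)| ≤ K := fun x hx => by
    rw [abs_mul, abs_of_pos (Real.exp_pos _)]
    have := mul_le_mul_of_nonneg_right (hK x hx) (Real.exp_pos (-x)).le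
    rwa [one_mul, mul_assoc, mul_comm (Real.exp x), hexp1, mul_one] at this
  have hsmall : Tendsto (fun x => (C (P x) - C P0 + p * q0 * (P x - P0)) * Real.exp (-x)) atBot
      (𝓝 0) := by
    have h1 := ((hasDerivAt_iff_isLittleO.1 (hC P0)).comp_tendsto hPlim).trans_isBigO hDO
    have h2 := h1.tendsto_div_nhds_zero
    refine h2.congr fun x => ?_
    simp only [Function.comp, smul_eq_mul, one_mul, Real.exp_neg, div_eq_mul_inv]
    ring
  have hD2 : Tendsto (fun x => (1 - s x) * ((P x - P0) * Real.exp (-x))) atBot (𝓝 0) :=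
    hs1.zero_mul_isBoundedUnder_le (isBoundedUnder_of_eventually_le (a := K)
      ((eventually_le_atBot X).mono fun x hx => hKb x hx))
  refine ⟨ρ * (m * P0) / (m + p * q0 + 1), ?_⟩
  -- `E = (P - P0) e^(-x)` satisfies `E' + (m + p q0 + 1) E → ρ m P0`: linearizing `C` at `P0` gives
  -- `p q0`, the factor `e^(-x)` gives the `1`.
  set κ := ρ * (m * P0) / (m + p * q0 + 1) with hκ
  have hκ' : (m + p * q0 + 1) * κ = ρ * (m * P0) := by rw [hκ]; field_simp
  have hE : ∀ x, HasDerivAt (fun x => (P x - P0) * Real.exp (-x) - κ)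
      ((-m * P x + s x * C (P x)) * Real.exp (-x) - (P x - P0) * Real.exp (-x)) x := by
    intro x
    refine ((((hP x).sub_const P0).mul (hasDerivAt_neg x).exp).sub_const κ).congr_deriv ?_
    ring
  have hlim : Tendsto (fun x => (-m * P x + s x * C (P x)) * Real.exp (-x)
      - (P x - P0) * Real.exp (-x)
      + (m + p * q0 + 1) * ((P x - P0) * Real.exp (-x) - κ)) atBot (𝓝 0) := by
    have hsl : Tendsto s atBot (𝓝 1) := by simpa using hs1.const_sub 1
    have h1 := ((hsl.mul hsmall).add (hD2.const_mul (p * q0))).add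
      ((hsc.mul_const (m * P0)).sub_const (ρ * (m * P0)))
    simp only [mul_zero, sub_self, add_zero] at h1
    refine h1.congr fun x => ?_
    rw [mul_sub (m + p * q0 + 1), hκ', hCP0]
    ring
  have := tendsto_zero_of_deriv_add_mul (X := X) (M := K + |κ|) hμ (fun x _ => hE x)
    (fun x hx => (abs_sub _ _).trans (by linarith [hKb x hx])) hlim
  simpa using this.add_const κ

end Equilibrium

/-! ### Expansion of the target warping function at its pole. -/

section JWarpExpansion

variable {σ : ℝ}

theorem abs_jWarp'_sub_one_le (h0 : 0 < σ) (h1 : σ < 1) {t : ℝ} (ht : 0 ≤ t) :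
    |jWarp' σ t - 1| ≤ |jWarp'' σ 0| * t := by
  have := Convex.norm_image_sub_le_of_norm_hasDerivWithin_le (s := Set.Ici (0 : ℝ))
    (C := |jWarp'' σ 0|) (fun x hx => (hasDerivAt_jWarp' h0 hx).hasDerivWithinAt)
    (fun x hx => abs_jWarp''_le h0 h1 hx) (convex_Ici 0) (Set.self_mem_Ici) ht
  rwa [jWarp'_zero h0 h1, sub_zero, Real.norm_of_nonneg ht] at this

theorem abs_jWarp_div_sub_one_le (h0 : 0 < σ) (h1 : σ < 1) {t : ℝ} (ht : 0 < t) :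
    |jWarp σ t / t - 1| ≤ |jWarp'' σ 0| * t := by
  have := Convex.norm_image_sub_le_of_norm_hasDerivWithin_le (s := Set.Icc (0 : ℝ) t)
    (f := fun x => jWarp σ x - x)
    (C := |jWarp'' σ 0| * t)
    (fun x hx => ((hasDerivAt_jWarp h0 hx.1).sub (hasDerivAt_id x)).hasDerivWithinAt)
    (fun x hx => (abs_jWarp'_sub_one_le h0 h1 hx.1).trans (by gcongr; exact hx.2))
    (convex_Icc 0 t) (Set.left_mem_Icc.2 ht.le) (Set.right_mem_Icc.2 ht.le)
  simp only [jWarp_zero h0, sub_zero, Real.norm_of_nonneg ht.le] at this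
  rw [show jWarp σ t / t - 1 = (jWarp σ t - t) / t by field_simp, abs_div, abs_of_pos ht,
    div_le_iff₀ ht]
  exact this

end JWarpExpansion

/-! ### The solution in the variable `x = log g` and its asymptotics at both ends. -/

section PhaseSolution

/-- A first-order Taylor expansion, rescaled by `r`; it is used with `r = e^(-x)` and with `r =
1/g`. -/
theorem tendsto_sub_mul_of_hasDerivAt {ι : Type*} {l : Filter ι} {A : ℝ → ℝ} {u r : ι → ℝ}
    {A' u0 κ : ℝ} (hA : HasDerivAt A A' u0) (hul : Tendsto u l (𝓝 u0))
    (hu : Tendsto (fun x => (u x - u0) * r x) l (𝓝 κ)) :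
    Tendsto (fun x => (A (u x) - A u0) * r x) l (𝓝 (A' * κ)) := by
  have h1 := ((hasDerivAt_iff_isLittleO.1 hA).comp_tendsto hul).mul_isBigO (isBigO_refl r l)
  have h2 := ((isLittleO_one_iff ℝ).1 (h1.trans_isBigO (hu.isBigO_one ℝ))).add (hu.const_mul A')
  rw [zero_add] at h2
  refine h2.congr fun x => ?_
  simp only [Function.comp, smul_eq_mul]
  ring

theorem exp_neg_mul_exp (x : ℝ) : Real.exp (-x) * Real.exp x = 1 := by
  rw [← Real.exp_add, neg_add_cancel, Real.exp_zero]

theorem tendsto_of_tendsto_sub_mul_exp {u : ℝ → ℝ} {u0 κ : ℝ}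
    (hu : Tendsto (fun x => (u x - u0) * Real.exp (-x)) atBot (𝓝 κ)) :
    Tendsto u atBot (𝓝 u0) := by
  have := (hu.mul Real.tendsto_exp_atBot).add_const u0
  rw [mul_zero, zero_add] at this
  refine this.congr fun x => ?_
  rw [mul_assoc, exp_neg_mul_exp]
  ring

/-- The `p`-harmonic map equation in the variables `x = log g`, `φ = f`, `z = f' g / j(f)`:
a global solution with its behaviour at the pole (`x → -∞`) and at infinity (`x → ∞`). -/
theorem exists_phase_solution {ν p δ σ m : ℝ} (hν : 1 ≤ ν) (hp : 2 < p) (hm : m = ν + 1 - p)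
    (hm0 : 0 < m) (hδ : 1 < δ) (hmδ : m < (δ - 1) / δ) (hσ0 : 0 < σ) (hσ1 : σ < 1) :
    ∃ φ z : ℝ → ℝ, (∀ x, 0 < φ x) ∧ (∀ x, 0 < z x) ∧ (∃ B, ∀ x, φ x ≤ B) ∧
      (∀ x, HasDerivAt φ (jWarp σ (φ x) * (gRecip δ (Real.exp x) * z x)) x) ∧
      (∀ x, HasDerivAt z ((gRecip δ (Real.exp x) * jWarp' σ (φ x) * sourceFun ν p (z x)
        - m * fluxFun ν p (z x)) / fluxFunDeriv ν p (z x)) x) ∧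
      (∃ α, Tendsto (fun x => φ x * Real.exp (-x)) atBot (𝓝 α)) ∧
      (∃ κ, Tendsto (fun x => (z x - 1) * Real.exp (-x)) atBot (𝓝 κ)) ∧
      Tendsto z atTop (𝓝 0) ∧ Tendsto (fun x => gRecip δ (Real.exp x) / z x) atTop (𝓝 0) := by
  obtain ⟨q, hq1, hq2, hq3⟩ := exists_inverse_of_one_le_deriv
    (fun z => hasDerivAt_fluxFun (p := p) hν z) (one_le_fluxFunDeriv hν hp)
  obtain ⟨e, he0, he1, he2⟩ := exists_flow_jWarp hσ0 hσ1
  have hF' : ∀ z, 0 < fluxFunDeriv ν p z := fun z => by linarith [one_le_fluxFunDeriv hν hp z]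
  have hFm : StrictMono (fluxFun ν p) :=
    strictMono_of_hasDerivAt_pos (fun z => hasDerivAt_fluxFun hν z) hF'
  set C : ℝ → ℝ := fun P => sourceFun ν p (q P) with hCdef
  have hC : ∀ P, HasDerivAt C (-p * q P) P := by
    intro P
    have hcomp : HasDerivAt (fun P => sourceFun ν p (q P)) _ P :=
      (hasDerivAt_sourceFun (p := p) hν (q P)).comp P (hq3 P)
    refine hcomp.congr_deriv ?_
    have := (hF' (q P)).ne'
    field_simp
  set a : ℝ → ℝ := fun x => gRecip δ (Real.exp x) with ha
  have ha0 : ∀ x, 0 < a x := fun x => gRecip_pos hδ (Real.exp_pos x).le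
  have ha1 : ∀ x, a x ≤ 1 := fun x => gRecip_zero hδ ▸ gRecip_anti hδ le_rfl (Real.exp_pos x).le
  have haa : Antitone a := fun x y hxy => gRecip_anti hδ (Real.exp_pos x).le (Real.exp_le_exp.2 hxy)
  have hF0 : fluxFun ν p 0 = 0 := by simp [fluxFun]
  have hq00 : q 0 = 0 := by have := hq2 0; rwa [hF0] at this
  have hqpos : ∀ P, 0 < (fluxFunDeriv ν p (q P))⁻¹ := fun P => inv_pos.2 (hF' _)
  have hqm : StrictMono q := strictMono_of_hasDerivAt_pos hq3 hqpos
  have hC0 : 0 < C 0 := by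
    simp only [hCdef, hq00, sourceFun]
    have := Real.rpow_pos_of_pos (show (0 : ℝ) < 0 ^ 2 + ν by positivity) ((p - 2) / 2)
    refine mul_pos this ?_
    linarith
  -- `Q` is the positive zero of the source; `Q ≥ 1` because `m > 0` means `ν > p - 1`, so the
  -- equilibrium slope `1` lies in `(0, Q]`.
  set Q := Real.sqrt (ν / (p - 1)) with hQ
  have hp1 : 0 < p - 1 := by linarith
  have hQ2 : Q ^ 2 = ν / (p - 1) := Real.sq_sqrt (by positivity)
  have hQ1 : 1 ≤ Q := by
    rw [hQ, Real.one_le_sqrt, one_le_div hp1]; linarith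
  set Pmax := fluxFun ν p Q with hPmaxdef
  have hP0pos : 0 < fluxFun ν p 1 := hF0 ▸ hFm one_pos
  have hP0le : fluxFun ν p 1 ≤ Pmax := hFm.monotone hQ1
  have hPmax : 0 < Pmax := hP0pos.trans_le hP0le
  have hC1 : C Pmax = 0 := by
    simp only [hCdef, hPmaxdef, hq2, sourceFun, hQ2]
    field_simp
    simp
  have hCP0 : C (fluxFun ν p 1) = m * fluxFun ν p 1 := by
    simp only [hCdef, hq2]
    simp only [sourceFun, fluxFun, hm]
    ring
  have hjc0 : 0 < jWarp σ 1 := jWarp_pos hσ0 one_pos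
  have hem : Monotone e := monotone_of_hasDerivAt_nonneg he1 fun y => (jWarp_pos hσ0 (he0 y)).le
  have hJ : ∀ y, HasDerivAt (fun y => jWarp' σ (e y)) (jWarp'' σ (e y) * jWarp σ (e y)) y :=
    fun y => (hasDerivAt_jWarp' hσ0 (he0 y).le).comp y (he1 y)
  set K := |jWarp'' σ 0| with hK
  obtain ⟨P, y, Pmin, hP, hy, hPb, hPmin, hPmin', hy0⟩ := exists_profile (q := q)
    (C := C) (a := a) (J := fun y => jWarp' σ (e y)) (K := K) (c := jWarp σ 1) (I := δ / (δ - 1))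
    (by linarith) hm0 hq3 hqpos (fun P => inv_le_one_of_one_le₀ (one_le_fluxFunDeriv hν hp _)) hq00
    hC hC0 hPmax hC1 (continuous_gRecip_exp hδ) ha0 ha1 haa
    (fun x hx => integral_gRecip_exp_le hδ hx) hJ (fun y => jWarp'_pos hσ0 (he0 y).le)
    (fun y => jWarp'_le_one hσ0 hσ1 (he0 y).le)
    (fun y z hyz => jWarp'_anti hσ0 hσ1 (he0 y).le (hem hyz)) hjc0
    (fun y hy => by
      rw [abs_mul, abs_of_pos (jWarp_pos hσ0 (he0 y))]
      exact mul_le_mul (abs_jWarp''_le hσ0 hσ1 (he0 y).le)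
        ((jWarp_le hσ0 hσ1 (he0 y).le).trans (he2 y hy)) (jWarp_pos hσ0 (he0 y)).le (abs_nonneg _))
  set φ : ℝ → ℝ := fun x => e (y x) with hφdef
  set z : ℝ → ℝ := fun x => q (P x) with hzdef
  have hφ0 : ∀ x, 0 < φ x := fun x => he0 _
  have hφ : ∀ x, HasDerivAt φ (jWarp σ (φ x) * (a x * z x)) x := fun x => (he1 (y x)).comp x (hy x)
  set s : ℝ → ℝ := fun x => a x * jWarp' σ (φ x) with hsdef
  have hs : ∀ x, 0 ≤ s x ∧ s x ≤ 1 := fun x =>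
    ⟨(mul_pos (ha0 x) (jWarp'_pos hσ0 (hφ0 x).le)).le, by
      simpa using mul_le_mul (ha1 x) (jWarp'_le_one hσ0 hσ1 (hφ0 x).le)
        (jWarp'_pos hσ0 (hφ0 x).le).le zero_le_one⟩
  have hCnn : ∀ x, 0 ≤ C (P x) := by
    intro x
    have hz1 : z x ≤ Q := by
      have := hqm.monotone (hPb x).2
      rwa [hPmaxdef, hq2] at this
    have hz0 : 0 ≤ z x := hq00 ▸ hqm.monotone (hPb x).1
    have h1 : z x ^ 2 ≤ ν / (p - 1) := hQ2 ▸ pow_le_pow_left₀ hz0 hz1 2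
    rw [le_div_iff₀ hp1] at h1
    exact mul_nonneg (Real.rpow_nonneg (by positivity) _) (by simp only [hzdef] at h1; linarith)
  have hClem : ∀ x, C (P x) ≤ C 0 := by
    have hanti : AntitoneOn C (Set.Ici 0) := antitoneOn_of_hasDerivWithinAt_nonpos (convex_Ici 0)
      (fun z _ => (hC z).continuousAt.continuousWithinAt)
      (fun z _ => (hC z).hasDerivWithinAt) fun z hz => by
        have h1 : 0 ≤ q z := hq00 ▸ hqm.monotone (interior_subset (s := Set.Ici (0 : ℝ)) hz)
        nlinarith
    exact fun x => hanti Set.self_mem_Ici (hPb x).1 (hPb x).1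
  -- the product `P e^{mx}` is nondecreasing
  have hPe : ∀ x, HasDerivAt (fun x => P x * Real.exp (m * x))
      (s x * C (P x) * Real.exp (m * x)) x := by
    intro x
    refine ((hP x).mul ((hasDerivAt_id x).const_mul m).exp).congr_deriv ?_
    simp only [id, hsdef, hφdef]
    ring
  have hPe_mono : Monotone fun x => P x * Real.exp (m * x) :=
    monotone_of_hasDerivAt_nonneg hPe fun x =>
      mul_nonneg (mul_nonneg (hs x).1 (hCnn x)) (Real.exp_pos _).le
  have hP00 : 0 < P 0 := hPmin.trans_le (hPmin' 0 le_rfl)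
  have hPlow : ∀ x, 0 ≤ x → P 0 * Real.exp (-(m * x)) ≤ P x := by
    intro x hx
    have := hPe_mono hx
    simp only [mul_zero, Real.exp_zero, mul_one] at this
    rw [Real.exp_neg, ← div_eq_mul_inv, div_le_iff₀ (Real.exp_pos _)]
    exact this
  have hPpos : ∀ x, 0 < P x := by
    intro x
    rcases le_total 0 x with hx | hx
    · exact (mul_pos hP00 (Real.exp_pos _)).trans_le (hPlow x hx)
    · exact hPmin.trans_le (hPmin' x hx)
  have hz0 : ∀ x, 0 < z x := fun x => hq00 ▸ hqm (hPpos x)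
  have hzP : ∀ x, fluxFun ν p (z x) = P x := fun x => hq1 _
  refine ⟨φ, z, hφ0, hz0, ⟨e 0, fun x => hem (hy0 x)⟩, hφ, fun x => ?_, ?_⟩
  · have hcomp : HasDerivAt z _ x := (hq3 (P x)).comp x (hP x)
    refine hcomp.congr_deriv ?_
    rw [hzP]
    simp only [hzdef, hCdef, hφdef]
    rw [div_eq_inv_mul]
    ring
  -- behaviour at the pole
  have hzQ : ∀ x, z x ≤ Q := fun x => by
    have := hqm.monotone (hPb x).2
    rwa [hPmaxdef, hq2] at this
  -- A crude rate `c` is enough to start: it is improved below to the exact rate `1`. Taking `c ≤ 1`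
  -- lets `e^x` be absorbed in `e^(c x)`.
  have hφO : ∃ c, 0 < c ∧ c ≤ 1 ∧ φ =O[atBot] fun x => Real.exp (c * x) := by
    have hqmin : 0 < q Pmin := hq00 ▸ hqm hPmin
    have hb : 0 < a 0 * q Pmin := mul_pos (ha0 0) hqmin
    refine ⟨min 1 (jWarp σ 1 * (a 0 * q Pmin)), lt_min one_pos (mul_pos hjc0 hb), min_le_left _ _,
      isBigO_exp_iff.2 ⟨1, 0, zero_le_one, fun x hx => ?_⟩⟩
    have hmono : MonotoneOn (fun x => y x - a 0 * q Pmin * x) (Set.Iic 0) := by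
      refine monotoneOn_of_hasDerivWithinAt_nonneg (convex_Iic 0)
        (fun t _ => ((hy t).sub ((hasDerivAt_id t).const_mul _)).continuousAt.continuousWithinAt)
        (fun t _ => ((hy t).sub ((hasDerivAt_id t).const_mul _)).hasDerivWithinAt) fun t ht => ?_
      have ht : t ≤ 0 := interior_subset (s := Set.Iic (0:ℝ)) ht
      rw [mul_one, sub_nonneg]
      exact mul_le_mul (haa ht) (hqm.monotone (hPmin' t ht)) hqmin.le (ha0 t).le
    have h1 := hmono hx (Set.mem_Iic.2 le_rfl) hx
    simp only [mul_zero, sub_zero] at h1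
    have h2 : y x ≤ a 0 * q Pmin * x := by linarith [hy0 0]
    rw [abs_of_pos (hφ0 x), one_mul]
    refine (he2 (y x) (hy0 x)).trans (Real.exp_le_exp.2 ?_)
    calc _ ≤ jWarp σ 1 * (a 0 * q Pmin * x) := mul_le_mul_of_nonneg_left h2 hjc0.le
      _ = jWarp σ 1 * (a 0 * q Pmin) * x := by ring
      _ ≤ _ := mul_le_mul_of_nonpos_right (min_le_right _ _) hx
  have haO : Tendsto (fun x => (a x - 1) * Real.exp (-x)) atBot (𝓝 (deriv (gRecip δ) 0)) := by
    have := tendsto_sub_mul_of_hasDerivAt (r := fun x => Real.exp (-x)) (κ := 1)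
      (differentiableAt_gRecip hδ le_rfl).hasDerivAt Real.tendsto_exp_atBot
      (tendsto_const_nhds.congr fun x => by rw [sub_zero, mul_comm, exp_neg_mul_exp])
    rwa [gRecip_zero hδ, mul_one] at this
  have hα : ∃ α, Tendsto (fun x => φ x * Real.exp (-x)) atBot (𝓝 α) := by
    obtain ⟨c, hc0, hc1, hφO⟩ := hφO
    have haO' : (fun x => a x - 1) =O[atBot] fun x => Real.exp (c * x) := by
      have h1 := (haO.isBigO_one ℝ).mul (isBigO_refl Real.exp atBot)
      have h2 : (fun x => a x - 1) =O[atBot] Real.exp := by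
        refine h1.congr (fun x => ?_) fun x => by rw [one_mul]
        rw [mul_assoc, exp_neg_mul_exp, mul_one]
      refine h2.trans (isBigO_exp_iff.2 ⟨1, 0, zero_le_one, fun x hx => ?_⟩)
      rw [abs_of_pos (Real.exp_pos _), one_mul]
      exact Real.exp_le_exp.2 (by nlinarith)
    have ha1O : a =O[atBot] fun _ => (1 : ℝ) := IsBigO.of_bound 1 (Eventually.of_forall fun x => by
      rw [Real.norm_of_nonneg (ha0 x).le, norm_one, mul_one]; exact ha1 x)
    have hz1O : z =O[atBot] fun _ => (1 : ℝ) := IsBigO.of_bound Q (Eventually.of_forall fun x => by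
      rw [Real.norm_of_nonneg (hz0 x).le, norm_one, mul_one]; exact hzQ x)
    have hj1 : (fun x => jWarp' σ (φ x) - 1) =O[atBot] fun x => Real.exp (c * x) :=
      (IsBigO.of_bound K (Eventually.of_forall fun x => by
        rw [Real.norm_of_nonneg (hφ0 x).le]
        exact abs_jWarp'_sub_one_le hσ0 hσ1 (hφ0 x).le)).trans hφO
    have hj2 : (fun x => jWarp σ (φ x) / φ x - 1) =O[atBot] fun x => Real.exp (c * x) :=
      (IsBigO.of_bound K (Eventually.of_forall fun x => by
        rw [Real.norm_of_nonneg (hφ0 x).le]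
        exact abs_jWarp_div_sub_one_le hσ0 hσ1 (hφ0 x))).trans hφO
    have hsO : (fun x => s x - 1) =O[atBot] fun x => Real.exp (c * x) := by
      have := (ha1O.mul hj1).add (haO'.congr_right fun x => (one_mul _).symm)
      refine this.congr (fun x => ?_) fun x => one_mul _
      simp only [hsdef]; ring
    have hDO := profile_sub_isBigO (by linarith) hm0 hqm.monotone hq00 hC hP hPb hs hP0pos.le hP0le
      hCP0 hc0 hsO
    have hexp0 : Tendsto (fun x : ℝ => Real.exp (c * x)) atBot (𝓝 0) :=
      Real.tendsto_exp_atBot.comp (tendsto_id.const_mul_atBot hc0)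
    have hPlim : Tendsto P atBot (𝓝 (fluxFun ν p 1)) := by
      simpa using (hDO.trans_tendsto hexp0).add_const (fluxFun ν p 1)
    have hzO : (fun x => z x - 1) =O[atBot] fun x => Real.exp (c * x) := by
      have := ((hq3 (fluxFun ν p 1)).isBigO_sub.comp_tendsto hPlim).trans hDO
      simpa only [Function.comp_def, hq2] using this
    -- The derivative of `log φ - x` is `O(e^(c x))`, hence integrable at `-∞`; the limit of `log φ
    -- - x` is `log α`.
    have hw : ∀ x, HasDerivAt (fun x => Real.log (φ x) - x)
        (jWarp σ (φ x) * (a x * z x) / φ x - 1) x := fun x =>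
      ((hφ x).log (hφ0 x).ne').sub (hasDerivAt_id x)
    have hwO : (fun x => jWarp σ (φ x) * (a x * z x) / φ x - 1) =O[atBot]
        fun x => Real.exp (c * x) := by
      have h1 := (((hj2.mul (ha1O.mul hz1O)).congr_right fun x => by rw [one_mul, mul_one]).add
        ((haO'.mul hz1O).congr_right fun x => by rw [mul_one])).add hzO
      refine h1.congr_left fun x => ?_
      ring
    obtain ⟨K', X, hK', hX⟩ := isBigO_exp_iff.1 hwO
    have hφc : Continuous φ := continuous_iff_continuousAt.2 fun x => (hφ x).continuousAt
    have hjc : Continuous fun x => jWarp σ (φ x) := continuous_iff_continuousAt.2 fun x =>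
      ContinuousAt.comp (g := jWarp σ) (hasDerivAt_jWarp hσ0 (hφ0 x).le).continuousAt
        hφc.continuousAt
    have hac : Continuous a := continuous_gRecip_exp hδ
    have hzc : Continuous z := continuous_iff_continuousAt.2 fun x =>
      ContinuousAt.comp (g := q) (hq3 (P x)).continuousAt (hP x).continuousAt
    have hwc : Continuous fun x => jWarp σ (φ x) * (a x * z x) / φ x - 1 :=
      ((hjc.mul (hac.mul hzc)).div hφc fun x => (hφ0 x).ne').sub continuous_const
    have hint : MeasureTheory.IntegrableOn (fun x => jWarp σ (φ x) * (a x * z x) / φ x - 1)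
        (Set.Iic X) := by
      refine ((integrableOn_exp_mul_Iic hc0 X).const_mul K').mono'
        hwc.aestronglyMeasurable.restrict ?_
      exact (MeasureTheory.ae_restrict_iff' measurableSet_Iic).2 (Eventually.of_forall hX)
    have hlim := MeasureTheory.tendsto_limUnder_of_hasDerivAt_of_integrableOn_Iic
      (fun x _ => hw x) hint
    refine ⟨_, (((Real.continuous_exp.tendsto _).comp hlim)).congr fun x => ?_⟩
    simp only [Function.comp]
    rw [sub_eq_add_neg, Real.exp_add, Real.exp_log (hφ0 x)]
  obtain ⟨α, hα⟩ := hα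
  refine ⟨⟨α, hα⟩, ?_, ?_⟩
  · have hj : Tendsto (fun x => (jWarp' σ (φ x) - 1) * Real.exp (-x)) atBot
        (𝓝 (jWarp'' σ 0 * α)) := by
      have := tendsto_sub_mul_of_hasDerivAt (u := φ) (r := fun x => Real.exp (-x))
        (hasDerivAt_jWarp' hσ0 le_rfl)
        (tendsto_of_tendsto_sub_mul_exp (by simpa using hα)) (by simpa using hα)
      rwa [jWarp'_zero hσ0 hσ1] at this
    have ha2 : Tendsto a atBot (𝓝 1) := by
      have h2 : Tendsto (gRecip δ) (𝓝 0) (𝓝 (gRecip δ 0)) :=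
        (differentiableAt_gRecip hδ le_rfl).continuousAt
      rw [gRecip_zero hδ] at h2
      exact h2.comp Real.tendsto_exp_atBot
    have hsc : Tendsto (fun x => (s x - 1) * Real.exp (-x)) atBot
        (𝓝 (1 * (jWarp'' σ 0 * α) + deriv (gRecip δ) 0)) := by
      refine ((ha2.mul hj).add haO).congr fun x => ?_
      simp only [hsdef]
      ring
    obtain ⟨κ, hκ⟩ := tendsto_profile_sub_mul_exp (by linarith) hm0 hqm.monotone hq00 hC hP hPb hs
      hP0pos.le hP0le hCP0 hsc
    have := tendsto_sub_mul_of_hasDerivAt (hq3 (fluxFun ν p 1))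
      (tendsto_of_tendsto_sub_mul_exp hκ) hκ
    simp only [hq2] at this
    exact ⟨_, this⟩
  -- behaviour at infinity
  set k := (δ - 1) / δ with hk
  have hkm : 0 < k - m := by linarith
  -- The growth rate of `P e^(m x)` is at most `C(0) e^(-(k-m) x)`, integrable because `m < k`; the
  -- added exponential is the integral of this bound over `[x, ∞)`.
  have hPup : ∀ x, 0 ≤ x → P x ≤ (P 0 + C 0 / (k - m)) * Real.exp (-(m * x)) := by
    intro x hx
    have hder : ∀ t, HasDerivAt (fun t => P t * Real.exp (m * t)
        + C 0 / (k - m) * Real.exp (-((k - m) * t)))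
        (s t * C (P t) * Real.exp (m * t) - C 0 * Real.exp (-((k - m) * t))) t := by
      intro t
      refine ((hPe t).add ((((hasDerivAt_id t).const_mul (k - m)).neg.exp).const_mul
        (C 0 / (k - m)))).congr_deriv ?_
      simp only [id, Pi.neg_apply]
      field_simp
      ring
    have hanti : AntitoneOn (fun t => P t * Real.exp (m * t)
        + C 0 / (k - m) * Real.exp (-((k - m) * t))) (Set.Ici 0) := by
      refine antitoneOn_of_hasDerivWithinAt_nonpos (convex_Ici 0)
        (fun t _ => (hder t).continuousAt.continuousWithinAt)
        (fun t _ => (hder t).hasDerivWithinAt) fun t _ => ?_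
      have h1 : s t ≤ Real.exp (-(k * t)) := by
        have h2 : s t ≤ a t * 1 :=
          mul_le_mul_of_nonneg_left (jWarp'_le_one hσ0 hσ1 (hφ0 t).le) (ha0 t).le
        rw [mul_one] at h2
        exact h2.trans (gRecip_exp_le hδ t)
      have h3 : s t * C (P t) ≤ Real.exp (-(k * t)) * C 0 :=
        mul_le_mul h1 (hClem t) (hCnn t) (Real.exp_pos _).le
      have h4 := mul_le_mul_of_nonneg_right h3 (Real.exp_pos (m * t)).le
      have h5 : Real.exp (-((k - m) * t)) = Real.exp (-(k * t)) * Real.exp (m * t) := by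
        rw [← Real.exp_add]; ring_nf
      rw [h5]
      linarith
    have h6 := hanti Set.self_mem_Ici hx hx
    simp only [mul_zero, neg_zero, Real.exp_zero, mul_one] at h6
    have h7 : 0 ≤ C 0 / (k - m) * Real.exp (-((k - m) * x)) := by positivity
    rw [Real.exp_neg, ← div_eq_mul_inv, le_div_iff₀ (Real.exp_pos _)]
    linarith
  have hdecay : ∀ b, 0 < b → Tendsto (fun x => Real.exp (-(b * x))) atTop (𝓝 0) := fun b hb =>
    Real.tendsto_exp_neg_atTop_nhds_zero.comp (tendsto_id.const_mul_atTop hb)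
  have hpow : ∀ x, 1 ≤ (z x ^ 2 + ν) ^ ((p - 2) / 2) := fun x =>
    Real.one_le_rpow (by nlinarith [sq_nonneg (z x)]) (by linarith)
  refine ⟨?_, ?_⟩
  · have h1 := (hdecay m hm0).const_mul (P 0 + C 0 / (k - m))
    rw [mul_zero] at h1
    refine squeeze_zero' (Eventually.of_forall fun x => (hz0 x).le) ?_ h1
    filter_upwards [eventually_ge_atTop 0] with x hx
    refine le_trans ?_ (hPup x hx)
    rw [← hzP x, fluxFun]
    exact le_mul_of_one_le_right (hz0 x).le (hpow x)
  -- Since `z ≤ Q`, `P ≤ M z`, so the lower bound `P(0) e^(-m x)` for `P` passes to `z` and is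
  -- compared with `a ≤ e^(-k x)`.
  · set M := (Q ^ 2 + ν) ^ ((p - 2) / 2) with hM
    have hM0 : 0 ≤ M := Real.rpow_nonneg (by positivity) _
    have h1 := (hdecay (k - m) hkm).const_mul (M / P 0)
    rw [mul_zero] at h1
    refine squeeze_zero' (Eventually.of_forall fun x => (div_pos (ha0 x) (hz0 x)).le) ?_ h1
    filter_upwards [eventually_ge_atTop 0] with x hx
    have h2 : P x ≤ z x * M := by
      rw [← hzP x, fluxFun]
      refine mul_le_mul_of_nonneg_left ?_ (hz0 x).le
      refine Real.rpow_le_rpow (by positivity) ?_ (by linarith)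
      have := pow_le_pow_left₀ (hz0 x).le (hzQ x) 2
      linarith
    have h3 := (hPlow x hx).trans h2
    have h4 : Real.exp (-((k - m) * x)) * Real.exp (-(m * x)) = Real.exp (-(k * x)) := by
      rw [← Real.exp_add]; ring_nf
    rw [div_le_iff₀ (hz0 x)]
    calc a x ≤ Real.exp (-(k * x)) := gRecip_exp_le hδ x
      _ = Real.exp (-((k - m) * x)) / P 0 * (P 0 * Real.exp (-(m * x))) := by
        rw [← h4]; field_simp
      _ ≤ Real.exp (-((k - m) * x)) / P 0 * (z x * M) := by gcongr
      _ = _ := by ring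

end PhaseSolution

/-- A function which is `C²` on `(0, ∞)` and whose first two derivatives have limits at `0` is
`C²` on `[0, ∞)`. -/
theorem contDiffOn_two_Ici {f f1 f2 : ℝ → ℝ} {c1 c2 : ℝ}
    (hf : ∀ s, 0 < s → HasDerivAt f (f1 s) s) (hf1 : ∀ s, 0 < s → HasDerivAt f1 (f2 s) s)
    (hf2 : ContinuousOn f2 (Set.Ioi 0)) (h0 : Tendsto f (𝓝[>] 0) (𝓝 (f 0)))
    (h1 : Tendsto f1 (𝓝[>] 0) (𝓝 c1)) (h2 : Tendsto f2 (𝓝[>] 0) (𝓝 c2)) :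
    ContDiffOn ℝ 2 f (Set.Ici 0) := by
  -- A one-sided derivative at `0` exists as soon as the derivative has a limit there;
  -- `Function.update` inserts that limit as the value at `0`.
  have key : ∀ {u v : ℝ → ℝ} {c : ℝ}, (∀ s, 0 < s → HasDerivAt u (v s) s) →
      Tendsto u (𝓝[>] 0) (𝓝 (u 0)) → Tendsto v (𝓝[>] 0) (𝓝 c) →
      ∀ s ∈ Set.Ici (0 : ℝ), HasDerivWithinAt u (Function.update v 0 c s) (Set.Ici 0) s := by
    intro u v c hu hu0 hv s hs
    rcases eq_or_lt_of_le (Set.mem_Ici.1 hs) with rfl | hs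
    · rw [Function.update_self]
      refine hasDerivWithinAt_Ici_of_tendsto_deriv (s := Set.Ioi 0)
        (fun t ht => (hu t ht).differentiableAt.differentiableWithinAt) hu0 self_mem_nhdsWithin ?_
      refine hv.congr' ?_
      filter_upwards [self_mem_nhdsWithin] with t ht
      rw [(hu t ht).deriv]
    · rw [Function.update_of_ne hs.ne']
      exact (hu s hs).hasDerivWithinAt
  have hcont : ∀ {v : ℝ → ℝ} {c : ℝ}, ContinuousOn v (Set.Ioi 0) → Tendsto v (𝓝[>] 0) (𝓝 c) →
      ContinuousOn (Function.update v 0 c) (Set.Ici 0) := by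
    intro v c hv hv0
    rw [continuousOn_update_iff]
    have hset : Set.Ici (0 : ℝ) \ {0} = Set.Ioi 0 := Set.Ici_sdiff_left
    rw [hset]
    exact ⟨hv, fun _ => hv0⟩
  have hU := uniqueDiffOn_Ici (0 : ℝ)
  have hd0 := key hf h0 h1
  have hupd : ∀ s, 0 < s → HasDerivAt (Function.update f1 0 c1) (f2 s) s := fun s hs =>
    (hf1 s hs).congr_of_eventuallyEq (by
      filter_upwards [lt_mem_nhds hs] with t ht
      rw [Function.update_of_ne ht.ne'])
  have hd1 := key hupd (by
    rw [Function.update_self]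
    refine h1.congr' ?_
    filter_upwards [self_mem_nhdsWithin] with t ht
    rw [Function.update_of_ne (ne_of_gt ht)]) h2
  rw [show (2 : WithTop ℕ∞) = 1 + 1 from rfl, contDiffOn_succ_iff_derivWithin hU]
  refine ⟨fun s hs => (hd0 s hs).differentiableWithinAt, by simp, ?_⟩
  refine ContDiffOn.congr (f := Function.update f1 0 c1) ?_
    fun s hs => (hd0 s hs).derivWithin (hU s hs)
  rw [contDiffOn_one_iff_derivWithin hU]
  refine ⟨fun s hs => (hd1 s hs).differentiableWithinAt, ?_⟩
  exact (hcont hf2 h2).congr fun s hs => (hd1 s hs).derivWithin (hU s hs)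

/-- The derivative of `f' g / j(f)` for a solution `f` of the `p`-harmonic map equation. -/
def slopeDeriv (ν p δ σ m : ℝ) (f Z : ℝ → ℝ) (s : ℝ) : ℝ :=
  (jWarp' σ (f s) * sourceFun ν p (Z s) - m * gWarp' δ s * fluxFun ν p (Z s))
    / (fluxFunDeriv ν p (Z s) * gWarp δ s)

/-- The `p`-harmonic map equation in the radial variable, as a first order system for the profile
`f` and `Z = f' g / j(f)`. -/
theorem exists_radial_profile {ν p δ σ m : ℝ} (hν : 1 ≤ ν) (hp : 2 < p) (hm : m = ν + 1 - p)
    (hm0 : 0 < m) (hδ : 1 < δ) (hmδ : m < (δ - 1) / δ) (hσ0 : 0 < σ) (hσ1 : σ < 1) :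
    ∃ f Z : ℝ → ℝ, f 0 = 0 ∧ (∀ s, 0 < s → 0 < f s) ∧ (∀ s, 0 < s → 0 < Z s) ∧
      (∃ B, ∀ s, 0 < s → f s ≤ B) ∧
      (∀ s, 0 < s → HasDerivAt f (jWarp σ (f s) / gWarp δ s * Z s) s) ∧
      (∀ s, 0 < s → HasDerivAt Z (slopeDeriv ν p δ σ m f Z s) s) ∧
      (∃ α, Tendsto (fun s => f s * (gWarp δ s)⁻¹) (𝓝[>] 0) (𝓝 α)) ∧
      (∃ κ, Tendsto (fun s => (Z s - 1) * (gWarp δ s)⁻¹) (𝓝[>] 0) (𝓝 κ)) ∧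
      Tendsto Z atTop (𝓝 0) ∧ Tendsto (fun s => (gWarp' δ s)⁻¹ / Z s) atTop (𝓝 0) := by
  obtain ⟨φ, z, hφ0, hz0, ⟨B, hB⟩, hφ, hz, ⟨α, hα⟩, ⟨κ, hκ⟩, hz_top, hza⟩ :=
    exists_phase_solution hν hp hm hm0 hδ hmδ hσ0 hσ1
  have hg0 : ∀ s, 0 < s → 0 < gWarp δ s := fun s hs => gWarp_pos hδ hs
  have hexp : ∀ s, 0 < s → Real.exp (Real.log (gWarp δ s)) = gWarp δ s := fun s hs =>
    Real.exp_log (hg0 s hs)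
  have ha : ∀ s, 0 < s → gRecip δ (Real.exp (Real.log (gWarp δ s))) = (gWarp' δ s)⁻¹ :=
    fun s hs => by rw [hexp s hs, gRecip_gWarp hδ hs.le]
  have hg1 : ∀ s, 0 < s → gWarp' δ s ≠ 0 := fun s hs => by
    linarith [one_le_gWarp' hδ hs.le]
  have hlog : ∀ s, 0 < s → HasDerivAt (fun s => Real.log (gWarp δ s)) (gWarp' δ s / gWarp δ s) s :=
    fun s hs => (hasDerivAt_gWarp hδ hs.le).log (hg0 s hs).ne'
  -- The value at `0` is set by hand: there `Real.log 0 = 0`, and the formula would return `φ 0 >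
  -- 0`.
  obtain ⟨f, hf00, hf⟩ : ∃ f : ℝ → ℝ, f 0 = 0 ∧ ∀ s, 0 < s → f s = φ (Real.log (gWarp δ s)) :=
    ⟨fun s => if 0 < s then φ (Real.log (gWarp δ s)) else 0, by simp, fun s hs => if_pos hs⟩
  have hgtend : Tendsto (fun s => Real.log (gWarp δ s)) (𝓝[>] 0) atBot := by
    refine Real.tendsto_log_nhdsGT_zero.comp (tendsto_nhdsWithin_iff.2 ⟨?_, ?_⟩)
    · have := (hasDerivAt_gWarp hδ le_rfl).continuousAt.tendsto
      rw [gWarp_zero hδ] at this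
      exact this.mono_left nhdsWithin_le_nhds
    · filter_upwards [self_mem_nhdsWithin] with s hs
      exact hg0 s hs
  have hgtop : Tendsto (fun s => Real.log (gWarp δ s)) atTop atTop := by
    refine Real.tendsto_log_atTop.comp (tendsto_atTop_mono' _ ?_ tendsto_id)
    filter_upwards [eventually_ge_atTop 0] with s hs
    exact le_gWarp hδ hs
  refine ⟨f, fun s => z (Real.log (gWarp δ s)), hf00, fun s hs => ?_, fun s _ => hz0 _,
    ⟨B, fun s hs => ?_⟩, fun s hs => ?_, fun s hs => ?_, ⟨α, ?_⟩, ⟨κ, ?_⟩, hz_top.comp hgtop, ?_⟩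
  · rw [hf s hs]; exact hφ0 _
  · rw [hf s hs]; exact hB _
  · have hcomp : HasDerivAt (fun s => φ (Real.log (gWarp δ s))) _ s :=
      (hφ (Real.log (gWarp δ s))).comp s (hlog s hs)
    have h2 := hcomp.congr_of_eventuallyEq (f₁ := f) (by
        filter_upwards [lt_mem_nhds hs] with t ht
        exact hf t ht)
    refine h2.congr_deriv ?_
    have := hg1 s hs
    rw [ha s hs, hf s hs]
    field_simp
  · have hcomp : HasDerivAt (fun s => z (Real.log (gWarp δ s))) _ s :=
      (hz (Real.log (gWarp δ s))).comp s (hlog s hs)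
    refine hcomp.congr_deriv ?_
    have h1 := hg1 s hs
    have h2 := (hg0 s hs).ne'
    have h3 : fluxFunDeriv ν p (z (Real.log (gWarp δ s))) ≠ 0 := by
      linarith [one_le_fluxFunDeriv hν hp (z (Real.log (gWarp δ s)))]
    rw [ha s hs, slopeDeriv, hf s hs]
    field_simp
  · refine (hα.comp hgtend).congr' ?_
    filter_upwards [self_mem_nhdsWithin] with s hs
    rw [hf s hs, Function.comp, Real.exp_neg, hexp s hs]
  · refine (hκ.comp hgtend).congr' ?_
    filter_upwards [self_mem_nhdsWithin] with s hs
    rw [Function.comp, Real.exp_neg, hexp s hs]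
  · refine (hza.comp hgtop).congr' ?_
    filter_upwards [eventually_gt_atTop 0] with s hs
    rw [Function.comp, ha s hs]

/-! ### Regularity at the pole and the `p`-harmonic equation in the radial variable. -/

section Radial

variable {ν p δ σ m : ℝ} {f Z : ℝ → ℝ}

/-- The second derivative of the profile. -/
def profileDeriv2 (ν p δ σ m : ℝ) (f Z : ℝ → ℝ) (s : ℝ) : ℝ :=
  jWarp σ (f s) / gWarp δ s *
    ((jWarp' σ (f s) * Z s - gWarp' δ s) / gWarp δ s * Z s + slopeDeriv ν p δ σ m f Z s)

/-- The logarithmic derivative of `y = j(f)/g` is `(j'(f) Z - g')/g`, since `f' = y Z`. -/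
theorem hasDerivAt_quot (hδ : 1 < δ) (hσ0 : 0 < σ) (hf0 : ∀ s, 0 < s → 0 < f s)
    (hf : ∀ s, 0 < s → HasDerivAt f (jWarp σ (f s) / gWarp δ s * Z s) s) {s : ℝ} (hs : 0 < s) :
    HasDerivAt (fun s => jWarp σ (f s) / gWarp δ s)
      (jWarp σ (f s) / gWarp δ s * ((jWarp' σ (f s) * Z s - gWarp' δ s) / gWarp δ s)) s := by
  have hg := (gWarp_pos hδ hs).ne'
  have hcomp : HasDerivAt (fun s => jWarp σ (f s)) _ s :=
    (hasDerivAt_jWarp hσ0 (hf0 s hs).le).comp s (hf s hs)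
  refine (hcomp.div (hasDerivAt_gWarp hδ hs.le) hg).congr_deriv ?_
  field_simp

theorem hasDerivAt_profileDeriv (hδ : 1 < δ) (hσ0 : 0 < σ) (hf0 : ∀ s, 0 < s → 0 < f s)
    (hf : ∀ s, 0 < s → HasDerivAt f (jWarp σ (f s) / gWarp δ s * Z s) s)
    (hZ : ∀ s, 0 < s → HasDerivAt Z (slopeDeriv ν p δ σ m f Z s) s) {s : ℝ} (hs : 0 < s) :
    HasDerivAt (fun s => jWarp σ (f s) / gWarp δ s * Z s) (profileDeriv2 ν p δ σ m f Z s) s := by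
  refine ((hasDerivAt_quot hδ hσ0 hf0 hf hs).mul (hZ s hs)).congr_deriv ?_
  rw [profileDeriv2]
  ring

theorem continuous_fluxFunDeriv (hν : 1 ≤ ν) : Continuous (fluxFunDeriv ν p) := by
  refine Continuous.mul ?_ (by fun_prop)
  refine Continuous.rpow_const (by fun_prop) fun z => Or.inl ?_
  have : 0 < z ^ 2 + ν := by positivity
  exact this.ne'

theorem continuous_fluxFun (hν : 1 ≤ ν) : Continuous (fluxFun ν p) :=
  continuous_iff_continuousAt.2 fun z => (hasDerivAt_fluxFun hν z).continuousAt

theorem continuous_sourceFun (hν : 1 ≤ ν) : Continuous (sourceFun ν p) :=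
  continuous_iff_continuousAt.2 fun z => (hasDerivAt_sourceFun hν z).continuousAt

theorem continuousOn_profileDeriv2 (hν : 1 ≤ ν) (hp : 2 < p) (hδ : 1 < δ) (hσ0 : 0 < σ)
    (hf0 : ∀ s, 0 < s → 0 < f s)
    (hf : ∀ s, 0 < s → HasDerivAt f (jWarp σ (f s) / gWarp δ s * Z s) s)
    (hZ : ∀ s, 0 < s → HasDerivAt Z (slopeDeriv ν p δ σ m f Z s) s) :
    ContinuousOn (profileDeriv2 ν p δ σ m f Z) (Set.Ioi 0) := by
  intro s hs
  have hs : 0 < s := hs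
  have hg := (gWarp_pos hδ hs).ne'
  have hF := one_le_fluxFunDeriv hν hp (Z s)
  have hfc := (hf s hs).continuousAt
  have hZc := (hZ s hs).continuousAt
  have hgc := (hasDerivAt_gWarp hδ hs.le).continuousAt
  have hg1c := (hasDerivAt_gWarp' hδ hs.le).continuousAt
  have hjc : ContinuousAt (fun s => jWarp' σ (f s)) s :=
    ContinuousAt.comp (g := jWarp' σ) (hasDerivAt_jWarp' hσ0 (hf0 s hs).le).continuousAt hfc
  have hFc : ContinuousAt (fun s => fluxFun ν p (Z s)) s :=
    (continuous_fluxFun hν).continuousAt.comp hZc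
  have hF'c : ContinuousAt (fun s => fluxFunDeriv ν p (Z s)) s :=
    (continuous_fluxFunDeriv hν).continuousAt.comp hZc
  have hSc : ContinuousAt (fun s => sourceFun ν p (Z s)) s :=
    (continuous_sourceFun hν).continuousAt.comp hZc
  have hslope : ContinuousAt (slopeDeriv ν p δ σ m f Z) s :=
    ((hjc.mul hSc).sub ((hg1c.const_mul m).mul hFc)).div (hF'c.mul hgc)
      (mul_ne_zero (by linarith) hg)
  exact ((hasDerivAt_quot hδ hσ0 hf0 hf hs).continuousAt.mul
    (((((hjc.mul hZc).sub hg1c).div hgc hg).mul hZc).add hslope)).continuousWithinAt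

/-- The profile is `C²` up to the pole. -/
theorem contDiffOn_profile (hν : 1 ≤ ν) (hp : 2 < p) (hm : m = ν + 1 - p) (hδ : 1 < δ)
    (hσ0 : 0 < σ) (hσ1 : σ < 1) (hf00 : f 0 = 0) (hf0 : ∀ s, 0 < s → 0 < f s)
    (hf : ∀ s, 0 < s → HasDerivAt f (jWarp σ (f s) / gWarp δ s * Z s) s)
    (hZ : ∀ s, 0 < s → HasDerivAt Z (slopeDeriv ν p δ σ m f Z s) s) {α κ : ℝ}
    (hα : Tendsto (fun s => f s * (gWarp δ s)⁻¹) (𝓝[>] 0) (𝓝 α))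
    (hκ : Tendsto (fun s => (Z s - 1) * (gWarp δ s)⁻¹) (𝓝[>] 0) (𝓝 κ)) :
    ContDiffOn ℝ 2 f (Set.Ici 0) := by
  have hg0 : ∀ s, 0 < s → gWarp δ s ≠ 0 := fun s hs => (gWarp_pos hδ hs).ne'
  have hgt : Tendsto (gWarp δ) (𝓝[>] 0) (𝓝 0) := by
    have := (hasDerivAt_gWarp hδ le_rfl).continuousAt.tendsto
    rw [gWarp_zero hδ] at this
    exact this.mono_left nhdsWithin_le_nhds
  have hmul : ∀ {u : ℝ → ℝ} {c : ℝ}, Tendsto (fun s => u s * (gWarp δ s)⁻¹) (𝓝[>] 0) (𝓝 c) →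
      Tendsto u (𝓝[>] 0) (𝓝 0) := by
    intro u c hu
    have := hu.mul hgt
    rw [mul_zero] at this
    refine this.congr' ?_
    filter_upwards [self_mem_nhdsWithin] with s hs
    have := hg0 s hs
    field_simp
  have hft : Tendsto f (𝓝[>] 0) (𝓝 0) := hmul hα
  have hZt : Tendsto Z (𝓝[>] 0) (𝓝 1) := by simpa using (hmul hκ).add_const 1
  have hsg : Tendsto (fun s => (s - 0) * (gWarp δ s)⁻¹) (𝓝[>] 0) (𝓝 1) := by
    have h1 := (hasDerivAt_iff_tendsto_slope.1 (hasDerivAt_gWarp hδ le_rfl)).mono_left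
      (nhdsWithin_mono 0 (fun s (hs : 0 < s) => hs.ne'))
    rw [gWarp'_zero hδ] at h1
    have h2 := h1.inv₀ one_ne_zero
    rw [inv_one] at h2
    refine h2.congr fun s => ?_
    rw [slope_def_field, gWarp_zero hδ, sub_zero, inv_div, div_eq_mul_inv]
  have hid : Tendsto (fun s : ℝ => s) (𝓝[>] 0) (𝓝 0) := tendsto_id.mono_left nhdsWithin_le_nhds
  have hα' : Tendsto (fun s => (f s - 0) * (gWarp δ s)⁻¹) (𝓝[>] 0) (𝓝 α) := by simpa using hα
  have hj := tendsto_sub_mul_of_hasDerivAt (hasDerivAt_jWarp hσ0 le_rfl) hft hα'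
  have hj1 := tendsto_sub_mul_of_hasDerivAt (hasDerivAt_jWarp' hσ0 le_rfl) hft hα'
  have hg1 := tendsto_sub_mul_of_hasDerivAt (hasDerivAt_gWarp' hδ le_rfl) hid hsg
  simp only [jWarp_zero hσ0, jWarp'_zero hσ0 hσ1, gWarp'_zero hδ, sub_zero, one_mul] at hj hj1 hg1
  -- Source minus `m` times flux vanishes at slope `1`, so this difference, divided by `g`, has a
  -- limit at the pole.
  have hS := tendsto_sub_mul_of_hasDerivAt
    ((hasDerivAt_sourceFun (p := p) hν 1).sub ((hasDerivAt_fluxFun (p := p) hν 1).const_mul m))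
    hZt hκ
  have hSF : sourceFun ν p 1 = m * fluxFun ν p 1 := by
    simp only [sourceFun, fluxFun, hm]; ring
  simp only [Pi.sub_apply, hSF, sub_self, sub_zero] at hS
  have hSc : Tendsto (fun s => sourceFun ν p (Z s)) (𝓝[>] 0) (𝓝 (sourceFun ν p 1)) :=
    ((continuous_sourceFun hν).tendsto 1).comp hZt
  have hFc : Tendsto (fun s => fluxFun ν p (Z s)) (𝓝[>] 0) (𝓝 (fluxFun ν p 1)) :=
    ((continuous_fluxFun hν).tendsto 1).comp hZt
  have hF'c : Tendsto (fun s => fluxFunDeriv ν p (Z s)) (𝓝[>] 0) (𝓝 (fluxFunDeriv ν p 1)) :=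
    ((continuous_fluxFunDeriv hν).tendsto 1).comp hZt
  have hF'1 : fluxFunDeriv ν p 1 ≠ 0 := by linarith [one_le_fluxFunDeriv hν hp 1]
  have hslope := (((hj1.mul hSc).add hS).sub ((hg1.mul hFc).const_mul m)).div hF'c hF'1
  -- The apparently singular quotients of `f''` are split as `j' Z - g' = (j' - 1) Z + (Z - 1) - (g'
  -- - 1)` and `j' S - m g' F = (j' - 1) S + (S - m F) - m (g' - 1) F`; each piece divided by `g`
  -- has a limit.
  refine contDiffOn_two_Ici hf (fun s hs => hasDerivAt_profileDeriv hδ hσ0 hf0 hf hZ hs)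
    (continuousOn_profileDeriv2 hν hp hδ hσ0 hf0 hf hZ) (by rwa [hf00]) (hj.mul hZt)
    ((hj.mul (((((hj1.mul hZt).add hκ).sub hg1).mul hZt).add hslope)).congr' ?_)
  filter_upwards [self_mem_nhdsWithin] with s hs
  have h1 := hg0 s hs
  have h2 : fluxFunDeriv ν p (Z s) ≠ 0 := by linarith [one_le_fluxFunDeriv hν hp (Z s)]
  simp only [profileDeriv2, slopeDeriv, Pi.div_apply]
  field_simp
  ring

/-- The conformal factor `|dF|^(p-2)` of the map with profile `f`. -/
def energyFactor (ν p δ σ : ℝ) (f Z : ℝ → ℝ) (s : ℝ) : ℝ :=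
  (jWarp σ (f s) / gWarp δ s) ^ (p - 2) * (Z s ^ 2 + ν) ^ ((p - 2) / 2)

theorem energyFactor_eq (hν : 1 ≤ ν) (hδ : 1 < δ) (hσ0 : 0 < σ) (hf0 : ∀ s, 0 < s → 0 < f s)
    {s : ℝ} (hs : 0 < s) :
    energyFactor ν p δ σ f Z s = Real.sqrt ((jWarp σ (f s) / gWarp δ s * Z s) ^ 2
      + ν * (jWarp σ (f s) ^ 2 / gWarp δ s ^ 2)) ^ (p - 2) := by
  have hy : 0 < jWarp σ (f s) / gWarp δ s := div_pos (jWarp_pos hσ0 (hf0 s hs)) (gWarp_pos hδ hs)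
  have h1 : (jWarp σ (f s) / gWarp δ s * Z s) ^ 2 + ν * (jWarp σ (f s) ^ 2 / gWarp δ s ^ 2)
      = (jWarp σ (f s) / gWarp δ s) ^ 2 * (Z s ^ 2 + ν) := by rw [← div_pow]; ring
  rw [h1, Real.sqrt_mul (by positivity), Real.sqrt_sq hy.le,
    Real.mul_rpow hy.le (Real.sqrt_nonneg _), energyFactor, Real.sqrt_eq_rpow, ← Real.rpow_mul
    (by positivity), show 1 / 2 * (p - 2) = (p - 2) / 2 by ring]

/-- The radial part of the `p`-tension field vanishes. -/
theorem exists_deriv_energyFactor (hν : 1 ≤ ν) (hp : 2 < p) (hm : m = ν + 1 - p) (hδ : 1 < δ)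
    (hσ0 : 0 < σ) (hf0 : ∀ s, 0 < s → 0 < f s)
    (hf : ∀ s, 0 < s → HasDerivAt f (jWarp σ (f s) / gWarp δ s * Z s) s)
    (hZ : ∀ s, 0 < s → HasDerivAt Z (slopeDeriv ν p δ σ m f Z s) s) {s : ℝ} (hs : 0 < s) :
    ∃ L', HasDerivAt (energyFactor ν p δ σ f Z) L' s ∧
      L' * (jWarp σ (f s) / gWarp δ s * Z s)
        + energyFactor ν p δ σ f Z s * profileDeriv2 ν p δ σ m f Z s
        + ν * (gWarp' δ s / gWarp δ s) * (energyFactor ν p δ σ f Z s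
          * (jWarp σ (f s) / gWarp δ s * Z s))
        - ν * energyFactor ν p δ σ f Z s * jWarp σ (f s) * jWarp' σ (f s) / gWarp δ s ^ 2 = 0 := by
  have hg := (gWarp_pos hδ hs).ne'
  have hy : 0 < jWarp σ (f s) / gWarp δ s := div_pos (jWarp_pos hσ0 (hf0 s hs)) (gWarp_pos hδ hs)
  have hcomp : HasDerivAt (fun s => (Z s ^ 2 + ν) ^ ((p - 2) / 2)) _ s :=
    (hasDerivAt_rpow_sq_add (p := p) hν (Z s)).comp s (hZ s hs)
  refine ⟨_, ((hasDerivAt_quot hδ hσ0 hf0 hf hs).rpow_const (p := p - 2) (Or.inl hy.ne')).mul hcomp,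
    ?_⟩
  have hF' : fluxFunDeriv ν p (Z s) ≠ 0 := by linarith [one_le_fluxFunDeriv hν hp (Z s)]
  have hZ1 : slopeDeriv ν p δ σ m f Z s * fluxFunDeriv ν p (Z s)
      = (jWarp' σ (f s) * sourceFun ν p (Z s) - m * gWarp' δ s * fluxFun ν p (Z s))
        / gWarp δ s := by
    rw [slopeDeriv]; field_simp
  rw [fluxFunDeriv, sourceFun, fluxFun, rpow_sub_one_mul hν] at hZ1
  have hj : jWarp σ (f s) = jWarp σ (f s) / gWarp δ s * gWarp δ s := by field_simp
  rw [profileDeriv2, energyFactor, rpow_sub_one_mul hν, Real.rpow_sub_one hy.ne']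
  -- With the powers and warping values frozen as independent symbols, the claim is a rational
  -- identity following from the equation for `Z'`.
  generalize (jWarp σ (f s) / gWarp δ s) ^ (p - 2) = Y
  generalize (Z s ^ 2 + ν) ^ ((p - 2) / 2 - 1) = W at *
  generalize slopeDeriv ν p δ σ m f Z s = Z1 at *
  generalize jWarp σ (f s) / gWarp δ s = y at *
  rw [hj, hm] at *
  generalize jWarp' σ (f s) = J at *
  generalize gWarp' δ s = g1 at *
  generalize gWarp δ s = g at *
  have e1 : ∀ A, y * (A / g) * (p - 2) * (Y / y) = (p - 2) * Y * (A / g) := fun A => by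
    field_simp
  have e2 : ∀ A, ν * A * (y * g) * J / g ^ 2 = ν * A * y * (J / g) := fun A => by
    field_simp
  rw [e1, e2]
  linear_combination (Y * y) * hZ1

end Radial

/-! ### The sign of the radial expression at infinity. -/

section Main

variable {ν p δ σ m : ℝ} {f Z : ℝ → ℝ}

/-- Along the solution, `(p-1) f'' + n (g'/g) f'` is asymptotic to `-m (p-2) (g'/g) f'`; this
dominates the term coming from any radial function composed with the map. -/
theorem eventually_radial_neg (hν : 1 ≤ ν) (hp : 2 < p) (hm : m = ν + 1 - p) (hm0 : 0 < m)
    (hδ : 1 < δ) (hσ0 : 0 < σ) (hσ1 : σ < 1) (hf0 : ∀ s, 0 < s → 0 < f s)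
    (hZ0 : ∀ s, 0 < s → 0 < Z s) {B : ℝ} (hB : ∀ s, 0 < s → f s ≤ B)
    (hZ_top : Tendsto Z atTop (𝓝 0)) (hgZ : Tendsto (fun s => (gWarp' δ s)⁻¹ / Z s) atTop (𝓝 0))
    {K : ℝ → ℝ} {C : ℝ} (hK : ∀ᶠ s in atTop, |K s| ≤ C) :
    ∀ᶠ s in atTop, (p - 1) * (K s * (jWarp σ (f s) / gWarp δ s * Z s) ^ 2
      + profileDeriv2 ν p δ σ m f Z s)
      + ν * (gWarp' δ s / gWarp δ s) * (jWarp σ (f s) / gWarp δ s * Z s) < 0 := by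
  -- Here `1/g'` is the product of `1/(g' Z)` and `Z`, both tending to `0`.
  have hginv : Tendsto (fun s => (gWarp' δ s)⁻¹) atTop (𝓝 0) := by
    have := hgZ.mul hZ_top
    rw [mul_zero] at this
    refine this.congr' ?_
    filter_upwards [eventually_gt_atTop 0] with s hs
    have := (hZ0 s hs).ne'
    field_simp
  have hbj : ∀ᶠ s in atTop, |jWarp' σ (f s)| ≤ 1 := by
    filter_upwards [eventually_gt_atTop 0] with s hs
    rw [abs_of_pos (jWarp'_pos hσ0 (hf0 s hs).le)]
    exact jWarp'_le_one hσ0 hσ1 (hf0 s hs).le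
  have hbK : ∀ᶠ s in atTop, |K s * jWarp σ (f s)| ≤ C * B := by
    filter_upwards [eventually_gt_atTop 0, hK] with s hs hKs
    rw [abs_mul, abs_of_pos (jWarp_pos hσ0 (hf0 s hs))]
    exact mul_le_mul hKs ((jWarp_le hσ0 hσ1 (hf0 s hs).le).trans (hB s hs))
      (jWarp_pos hσ0 (hf0 s hs)).le ((abs_nonneg _).trans hKs)
  have hT1 : Tendsto (fun s => (gWarp' δ s)⁻¹ * Z s * (K s * jWarp σ (f s))) atTop (𝓝 0) := by
    have h := hginv.mul hZ_top
    rw [mul_zero] at h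
    exact h.zero_mul_isBoundedUnder_le (isBoundedUnder_of_eventually_le hbK)
  have hT2 : Tendsto (fun s => (gWarp' δ s)⁻¹ * Z s * jWarp' σ (f s)) atTop (𝓝 0) := by
    have h := hginv.mul hZ_top
    rw [mul_zero] at h
    exact h.zero_mul_isBoundedUnder_le (isBoundedUnder_of_eventually_le hbj)
  have hT3 : Tendsto (fun s => (gWarp' δ s)⁻¹ / Z s * jWarp' σ (f s)) atTop (𝓝 0) :=
    hgZ.zero_mul_isBoundedUnder_le (isBoundedUnder_of_eventually_le hbj)
  have hW : ∀ z : ℝ, 0 < z ^ 2 + ν := fun z => by positivity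
  have hF' : ∀ z, fluxFunDeriv ν p z ≠ 0 := fun z => by linarith [one_le_fluxFunDeriv hν hp z]
  have hS : Tendsto (fun s => sourceFun ν p (Z s) / fluxFunDeriv ν p (Z s)) atTop
      (𝓝 (sourceFun ν p 0 / fluxFunDeriv ν p 0)) :=
    (((continuous_sourceFun hν).div (continuous_fluxFunDeriv hν) hF').tendsto 0).comp hZ_top
  have hE : Tendsto (fun s => (Z s ^ 2 + ν) / ((p - 1) * Z s ^ 2 + ν)) atTop (𝓝 1) := by
    have h1 := ((hZ_top.pow 2).add_const ν).div (((hZ_top.pow 2).const_mul (p - 1)).add_const ν)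
      (by simp only [ne_eq, OfNat.ofNat_ne_zero, not_false_eq_true, zero_pow, mul_zero, zero_add]
          linarith)
    have h2 : (0 ^ 2 + ν) / ((p - 1) * 0 ^ 2 + ν) = 1 := by
      have hν0 : ν ≠ 0 := by linarith
      simp [hν0]
    rw [h2] at h1
    exact h1
  -- This is the expression divided by the positive factor `f' g'/g`. Its limit is `(p-1)(-1-m) + ν
  -- = -m(p-2)`: the `-1` comes from `y'`, the `-m` from `Z'`.
  have hlim := ((((hT1.add hT2).sub_const 1).add ((hT3.mul hS).sub (hE.const_mul m))).const_mul
    (p - 1)).add_const ν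
  have hneg : (p - 1) * (0 + 0 - 1 + (0 * (sourceFun ν p 0 / fluxFunDeriv ν p 0) - m * 1)) + ν
      < 0 := by
    rw [hm] at hm0 ⊢
    nlinarith
  filter_upwards [hlim.eventually (gt_mem_nhds hneg), eventually_gt_atTop 0] with s hlt hs
  have hg := gWarp_pos hδ hs
  have hg1 : 0 < gWarp' δ s := by linarith [one_le_gWarp' hδ hs.le]
  have hZs := hZ0 s hs
  have hjs := jWarp_pos hσ0 (hf0 s hs)
  have hpos : 0 < jWarp σ (f s) / gWarp δ s * Z s * (gWarp' δ s / gWarp δ s) := by positivity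
  have hmul := mul_neg_of_pos_of_neg hpos hlt
  refine lt_of_eq_of_lt ?_ hmul
  have hq : 0 < (p - 1) * Z s ^ 2 + ν := by
    have := mul_nonneg (show 0 ≤ p - 1 by linarith) (sq_nonneg (Z s)); linarith
  have hw := Real.rpow_pos_of_pos (hW (Z s)) ((p - 2) / 2 - 1)
  rw [profileDeriv2, slopeDeriv, fluxFun, sourceFun, fluxFunDeriv, rpow_sub_one_mul hν]
  generalize (Z s ^ 2 + ν) ^ ((p - 2) / 2 - 1) = W at *
  field_simp
  ring

theorem contDiffOn_rotSym {n : ℕ} (hf : ContDiffOn ℝ 2 f (Set.Ici 0)) :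
    ContDiffOn ℝ 2 (fun x : EuclideanSpace ℝ (Fin (n + 1)) => (f ‖x‖ / ‖x‖) • x) {0}ᶜ := by
  intro x hx
  have hx : x ≠ 0 := hx
  have hr : 0 < ‖x‖ := norm_pos_iff.mpr hx
  have hnorm := contDiffAt_norm (n := 2) ℝ hx
  have h1 : ContDiffAt ℝ 2 (fun x : EuclideanSpace ℝ (Fin (n + 1)) => f ‖x‖) x :=
    (hf.contDiffAt (Ici_mem_nhds hr)).comp x hnorm
  exact ((h1.div hnorm hr.ne').smul contDiffAt_id).contDiffWithinAt

/-- The derivatives of a `C²` function on `[0, ∞)` at interior points. -/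
theorem hasDerivAt_of_contDiffOn {h : ℝ → ℝ} (hh : ContDiffOn ℝ 2 h (Set.Ici 0)) :
    (∀ t, 0 < t → HasDerivAt h (deriv h t) t) ∧
      (∀ t, 0 < t → HasDerivAt (deriv h) (deriv (deriv h) t) t) ∧
      ContinuousOn (deriv (deriv h)) (Set.Ioi 0) := by
  have h1 := hh.mono Set.Ioi_subset_Ici_self
  rw [show (2 : WithTop ℕ∞) = 1 + 1 from rfl, contDiffOn_succ_iff_deriv_of_isOpen isOpen_Ioi] at h1
  have h2 := h1.2.2
  rw [show (1 : WithTop ℕ∞) = 0 + 1 from rfl, contDiffOn_succ_iff_deriv_of_isOpen isOpen_Ioi] at h2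
  exact ⟨fun t ht => (h1.1.differentiableAt (Ioi_mem_nhds ht)).hasDerivAt,
    fun t ht => (h2.1.differentiableAt (Ioi_mem_nhds ht)).hasDerivAt, h2.2.2.continuousOn⟩

end Main

end PHarm

end

theorem theorem1p1 (n : ℕ) (p δ σ : ℝ)
    (hp : max 2 (n : ℝ) < p) (hpn : p < (n : ℝ) + 1)
    (hδ : (p - (n : ℝ))⁻¹ < δ) (hσ0 : 0 < σ) (hσ1 : σ < 1) :
    ∃ (F : EuclideanSpace ℝ (Fin (n + 1)) → EuclideanSpace ℝ (Fin (n + 1))) (f : ℝ → ℝ),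
      PHarm.IsRotSymMap n F f ∧
      PHarm.IsPHarmonicOn p (PHarm.warpedMetric n (PHarm.gWarp δ)) {0}ᶜ
        (PHarm.warpedMetric n (PHarm.jWarp σ)) {0}ᶜ F ∧
      (∃ s : ℕ → ℝ, (∀ k, 0 < s k) ∧ Filter.Tendsto s Filter.atTop Filter.atTop ∧
        ∀ (H : EuclideanSpace ℝ (Fin (n + 1)) → ℝ) (h : ℝ → ℝ),
          PHarm.IsRotSymFun n H h →
          PHarm.IsConvexOn (PHarm.warpedMetric n (PHarm.jWarp σ)) {0}ᶜ H →
          (∀ t, 0 < t → 0 < deriv h t) →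
          ∀ᶠ k in Filter.atTop,
            ∀ θ ∈ Metric.sphere (0 : EuclideanSpace ℝ (Fin (n + 1))) 1,
              PHarm.pLaplacian p (PHarm.warpedMetric n (PHarm.gWarp δ)) (H ∘ F) (s k • θ) < 0) ∧
      (∃ (H : EuclideanSpace ℝ (Fin (n + 1)) → ℝ) (h : ℝ → ℝ),
          PHarm.IsRotSymFun n H h ∧
          PHarm.IsConvexOn (PHarm.warpedMetric n (PHarm.jWarp σ)) {0}ᶜ H ∧
          (∀ t, 0 < t → 0 < deriv h t) ∧
          ¬ ∀ x ∈ ({0}ᶜ : Set (EuclideanSpace ℝ (Fin (n + 1)))),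
            0 ≤ PHarm.pLaplacian p (PHarm.warpedMetric n (PHarm.gWarp δ)) (H ∘ F) x) := by
  open PHarm Filter Topology in
  obtain ⟨hp2, hpn'⟩ := max_lt_iff.1 hp
  have hν : (1 : ℝ) ≤ n := by linarith
  obtain ⟨m, hm⟩ : ∃ m : ℝ, m = n + 1 - p := ⟨_, rfl⟩
  have hm0 : 0 < m := by linarith
  have hpn0 : 0 < p - n := by linarith
  have hδ1 : 1 < δ := ((one_lt_inv₀ hpn0).2 (by linarith)).trans hδ
  -- Equivalent to `1/δ < p - n = 1 - m`.
  have hmδ : m < (δ - 1) / δ := by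
    rw [inv_lt_comm₀ hpn0 (by linarith)] at hδ
    rw [sub_div, div_self (by linarith), one_div]
    linarith
  obtain ⟨f, Z, hf00, hf0, hZ0, ⟨B, hB⟩, hf, hZ, ⟨α, hα⟩, ⟨κ, hκ⟩, hZ_top, hgZ⟩ :=
    exists_radial_profile hν hp2 hm hm0 hδ1 hmδ hσ0 hσ1
  have hf1pos : ∀ s, 0 < s → 0 < jWarp σ (f s) / gWarp δ s * Z s := fun s hs =>
    mul_pos (div_pos (jWarp_pos hσ0 (hf0 s hs)) (gWarp_pos hδ1 hs)) (hZ0 s hs)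
  have hf2 : ∀ s, 0 < s → HasDerivAt (fun s => jWarp σ (f s) / gWarp δ s * Z s)
      (profileDeriv2 n p δ σ m f Z s) s := fun s hs =>
    hasDerivAt_profileDeriv hδ1 hσ0 hf0 hf hZ hs
  have hfC2 := contDiffOn_profile hν hp2 hm hδ1 hσ0 hσ1 hf00 hf0 hf hZ hα hκ
  have hfmono : ∀ s, 1 ≤ s → f 1 ≤ f s := by
    have h1 : MonotoneOn f (Set.Ici 1) := monotoneOn_of_hasDerivWithinAt_nonneg (convex_Ici 1)
      (fun t (ht : 1 ≤ t) => (hf t (by linarith)).continuousAt.continuousWithinAt)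
      (fun t ht => (hf t (by
        have : 1 ≤ t := interior_subset (s := Set.Ici (1 : ℝ)) ht
        linarith)).hasDerivWithinAt)
      (fun t ht => (hf1pos t (by
        have : 1 ≤ t := interior_subset (s := Set.Ici (1 : ℝ)) ht
        linarith)).le)
    exact fun s hs => h1 Set.self_mem_Ici hs hs
  -- At the pole the formula gives the zero vector whatever the value of the quotient.
  let F : EuclideanSpace ℝ (Fin (n + 1)) → EuclideanSpace ℝ (Fin (n + 1)) :=
    fun x => (f ‖x‖ / ‖x‖) • x
  have hFnorm : ∀ x, x ≠ 0 → ‖F x‖ = f ‖x‖ := fun x hx =>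
    norm_radial (hf0 _ (norm_pos_iff.mpr hx)) hx rfl
  have hmain : ∀ (H : EuclideanSpace ℝ (Fin (n + 1)) → ℝ) (h : ℝ → ℝ), IsRotSymFun n H h →
      (∀ t, 0 < t → 0 < deriv h t) → ∀ᶠ s in atTop,
        ∀ x : EuclideanSpace ℝ (Fin (n + 1)), ‖x‖ = s →
          pLaplacian p (warpedMetric n (gWarp δ)) (H ∘ F) x < 0 := by
    intro H h hH hh
    obtain ⟨hd1, hd2, hd3⟩ := hasDerivAt_of_contDiffOn hH.1
    have hHF : ∀ y, y ≠ 0 → (H ∘ F) y = h (f ‖y‖) := by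
      intro y hy
      have hr : 0 < ‖y‖ := norm_pos_iff.mpr hy
      have h1 := hH.2 (f ‖y‖) (hf0 _ hr) (‖y‖⁻¹ • y) (by
        rw [mem_sphere_zero_iff_norm, norm_smul, norm_inv, norm_norm, inv_mul_cancel₀ hr.ne'])
      rw [smul_smul] at h1
      exact h1
    -- For `s ≥ 1` the increasing bounded profile stays in `[f(1), B]`, a compact subset of `(0,∞)`,
    -- so `h''/h'` is bounded along it.
    obtain ⟨C, hC⟩ : ∃ C, ∀ t ∈ Set.Icc (f 1) B, ‖deriv (deriv h) t / deriv h t‖ ≤ C := by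
      refine isCompact_Icc.exists_bound_of_continuousOn fun t ht => ?_
      have ht : 0 < t := (hf0 1 one_pos).trans_le ht.1
      exact ((hd3.continuousAt (Ioi_mem_nhds ht)).div (hd2 t ht).continuousAt
        (hh t ht).ne').continuousWithinAt
    have hneg := eventually_radial_neg hν hp2 hm hm0 hδ1 hσ0 hσ1 hf0 hZ0 hB hZ_top hgZ
      (K := fun s => deriv (deriv h) (f s) / deriv h (f s)) (C := C) (by
        filter_upwards [eventually_ge_atTop 1] with s hs
        exact hC (f s) ⟨hfmono s hs, hB s (by linarith)⟩)
    filter_upwards [hneg, eventually_gt_atTop 0] with s hs hs0 x hx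
    have hx0 : x ≠ 0 := by
      rw [← norm_pos_iff, hx]; exact hs0
    have hu : ∀ s, 0 < s → HasDerivAt (fun s => h (f s))
        (deriv h (f s) * (jWarp σ (f s) / gWarp δ s * Z s)) s := fun s hs =>
      (hd1 (f s) (hf0 s hs)).comp s (hf s hs)
    have hv : HasDerivAt (fun s => deriv h (f s) * (jWarp σ (f s) / gWarp δ s * Z s)) _ s :=
      ((hd2 (f s) (hf0 s hs0)).comp s (hf s hs0)).mul (hf2 s hs0)
    have hpos := mul_pos (hh (f s) (hf0 s hs0)) (hf1pos s hs0)
    rw [pLaplacian_radial p hHF (fun s hs => gWarp_pos hδ1 hs) hu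
      (fun s hs => mul_pos (hh (f s) (hf0 s hs)) (hf1pos s hs)) hx0
      (hasDerivAt_gWarp hδ1 (norm_nonneg x)) (hx ▸ hv), hx]
    refine mul_neg_of_pos_of_neg (Real.rpow_pos_of_pos hpos _) ?_
    have hd := hh (f s) (hf0 s hs0)
    refine lt_of_eq_of_lt ?_ (mul_neg_of_pos_of_neg hd hs)
    simp only [Function.comp]
    field_simp
  have hsph : ∀ s : ℝ, 0 < s → ∀ θ ∈ Metric.sphere (0 : EuclideanSpace ℝ (Fin (n + 1))) 1,
      ‖s • θ‖ = s := fun s hs θ hθ => by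
    rw [norm_smul, mem_sphere_zero_iff_norm.1 hθ, mul_one, Real.norm_of_nonneg hs.le]
  -- The sign holds for all large `s`, so any positive sequence tending to infinity serves.
  have hseq : Tendsto (fun k : ℕ => (k : ℝ) + 1) atTop atTop :=
    tendsto_atTop_add_const_right _ _ tendsto_natCast_atTop_atTop
  refine ⟨F, f, ⟨hfC2, fun s hs => ?_, fun s hs θ hθ => ?_⟩, ⟨fun x hx => ?_, contDiffOn_rotSym hfC2,
    fun x hx a => ?_⟩, ⟨fun k => (k : ℝ) + 1, fun k => by positivity, hseq, ?_⟩, ?_⟩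
  · rcases eq_or_lt_of_le hs with rfl | hs
    · exact hf00.ge
    · exact (hf0 s hs).le
  · rcases eq_or_lt_of_le hs with rfl | hs
    · simp [F, hf00]
    · simp only [F, hsph s hs θ hθ, smul_smul]
      rw [div_mul_cancel₀ _ hs.ne']
  · rw [Set.mem_compl_singleton_iff] at hx ⊢
    rw [← norm_pos_iff, hFnorm x hx]
    exact hf0 _ (norm_pos_iff.mpr hx)
  · rw [Set.mem_compl_singleton_iff] at hx
    have hr : 0 < ‖x‖ := norm_pos_iff.mpr hx
    obtain ⟨L', hL', hL0⟩ := exists_deriv_energyFactor hν hp2 hm hδ1 hσ0 hf0 hf hZ hr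
    rw [pTension_rotSym p (fun y _ => rfl) (fun s hs => gWarp_pos hδ1 hs)
      (fun t ht => jWarp_pos hσ0 ht) hf0 hf (fun s hs => energyFactor_eq hν hδ1 hσ0 hf0 hs) hx
      (hasDerivAt_gWarp hδ1 hr.le) (hasDerivAt_jWarp hσ0 (hf0 _ hr).le) hL' (hf2 _ hr), hL0,
      zero_mul]
  · intro H h hH _ hh
    filter_upwards [hseq.eventually (hmain H h hH hh)] with k hk θ hθ
    exact hk _ (hsph _ (by positivity) θ hθ)
  -- The witness is the distance to the pole, convex because `j' > 0`.
  · have hid : IsRotSymFun n (fun x => ‖x‖) id := ⟨contDiffOn_id, fun t ht θ hθ => hsph t ht θ hθ⟩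
    have hid' : ∀ t : ℝ, 0 < t → 0 < deriv id t := fun t _ => by simp
    refine ⟨fun x => ‖x‖, id, hid, isConvexOn_norm (fun s hs => jWarp_pos hσ0 hs)
      (fun s hs => hasDerivAt_jWarp hσ0 hs.le) (fun s hs => (jWarp'_pos hσ0 hs.le).le), hid',
      fun hall => ?_⟩
    obtain ⟨s, hs, hs0⟩ := ((hmain _ _ hid hid').and (eventually_gt_atTop 0)).exists
    have hx : ‖EuclideanSpace.single (0 : Fin (n + 1)) s‖ = s := by
      rw [PiLp.norm_single, Real.norm_of_nonneg hs0.le]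
    refine absurd (hall _ ?_) (not_le.2 (hs _ hx))
    rw [Set.mem_compl_singleton_iff, ← norm_pos_iff, hx]
    exact hs0
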